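/- Theorem. A 1-bend RAC drawing of a finite simple graph $G$ places the vertices at distinct points of the plane and draws every edge as a polyline consisting of one or two straight-line segments, without self-intersections and containing no vertex other than its two endpoints, such that every common point of two distinct edges is either a common endpoint of the two edges or a crossing, that is, a point interior to a segment of each of them, where these two segments are orthogonal. We consider drawings in which all vertices and bends are points of the grid $\mathbb{Z}^2$; the area of such a drawing is measured by the number $(w+1)(h+1)$ of grid points in its smallest enclosing axis-parallel rectangle, where $w$ and $h$ are the width and the height of the rectangle. There is an algorithm that, given a simple graph $G$ (not necessarily connected) with $n$ vertices and maximum degree at most $4$, computes in $O(n)$ time a 1-bend RAC drawing of $G$ with all vertices and bends on the grid and with $O(n^2)$ area. Precisely: there are a program $P$ for a random access machine and a constant $C$ such that for every $n \ge 0$, every simple graph $G$ on the vertex set $\{0,\dots,n-1\}$ with maximum degree at most $4$, and every list of the edges of $G$ (each edge exactly once, in arbitrary order and orientation), the program $P$, started with $n$, the number of edges and the edge list in its memory, halts after at most $C(n+1)$ elementary steps, never uses a number of absolute value larger than $C(n+1)$ (so that words of $O(\log n)$ bits suffice), and outputs the integer coordinates of all vertices and, for every edge, whether it has a bend and the integer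 coordinates of the bend, of a 1-bend RAC drawing of $G$ of area at most $C(n+1)^2$. The elementary operations, each taking one step, are reading and writing variables and array cells, addition and subtraction of integers, comparisons, Boolean connectives, and branching. -/

import Mathlib

namespace OneBendRAC

/-! ### Grid drawings with at most one bend per edge -/

/-- A point of the integer grid. -/
abbrev GridPoint := ℤ × ℤ

/-- The grid point as a point of the real plane. -/
def toPlane (p : GridPoint) : ℝ × ℝ := ((p.1 : ℝ), (p.2 : ℝ))

/-- The closed straight-line segment between two grid points. -/
def closedSeg (s : GridPoint × GridPoint) : Set (ℝ × ℝ) :=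
  segment ℝ (toPlane s.1) (toPlane s.2)

/-- The relative interior of the segment between two (distinct) grid points. -/
def openSeg (s : GridPoint × GridPoint) : Set (ℝ × ℝ) :=
  openSegment ℝ (toPlane s.1) (toPlane s.2)

/-- The directions of the two segments are orthogonal. -/
def Perp (s t : GridPoint × GridPoint) : Prop :=
  (s.2.1 - s.1.1) * (t.2.1 - t.1.1) + (s.2.2 - s.1.2) * (t.2.2 - t.1.2) = 0

/-- The data of a polyline drawing with at most one bend per edge in which vertices and bends are
grid points: a position for each vertex and, for each edge, either no bend or the position of its
only bend.  (Values of `bend` on pairs that are not edges are irrelevant.) -/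
structure Drawing (V : Type*) where
  pos : V → GridPoint
  bend : Sym2 V → Option GridPoint

namespace Drawing

variable {V : Type*}

/-- The straight-line segments of which the drawing of the edge `uv` consists, from `u` to `v`. -/
def pieces (Γ : Drawing V) (u v : V) : List (GridPoint × GridPoint) :=
  match Γ.bend s(u, v) with
  | none => [(Γ.pos u, Γ.pos v)]
  | some b => [(Γ.pos u, b), (b, Γ.pos v)]

/-- The polyline representing the edge `uv`. -/
def curve (Γ : Drawing V) (u v : V) : Set (ℝ × ℝ) :=
  {x | ∃ s ∈ Γ.pieces u v, x ∈ closedSeg s}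

/-- `Γ` is a 1-bend RAC drawing of `G`: distinct vertices are distinct points, every edge is a
non-self-intersecting polyline with at most one bend which meets no vertex other than its ends, and
each common point of two distinct edges either is a common endpoint of the two edges, or is an
interior point of a segment of the one and of a segment of the other, and these segments are
orthogonal. -/
structure IsOneBendRAC (Γ : Drawing V) (G : SimpleGraph V) : Prop where
  pos_injective : Function.Injective Γ.pos
  bend_ne : ∀ u v b, G.Adj u v → Γ.bend s(u, v) = some b → b ≠ Γ.pos u ∧ b ≠ Γ.pos v
  bend_simple : ∀ u v b, G.Adj u v → Γ.bend s(u, v) = some b →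
    closedSeg (Γ.pos u, b) ∩ closedSeg (b, Γ.pos v) = {toPlane b}
  avoids_vertices : ∀ u v w, G.Adj u v → toPlane (Γ.pos w) ∈ Γ.curve u v → w = u ∨ w = v
  right_angle_crossings : ∀ u v u' v', G.Adj u v → G.Adj u' v' → s(u, v) ≠ s(u', v') →
    ∀ x, x ∈ Γ.curve u v → x ∈ Γ.curve u' v' →
      (∃ w, w ∈ s(u, v) ∧ w ∈ s(u', v') ∧ x = toPlane (Γ.pos w)) ∨
      (∃ s ∈ Γ.pieces u v, ∃ t ∈ Γ.pieces u' v', x ∈ openSeg s ∧ x ∈ openSeg t ∧ Perp s t)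

/-- All vertices and bends (hence the whole drawing) lie in an axis-parallel rectangle of width `w`
and height `h` which contains at most `A` grid points, i.e. `(w + 1) * (h + 1) ≤ A`. -/
def HasAreaAtMost (Γ : Drawing V) (G : SimpleGraph V) (A : ℕ) : Prop :=
  ∃ (x₀ y₀ : ℤ) (w h : ℕ),
    (∀ v, Γ.pos v ∈ Set.Icc x₀ (x₀ + w) ×ˢ Set.Icc y₀ (y₀ + h)) ∧
    (∀ u v b, G.Adj u v → Γ.bend s(u, v) = some b →
      b ∈ Set.Icc x₀ (x₀ + w) ×ˢ Set.Icc y₀ (y₀ + h)) ∧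
    (w + 1) * (h + 1) ≤ A

end Drawing

/-! ### Random access machine with bounded words

Structured programs working on finitely many integer variables and arrays with random access.
Each elementary operation takes one step.  A word holds an integer of absolute value at most `B`:
a computation in which some intermediate value does not fit into a word has no execution. -/

/-- A memory state: integer variables, and arrays indexed by natural numbers. -/
structure State where
  var : ℕ → ℤ
  arr : ℕ → ℕ → ℤ

/-- The state with variable `x` set to `z`. -/
def State.setVar (σ : State) (x : ℕ) (z : ℤ) : State :=
  { σ with var := Function.update σ.var x z }

/-- The state with cell `i` of array `a` set to `z`. -/
def State.setArr (σ : State) (a i : ℕ) (z : ℤ) : State :=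
  { σ with arr := Function.update σ.arr a (Function.update (σ.arr a) i z) }

/-- Integer expressions: constants, variables, array cells, sums and differences. -/
inductive Expr where
  | lit (z : ℤ)
  | var (x : ℕ)
  | get (a : ℕ) (i : Expr)
  | add (e f : Expr)
  | sub (e f : Expr)

namespace Expr

def eval (σ : State) : Expr → ℤ
  | lit z => z
  | var x => σ.var x
  | get a i => σ.arr a (i.eval σ).toNat
  | add e f => e.eval σ + f.eval σ
  | sub e f => e.eval σ - f.eval σ

/-- The value of the expression and of all its subexpressions fit into a word, and array indices are
nonnegative. -/
def Fits (B : ℕ) (σ : State) : Expr → Prop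
  | lit z => |z| ≤ B
  | var x => |σ.var x| ≤ B
  | get a i => i.Fits B σ ∧ 0 ≤ i.eval σ ∧ |σ.arr a (i.eval σ).toNat| ≤ B
  | add e f => e.Fits B σ ∧ f.Fits B σ ∧ |e.eval σ + f.eval σ| ≤ B
  | sub e f => e.Fits B σ ∧ f.Fits B σ ∧ |e.eval σ - f.eval σ| ≤ B

/-- Number of steps taken by the evaluation. -/
def cost : Expr → ℕ
  | lit _ => 1
  | var _ => 1
  | get _ i => i.cost + 1
  | add e f => e.cost + f.cost + 1
  | sub e f => e.cost + f.cost + 1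

end Expr

/-- Boolean tests. -/
inductive Test where
  | le (e f : Expr)
  | eq (e f : Expr)
  | not (p : Test)
  | and (p q : Test)

namespace Test

def Holds (σ : State) : Test → Prop
  | le e f => e.eval σ ≤ f.eval σ
  | eq e f => e.eval σ = f.eval σ
  | not p => ¬ p.Holds σ
  | and p q => p.Holds σ ∧ q.Holds σ

def Fits (B : ℕ) (σ : State) : Test → Prop
  | le e f => e.Fits B σ ∧ f.Fits B σ
  | eq e f => e.Fits B σ ∧ f.Fits B σ
  | not p => p.Fits B σ
  | and p q => p.Fits B σ ∧ q.Fits B σ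

def cost : Test → ℕ
  | le e f => e.cost + f.cost + 1
  | eq e f => e.cost + f.cost + 1
  | not p => p.cost + 1
  | and p q => p.cost + q.cost + 1

end Test

/-- Programs.  `loop p c` is `while p do c`. -/
inductive Program where
  | skip
  | assign (x : ℕ) (e : Expr)
  | store (a : ℕ) (i e : Expr)
  | seq (c d : Program)
  | ite (p : Test) (c d : Program)
  | loop (p : Test) (c : Program)

/-- `Exec B c σ t τ`: with words holding integers of absolute value at most `B`, the program `c`
started in the state `σ` halts after exactly `t` steps in the state `τ`. -/
inductive Exec (B : ℕ) : Program → State → ℕ → State → Prop where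
  | skip (σ : State) : Exec B .skip σ 1 σ
  | assign (σ : State) (x : ℕ) (e : Expr) (he : e.Fits B σ) :
      Exec B (.assign x e) σ (e.cost + 1) (σ.setVar x (e.eval σ))
  | store (σ : State) (a : ℕ) (i e : Expr) (hi : i.Fits B σ) (hi0 : 0 ≤ i.eval σ)
      (he : e.Fits B σ) :
      Exec B (.store a i e) σ (i.cost + e.cost + 1) (σ.setArr a (i.eval σ).toNat (e.eval σ))
  | seq {c d : Program} {σ τ ρ : State} {s t : ℕ} (hc : Exec B c σ s τ) (hd : Exec B d τ t ρ) :
      Exec B (.seq c d) σ (s + t) ρ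
  | ite_true {p : Test} {c d : Program} {σ τ : State} {t : ℕ} (hf : p.Fits B σ)
      (hp : p.Holds σ) (hc : Exec B c σ t τ) : Exec B (.ite p c d) σ (p.cost + 1 + t) τ
  | ite_false {p : Test} {c d : Program} {σ τ : State} {t : ℕ} (hf : p.Fits B σ)
      (hp : ¬ p.Holds σ) (hd : Exec B d σ t τ) : Exec B (.ite p c d) σ (p.cost + 1 + t) τ
  | loop_true {p : Test} {c : Program} {σ τ ρ : State} {s t : ℕ} (hf : p.Fits B σ)
      (hp : p.Holds σ) (hc : Exec B c σ s τ) (hl : Exec B (.loop p c) τ t ρ) :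
      Exec B (.loop p c) σ (p.cost + 1 + s + t) ρ
  | loop_false {p : Test} {c : Program} {σ : State} (hf : p.Fits B σ) (hp : ¬ p.Holds σ) :
      Exec B (.loop p c) σ (p.cost + 1) σ

/-! ### Input and output -/

/-- `L` lists the edges of `G`, each exactly once, in any order and with any order of its ends. -/
def IsEdgeList {V : Type*} (G : SimpleGraph V) (L : List (V × V)) : Prop :=
  (L.map fun e => s(e.1, e.2)).Nodup ∧
    ∀ u v, G.Adj u v ↔ s(u, v) ∈ L.map fun e => s(e.1, e.2)

/-- The initial state: variable `0` holds the number of vertices, variable `1` the number of edges,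
cell `j` of the arrays `0` and `1` holds the two ends of the `j`-th edge; all else is `0`. -/
def inputState (n : ℕ) (L : List (Fin n × Fin n)) : State where
  var x := if x = 0 then (n : ℤ) else if x = 1 then (L.length : ℤ) else 0
  arr a j :=
    if h : j < L.length then
      if a = 0 then ((L[j].1 : ℕ) : ℤ) else if a = 1 then ((L[j].2 : ℕ) : ℤ) else 0
    else 0

/-- The final state `σ` describes the drawing `Γ`: cell `v` of the arrays `2` and `3` holds the
coordinates of the vertex `v`; cell `j` of the array `4` is `0` if the `j`-th edge has no bend, and
otherwise cell `j` of the arrays `5` and `6` holds the coordinates of its bend. -/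
def Outputs {n : ℕ} (σ : State) (L : List (Fin n × Fin n)) (Γ : Drawing (Fin n)) : Prop :=
  (∀ v : Fin n, Γ.pos v = (σ.arr 2 v, σ.arr 3 v)) ∧
  (∀ (j : ℕ) (h : j < L.length), Γ.bend s(L[j].1, L[j].2) =
    if σ.arr 4 j = 0 then none else some (σ.arr 5 j, σ.arr 6 j))

end OneBendRAC

/-! Combinatorics. Give every vertex four darts, let each edge occupy one dart at either end, and
pair the remaining `4 * n - 2 * m` darts arbitrarily into dummy edges that are never drawn. The
result is a 4-regular multigraph. The union of two perfect matchings is a union of even cycles,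
hence 2-colourable. One such colouring orients the multigraph with two edges in and two edges out at
each vertex. A second one splits the oriented edges into two directed 2-factors, that is, two
permutations of the vertices (`dartSpec_of_post`, `mateSpec_of_post`, `factorsSpec_of_post`).

Geometry. Columns number the vertices along the cycles of the first factor, rows along the cycles of
the second, each cycle filling an interval. A first-factor edge arrives at its head in the column of
the head, a second-factor edge in the row of the head. If tail and head are in consecutive columns
(rows), the other segment is a short slanted one inside the strip between them; the grid is refined
by three so that it stays close to the tail and meets nothing. The edge that closes a cycle behind
its cut is an L-shape that also uses the row (column) of its tail. All remaining crossings are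
between horizontal and vertical segments. What must be excluded is an overlap, and this is the
content of `Layout.Good`; `Layout.isOneBendRAC` then gives the drawing.

Cutting. A closing edge of the first factor with tail `u` competes, in the row of `u`, with the
second-factor edge entering `u`. If the latter comes from another cycle, that cycle lies entirely on
one side, and laying out the cycle of `u` in the right direction separates the two edges
(`place_side`). If one of the two edges is a dummy, nothing has to be done. So a cycle can be cut
behind `u` unless `Whole` holds at `u`. If `Whole` holds all along a cycle, its vertex set is closed
under both permutations (`Whole.closed`), so the cycle spans a component. In the first factor the
remedy is to take one second-factor edge, entering the canonical vertex `r`, out of the regular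
scheme: with `r` rightmost in its block, this edge runs in the row of its tail past the column of
`r` and comes back by a steep segment. Only rows of the same component are crossed by that segment,
and their horizontal parts end before it. The row of the tail is free to the right if its own
incoming edge comes from the left, which is achieved by reversing the cycle if necessary. In the
second factor no remedy is needed: the factors are exchanged beforehand on each component spanned by
an uncuttable cycle of the second factor, and `Choices.exists_not_whole` shows that afterwards every
cycle of the second factor has a cut. `Choices.layout_good` collects all this.

Running time. The program is a sequence of single loops over vertices, edges or darts in which each
array is written by one loop only and before it is read (`Stage`), together with two walks along
cycles, `twoColor` and `label`. Since arrays are never overwritten by a later stage, the effect of a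
stage can be stated about the final memory (`Stage.Post`, `linear_stages`). `Linear` expresses that
time and word size are at most a constant times the size of the initial words, and it is closed
under composition. Finally `exists_choices` and `drawn_spec` read the choices and the drawing off
the final arrays. -/

namespace OneBendRAC

/-! ### Programs on natural-number states -/

/-- A memory state all of whose words are natural numbers. -/
structure NState where
  var : ℕ → ℕ
  arr : ℕ → ℕ → ℕ

namespace NState

def toState (ν : NState) : State := ⟨fun x => (ν.var x : ℤ), fun a i => (ν.arr a i : ℤ)⟩

def Bdd (M : ℕ) (ν : NState) : Prop := (∀ x, ν.var x ≤ M) ∧ ∀ a i, ν.arr a i ≤ M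

def setVar (ν : NState) (x z : ℕ) : NState := { ν with var := Function.update ν.var x z }

def setArr (ν : NState) (a i z : ℕ) : NState :=
  { ν with arr := Function.update ν.arr a (Function.update (ν.arr a) i z) }

@[simp] theorem setVar_arr (ν : NState) (x z : ℕ) : (ν.setVar x z).arr = ν.arr := rfl

@[simp] theorem setArr_var (ν : NState) (a i z : ℕ) : (ν.setArr a i z).var = ν.var := rfl

theorem setVar_var (ν : NState) (x z y : ℕ) :
    (ν.setVar x z).var y = if y = x then z else ν.var y := by
  simp [setVar, Function.update_apply]

theorem setArr_arr (ν : NState) (a i z b j : ℕ) :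
    (ν.setArr a i z).arr b j = if b = a then (if j = i then z else ν.arr a j) else ν.arr b j := by
  by_cases h : b = a
  · subst h; simp [setArr, Function.update_apply]
  · simp [setArr, h]

theorem toState_setVar (ν : NState) (x z : ℕ) :
    (ν.setVar x z).toState = ν.toState.setVar x z := by
  simp only [toState, State.setVar, setVar, State.mk.injEq, and_true]
  funext y; by_cases h : y = x
  · subst h; simp
  · simp [h]

theorem toState_setArr (ν : NState) (a i z : ℕ) :
    (ν.setArr a i z).toState = ν.toState.setArr a i z := by
  simp only [toState, State.setArr, setArr, State.mk.injEq, true_and]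
  funext b j; by_cases h : b = a
  · subst h
    by_cases hj : j = i
    · subst hj; simp
    · simp [hj]
  · simp [h]

theorem Bdd.setVar {M : ℕ} {ν : NState} (h : ν.Bdd M) {x z : ℕ} (hz : z ≤ M) :
    (ν.setVar x z).Bdd M := by
  refine ⟨fun y => ?_, h.2⟩
  rw [setVar_var]; split_ifs
  exacts [hz, h.1 y]

theorem Bdd.setArr {M : ℕ} {ν : NState} (h : ν.Bdd M) {a i z : ℕ} (hz : z ≤ M) :
    (ν.setArr a i z).Bdd M := by
  refine ⟨h.1, fun b j => ?_⟩
  rw [setArr_arr]; split_ifs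
  exacts [hz, h.2 _ _, h.2 _ _]

end NState

namespace Expr

def neval (ν : NState) : Expr → ℕ
  | lit z => z.toNat
  | var x => ν.var x
  | get a i => ν.arr a (i.neval ν)
  | add e f => e.neval ν + f.neval ν
  | sub e f => e.neval ν - f.neval ν

/-- Condition under which evaluation over the natural numbers agrees with evaluation over the
integers and no intermediate value exceeds `M`. -/
def Ok (M : ℕ) (ν : NState) : Expr → Prop
  | lit z => 0 ≤ z ∧ z ≤ M
  | var _ => True
  | get _ i => i.Ok M ν
  | add e f => e.Ok M ν ∧ f.Ok M ν ∧ e.neval ν + f.neval ν ≤ M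
  | sub e f => e.Ok M ν ∧ f.Ok M ν ∧ f.neval ν ≤ e.neval ν

/-- Subtraction is the only operation on which naturals and integers disagree, and `Ok` requires it
not to truncate. This lets all later reasoning about memory be done in `ℕ`. -/
theorem Ok.spec {M : ℕ} {ν : NState} (hν : ν.Bdd M) {e : Expr} (he : e.Ok M ν) :
    e.eval ν.toState = e.neval ν ∧ e.Fits M ν.toState ∧ e.neval ν ≤ M := by
  induction e with
  | lit z =>
    obtain ⟨h0, h1⟩ := he
    refine ⟨?_, ?_, ?_⟩
    · simp [eval, neval, h0]
    · simpa [Fits, abs_of_nonneg h0] using h1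
    · simpa [neval] using h1
  | var x =>
    have := hν.1 x
    refine ⟨rfl, ?_, this⟩
    simpa [Fits, NState.toState] using this
  | get a i ih =>
    obtain ⟨h1, h2, h3⟩ := ih he
    have := hν.2 a (i.neval ν)
    refine ⟨?_, ⟨h2, ?_, ?_⟩, this⟩
    · change ((ν.arr a (i.eval ν.toState).toNat : ℕ) : ℤ) = _
      rw [h1]; rfl
    · rw [h1]; positivity
    · change |((ν.arr a (i.eval ν.toState).toNat : ℕ) : ℤ)| ≤ _
      rw [h1, Int.toNat_natCast, Nat.abs_cast]; exact_mod_cast this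
  | add e f ihe ihf =>
    obtain ⟨he, hf, hM⟩ := he
    obtain ⟨h1, h2, -⟩ := ihe he
    obtain ⟨h4, h5, -⟩ := ihf hf
    refine ⟨by simp [eval, neval, h1, h4], ⟨h2, h5, ?_⟩, hM⟩
    rw [h1, h4, abs_of_nonneg (by positivity)]; exact_mod_cast hM
  | sub e f ihe ihf =>
    obtain ⟨he, hf, hM⟩ := he
    obtain ⟨h1, h2, h3⟩ := ihe he
    obtain ⟨h4, h5, -⟩ := ihf hf
    have : (e.eval ν.toState - f.eval ν.toState) = ((e.neval ν - f.neval ν : ℕ) : ℤ) := by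
      rw [h1, h4, Nat.cast_sub hM]
    have h6 : e.neval ν - f.neval ν ≤ M := by omega
    refine ⟨this, ⟨h2, h5, ?_⟩, h6⟩
    rw [this, abs_of_nonneg (by positivity)]; exact_mod_cast h6

end Expr

namespace Test

def NHolds (ν : NState) : Test → Prop
  | le e f => e.neval ν ≤ f.neval ν
  | eq e f => e.neval ν = f.neval ν
  | not p => ¬ p.NHolds ν
  | and p q => p.NHolds ν ∧ q.NHolds ν

def Ok (M : ℕ) (ν : NState) : Test → Prop
  | le e f => e.Ok M ν ∧ f.Ok M ν
  | eq e f => e.Ok M ν ∧ f.Ok M ν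
  | not p => p.Ok M ν
  | and p q => p.Ok M ν ∧ q.Ok M ν

theorem Ok.spec {M : ℕ} {ν : NState} (hν : ν.Bdd M) {p : Test} (hp : p.Ok M ν) :
    (p.Holds ν.toState ↔ p.NHolds ν) ∧ p.Fits M ν.toState := by
  induction p with
  | le e f =>
    obtain ⟨a1, a2, -⟩ := Expr.Ok.spec hν hp.1
    obtain ⟨b1, b2, -⟩ := Expr.Ok.spec hν hp.2
    exact ⟨by simp [Holds, NHolds, a1, b1], a2, b2⟩
  | eq e f =>
    obtain ⟨a1, a2, -⟩ := Expr.Ok.spec hν hp.1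
    obtain ⟨b1, b2, -⟩ := Expr.Ok.spec hν hp.2
    exact ⟨by simp [Holds, NHolds, a1, b1], a2, b2⟩
  | not p ih => exact ⟨not_congr (ih hp).1, (ih hp).2⟩
  | and p q ihp ihq =>
    exact ⟨and_congr (ihp hp.1).1 (ihq hp.2).1, (ihp hp.1).2, (ihq hp.2).2⟩

/-- Disjunction. -/
def or (p q : Test) : Test := .not (.and (.not p) (.not q))

/-- Strict inequality. -/
def lt (e f : Expr) : Test := .not (.le f e)

/-- Inequality. -/
def ne (e f : Expr) : Test := .not (.eq e f)

@[simp] theorem or_nholds (ν : NState) (p q : Test) :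
    (or p q).NHolds ν ↔ p.NHolds ν ∨ q.NHolds ν := by simp only [or, NHolds]; tauto

@[simp] theorem lt_nholds (ν : NState) (e f : Expr) :
    (lt e f).NHolds ν ↔ e.neval ν < f.neval ν := by simp [lt, NHolds]

@[simp] theorem lt_ok (M : ℕ) (ν : NState) (e f : Expr) :
    (lt e f).Ok M ν ↔ e.Ok M ν ∧ f.Ok M ν := by simp only [lt, Ok]; tauto

@[simp] theorem ne_nholds (ν : NState) (e f : Expr) :
    (ne e f).NHolds ν ↔ e.neval ν ≠ f.neval ν := Iff.rfl

end Test

namespace Program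

open Classical in
/-- The effect of a loop-free program. -/
noncomputable def nrun : Program → NState → NState
  | skip, ν => ν
  | assign x e, ν => ν.setVar x (e.neval ν)
  | store a i e, ν => ν.setArr a (i.neval ν) (e.neval ν)
  | seq c d, ν => d.nrun (c.nrun ν)
  | ite p c d, ν => if p.NHolds ν then c.nrun ν else d.nrun ν
  | loop _ _, ν => ν

/-- The loop-free program runs from `ν` without exceeding the word size. -/
def Ok (M : ℕ) : Program → NState → Prop
  | skip, _ => True
  | assign _ e, ν => e.Ok M ν
  | store _ i e, ν => i.Ok M ν ∧ e.Ok M ν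
  | seq c d, ν => c.Ok M ν ∧ d.Ok M (c.nrun ν)
  | ite p c d, ν => p.Ok M ν ∧ (p.NHolds ν → c.Ok M ν) ∧ (¬ p.NHolds ν → d.Ok M ν)
  | loop _ _, _ => False

/-- Upper bound for the number of steps of a loop-free program. -/
def bound : Program → ℕ
  | skip => 1
  | assign _ e => e.cost + 1
  | store _ i e => i.cost + e.cost + 1
  | seq c d => c.bound + d.bound
  | ite p c d => p.cost + 1 + (c.bound + d.bound)
  | loop _ _ => 0

/-- The arrays written by a program. -/
def arrs : Program → List ℕ
  | skip => []
  | assign _ _ => []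
  | store a _ _ => [a]
  | seq c d => c.arrs ++ d.arrs
  | ite _ c d => c.arrs ++ d.arrs
  | loop _ c => c.arrs

/-- The variables written by a program. -/
def vars : Program → List ℕ
  | skip => []
  | assign x _ => [x]
  | store _ _ _ => []
  | seq c d => c.vars ++ d.vars
  | ite _ c d => c.vars ++ d.vars
  | loop _ c => c.vars

/-- `τ` agrees with `ν` outside the given arrays and variables. -/
structure Frame (A X : List ℕ) (ν τ : NState) : Prop where
  arr : ∀ a, a ∉ A → τ.arr a = ν.arr a
  var : ∀ x, x ∉ X → τ.var x = ν.var x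

theorem Frame.refl (A X : List ℕ) (ν : NState) : Frame A X ν ν := ⟨fun _ _ => rfl, fun _ _ => rfl⟩

theorem Frame.trans {A X : List ℕ} {ν τ ρ : NState} (h : Frame A X ν τ) (h' : Frame A X τ ρ) :
    Frame A X ν ρ :=
  ⟨fun a ha => (h'.arr a ha).trans (h.arr a ha), fun x hx => (h'.var x hx).trans (h.var x hx)⟩

theorem Frame.mono {A X A' X' : List ℕ} {ν τ : NState} (h : Frame A X ν τ) (hA : A ⊆ A')
    (hX : X ⊆ X') : Frame A' X' ν τ :=
  ⟨fun a ha => h.arr a fun h' => ha (hA h'), fun x hx => h.var x fun h' => hx (hX h')⟩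

theorem nrun_frame (c : Program) (ν : NState) : Frame c.arrs c.vars ν (c.nrun ν) := by
  induction c generalizing ν with
  | skip => exact .refl _ _ _
  | assign x e =>
    refine ⟨fun _ _ => rfl, fun y hy => ?_⟩
    have : y ≠ x := by simpa [vars] using hy
    simp [nrun, NState.setVar_var, this]
  | store a i e =>
    refine ⟨fun b hb => ?_, fun _ _ => rfl⟩
    have : b ≠ a := by simpa [arrs] using hb
    funext j; simp [nrun, NState.setArr_arr, this]
  | seq c d ihc ihd =>
    exact ((ihc ν).mono (by simp [arrs]) (by simp [vars])).trans
      ((ihd _).mono (by simp [arrs]) (by simp [vars]))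
  | ite p c d ihc ihd =>
    simp only [nrun]; split_ifs
    · exact (ihc ν).mono (by simp [arrs]) (by simp [vars])
    · exact (ihd ν).mono (by simp [arrs]) (by simp [vars])
  | loop p c _ => exact .refl _ _ _

/-- From `ν` the program `c` halts in `τ` within `T` steps. -/
structure Run (M : ℕ) (c : Program) (T : ℕ) (ν τ : NState) : Prop where
  exec : ∃ t ≤ T, Exec M c ν.toState t τ.toState
  bdd : τ.Bdd M
  frame : Frame c.arrs c.vars ν τ

theorem Run.seq {M : ℕ} {c d : Program} {S T : ℕ} {ν τ ρ : NState} (h : Run M c S ν τ)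
    (h' : Run M d T τ ρ) : Run M (.seq c d) (S + T) ν ρ := by
  obtain ⟨s, hs, es⟩ := h.exec
  obtain ⟨t, ht, et⟩ := h'.exec
  exact ⟨⟨s + t, by omega, .seq es et⟩, h'.bdd,
    (h.frame.mono (by simp [arrs]) (by simp [vars])).trans
      (h'.frame.mono (by simp [arrs]) (by simp [vars]))⟩

theorem Run.mono {M : ℕ} {c : Program} {S T : ℕ} {ν τ : NState} (h : Run M c S ν τ) (hST : S ≤ T) :
    Run M c T ν τ :=
  ⟨h.exec.imp fun _ ht => ⟨ht.1.trans hST, ht.2⟩, h.bdd, h.frame⟩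

/-- Bridge from the denotational `nrun` to the step relation. Since `bound` charges both branches of
a conditional, it bounds the time independently of the state. -/
theorem run_of_ok {M : ℕ} {c : Program} {ν : NState} (hν : ν.Bdd M) (hc : c.Ok M ν) :
    Run M c c.bound ν (c.nrun ν) := by
  induction c generalizing ν with
  | skip => exact ⟨⟨1, le_rfl, .skip _⟩, hν, nrun_frame _ _⟩
  | assign x e =>
    obtain ⟨h1, h2, h3⟩ := Expr.Ok.spec hν hc
    refine ⟨⟨_, le_rfl, ?_⟩, hν.setVar h3, nrun_frame _ _⟩
    rw [nrun, NState.toState_setVar, ← h1]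
    exact .assign _ _ _ h2
  | store a i e =>
    obtain ⟨i1, i2, -⟩ := Expr.Ok.spec hν hc.1
    obtain ⟨h1, h2, h3⟩ := Expr.Ok.spec hν hc.2
    refine ⟨⟨_, le_rfl, ?_⟩, hν.setArr h3, nrun_frame _ _⟩
    have := Exec.store (B := M) ν.toState a i e i2 (by rw [i1]; positivity) h2
    rwa [h1, i1, Int.toNat_natCast, ← NState.toState_setArr] at this
  | seq c d ihc ihd =>
    have h := ihc hν hc.1
    exact h.seq (ihd h.bdd hc.2)
  | ite p c d ihc ihd =>
    obtain ⟨hp1, hp2⟩ := Test.Ok.spec hν hc.1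
    by_cases hp : p.NHolds ν
    · obtain ⟨⟨t, ht, et⟩, hb, -⟩ := ihc hν (hc.2.1 hp)
      refine ⟨⟨p.cost + 1 + t, by simp only [bound]; omega, ?_⟩, ?_, nrun_frame _ _⟩
      · simp only [nrun, if_pos hp]; exact .ite_true hp2 (hp1.2 hp) et
      · simpa only [nrun, if_pos hp] using hb
    · obtain ⟨⟨t, ht, et⟩, hb, -⟩ := ihd hν (hc.2.2 hp)
      refine ⟨⟨p.cost + 1 + t, by simp only [bound]; omega, ?_⟩, ?_, nrun_frame _ _⟩
      · simp only [nrun, if_neg hp]; exact .ite_false hp2 (fun h => hp (hp1.1 h)) et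
      · simpa only [nrun, if_neg hp] using hb
  | loop p c _ => exact hc.elim

/-- Total correctness of a loop with loop-free body, by an invariant and a measure. -/
theorem exists_run_loop {M : ℕ} {p : Test} {c : Program} (I : NState → Prop) (μ : NState → ℕ)
    {ν : NState} (hν : ν.Bdd M) (h0 : I ν)
    (step : ∀ σ, σ.Bdd M → Frame c.arrs c.vars ν σ → I σ →
      p.Ok M σ ∧ (p.NHolds σ → c.Ok M σ ∧ I (c.nrun σ) ∧ μ (c.nrun σ) < μ σ)) :
    ∃ τ, Run M (.loop p c) ((p.cost + 1 + c.bound) * (μ ν + 1)) ν τ ∧ I τ ∧ ¬ p.NHolds τ := by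
  -- The frame stays relative to the fixed initial state `ν` during the induction, so the step
  -- hypothesis may compare every intermediate state with the start of the loop.
  suffices H : ∀ N σ, μ σ = N → σ.Bdd M → Frame c.arrs c.vars ν σ → I σ →
      ∃ τ, Run M (.loop p c) ((p.cost + 1 + c.bound) * (N + 1)) σ τ ∧ I τ ∧ ¬ p.NHolds τ from
    H _ ν rfl hν (.refl _ _ _) h0
  intro N
  induction N using Nat.strong_induction_on with
  | _ N ih =>
    intro σ hσ hb hf hI
    obtain ⟨hp, hstep⟩ := step σ hb hf hI
    obtain ⟨hp1, hp2⟩ := Test.Ok.spec hb hp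
    by_cases h : p.NHolds σ
    · obtain ⟨hc, hI', hμ⟩ := hstep h
      have hr := run_of_ok hb hc
      obtain ⟨τ, hτ, h1, h2⟩ := ih _ (hσ ▸ hμ) _ rfl hr.bdd (hf.trans hr.frame) hI'
      obtain ⟨s, hs, es⟩ := hr.exec
      obtain ⟨t, ht, et⟩ := hτ.exec
      refine ⟨τ, ⟨⟨p.cost + 1 + s + t, ?_, .loop_true hp2 (hp1.2 h) es et⟩, hτ.bdd,
        hr.frame.trans hτ.frame⟩, h1, h2⟩
      have h3 : (p.cost + 1 + c.bound) * (μ (c.nrun σ) + 1) ≤ (p.cost + 1 + c.bound) * N :=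
        Nat.mul_le_mul_left _ (by omega)
      rw [Nat.mul_succ]; omega
    · refine ⟨σ, ⟨⟨p.cost + 1, ?_, .loop_false hp2 fun h' => h (hp1.1 h')⟩, hb, .refl _ _ _⟩, hI, h⟩
      nlinarith

/-- `for k < b do c`, where the counter `k` is the variable `3` and the bound `b` a variable. -/
def upto (b : ℕ) (c : Program) : Program :=
  .seq (.assign 3 (.lit 0))
    (.loop (.lt (.var 3) (.var b)) (.seq c (.assign 3 (.add (.var 3) (.lit 1)))))

/-- A counted loop needs neither a measure nor a termination argument from its user; the body only
has to leave the counter and the bound alone. -/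
theorem exists_run_upto {M b N : ℕ} {c : Program} (I : ℕ → NState → Prop) {ν : NState}
    (hν : ν.Bdd M) (hb : ν.var b = N) (hb3 : b ≠ 3) (hbc : b ∉ c.vars) (h3c : 3 ∉ c.vars)
    (hM : 1 ≤ M) (h0 : I 0 (ν.setVar 3 0))
    (step : ∀ i σ, i < N → σ.Bdd M → σ.var 3 = i → Frame c.arrs (3 :: c.vars) ν σ → I i σ →
      c.Ok M σ ∧ I (i + 1) ((c.nrun σ).setVar 3 (i + 1))) :
    ∃ τ, Run M (upto b c) (2 + (c.bound + 9) * (N + 1)) ν τ ∧ I N τ := by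
  have hNM : N ≤ M := hb ▸ hν.1 b
  have r0 : Run M (.assign 3 (.lit 0)) 2 ν (ν.setVar 3 0) :=
    run_of_ok (c := .assign 3 (.lit 0)) hν ⟨le_rfl, by positivity⟩
  have key := exists_run_loop (M := M) (p := .lt (.var 3) (.var b))
    (c := .seq c (.assign 3 (.add (.var 3) (.lit 1))))
    (fun σ => σ.var 3 ≤ N ∧ I (σ.var 3) σ) (fun σ => N - σ.var 3) r0.bdd
    (by simpa [NState.setVar_var] using h0) (by
      intro σ hσ hf ⟨h3, hI⟩
      have hf' : Frame c.arrs (3 :: c.vars) ν σ := by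
        refine (r0.frame.mono ?_ ?_).trans (hf.mono ?_ ?_) <;> simp [arrs, vars]
      have hb' : σ.var b = N := by rw [hf'.var b (by simp [hb3, hbc]), hb]
      refine ⟨by simp [Expr.Ok], fun hp => ?_⟩
      have hlt : σ.var 3 < N := by simpa [Expr.neval, hb'] using hp
      obtain ⟨hok, hI'⟩ := step _ σ hlt hσ rfl hf' hI
      have h33 : (c.nrun σ).var 3 = σ.var 3 := (nrun_frame c σ).var 3 h3c
      have e : (Program.seq c (.assign 3 (.add (.var 3) (.lit 1)))).nrun σ =
          (c.nrun σ).setVar 3 (σ.var 3 + 1) := by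
        simp [nrun, Expr.neval, h33]
      rw [e]
      refine ⟨⟨hok, trivial, ⟨by simp, by exact_mod_cast hM⟩, ?_⟩, ⟨?_, ?_⟩, ?_⟩
      · simp only [Expr.neval, h33]; simp; omega
      · simpa [NState.setVar_var] using hlt
      · simpa [NState.setVar_var] using hI'
      · simp only [NState.setVar_var, if_true]; omega)
  obtain ⟨τ, hτ, ⟨h3, hI⟩, hp⟩ := key
  have hτb : τ.var b = N := by
    rw [(r0.seq hτ).frame.var b (by simp [vars, hb3, hbc]), hb]
  have : τ.var 3 = N := by
    have : ¬ τ.var 3 < N := by simpa [Expr.neval, hτb] using hp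
    omega
  refine ⟨τ, (r0.seq hτ).mono ?_, this ▸ hI⟩
  have : (N - (ν.setVar 3 0).var 3) = N := by simp [NState.setVar_var]
  have e : (Test.lt (.var 3) (.var b)).cost + 1 +
      (Program.seq c (.assign 3 (.add (.var 3) (.lit 1)))).bound = c.bound + 9 := by
    simp only [Test.lt, Test.cost, Expr.cost, bound]; omega
  rw [this, e]

end Program

end OneBendRAC

namespace OneBendRAC

/-! ### Grid layouts -/

theorem exists_of_mem_closedSeg {a b : GridPoint} {x : ℝ × ℝ} (h : x ∈ closedSeg (a, b)) :
    ∃ t : ℝ, 0 ≤ t ∧ t ≤ 1 ∧ x.1 = a.1 + t * (b.1 - a.1) ∧ x.2 = a.2 + t * (b.2 - a.2) := by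
  obtain ⟨s, t, hs, ht, hst, rfl⟩ := h
  obtain rfl : s = 1 - t := by linarith
  refine ⟨t, ht, by linarith, ?_, ?_⟩ <;> simp [toPlane] <;> ring

theorem mem_openSeg_of {a b : GridPoint} {x : ℝ × ℝ} (t : ℝ) (h0 : 0 < t) (h1 : t < 1)
    (hx : x.1 = a.1 + t * (b.1 - a.1)) (hy : x.2 = a.2 + t * (b.2 - a.2)) :
    x ∈ openSeg (a, b) := by
  refine ⟨1 - t, t, by linarith, h0, by ring, ?_⟩
  ext
  · rw [hx]; simp [toPlane]; ring
  · rw [hy]; simp [toPlane]; ring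

theorem left_mem_closedSeg (a b : GridPoint) : toPlane a ∈ closedSeg (a, b) :=
  left_mem_segment ℝ _ _

theorem right_mem_closedSeg (a b : GridPoint) : toPlane b ∈ closedSeg (a, b) :=
  right_mem_segment ℝ _ _

theorem closedSeg_swap (a b : GridPoint) : closedSeg (a, b) = closedSeg (b, a) :=
  segment_symm ℝ _ _

theorem openSeg_swap (a b : GridPoint) : openSeg (a, b) = openSeg (b, a) :=
  openSegment_symm ℝ _ _

theorem mem_openSeg_horizontal {a b c : ℤ} {x : ℝ × ℝ} (hy : x.2 = c)
    (h : (a : ℝ) < x.1 ∧ x.1 < b ∨ (b : ℝ) < x.1 ∧ x.1 < a) : x ∈ openSeg ((a, c), (b, c)) := by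
  wlog hab : (a : ℝ) < x.1 ∧ x.1 < b generalizing a b
  · rw [openSeg_swap]; exact this h.symm (h.resolve_left hab)
  have hpos : (0 : ℝ) < b - a := by linarith [hab.1, hab.2]
  refine mem_openSeg_of ((x.1 - a) / (b - a)) (div_pos (by linarith) hpos)
    ((div_lt_one hpos).2 (by linarith)) ?_ ?_
  · simp only; field_simp; ring
  · simp [hy]

theorem mem_openSeg_vertical {a b c : ℤ} {x : ℝ × ℝ} (hx : x.1 = c)
    (h : (a : ℝ) < x.2 ∧ x.2 < b ∨ (b : ℝ) < x.2 ∧ x.2 < a) : x ∈ openSeg ((c, a), (c, b)) := by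
  wlog hab : (a : ℝ) < x.2 ∧ x.2 < b generalizing a b
  · rw [openSeg_swap]; exact this h.symm (h.resolve_left hab)
  have hpos : (0 : ℝ) < b - a := by linarith [hab.1, hab.2]
  refine mem_openSeg_of ((x.2 - a) / (b - a)) (div_pos (by linarith) hpos)
    ((div_lt_one hpos).2 (by linarith)) ?_ ?_
  · simp [hx]
  · simp only; field_simp; ring

/-- The way an edge of a layout is drawn: along the column of its head, along the row of its head,
or by a steep segment to the right of its head. -/
inductive Kind where
  | vert
  | horiz
  | steep

/-- The vertex `v` is placed at `(3 * X v, 3 * Y v)`.  The edges are indexed by their kind and their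
head `v`; the tail is `p v` for edges of kind `vert` and `q v` otherwise. -/
structure Layout (n : ℕ) where
  X : Fin n → ℤ
  Y : Fin n → ℤ
  p : Fin n → Fin n
  q : Fin n → Fin n
  real : Kind → Fin n → Prop
  lab : Fin n → ℕ

namespace Layout

variable {n : ℕ}

def tail (Λ : Layout n) : Kind → Fin n → Fin n
  | .vert, v => Λ.p v
  | .horiz, v => Λ.q v
  | .steep, v => Λ.q v

def pos (Λ : Layout n) (v : Fin n) : GridPoint := (3 * Λ.X v, 3 * Λ.Y v)

/-- Tail and head of the edge of kind `vert` are in consecutive columns. -/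
def AdjX (Λ : Layout n) (v : Fin n) : Prop := Λ.X (Λ.p v) = Λ.X v + 1 ∨ Λ.X v = Λ.X (Λ.p v) + 1

/-- Tail and head of the edge of kind `horiz` are in consecutive rows. -/
def AdjY (Λ : Layout n) (v : Fin n) : Prop := Λ.Y (Λ.q v) = Λ.Y v + 1 ∨ Λ.Y v = Λ.Y (Λ.q v) + 1

open Classical in
noncomputable def offY (Λ : Layout n) (v : Fin n) : ℤ :=
  if Λ.AdjX v then if Λ.Y (Λ.p v) < Λ.Y v then 1 else -1 else 0

open Classical in
noncomputable def offX (Λ : Layout n) (v : Fin n) : ℤ :=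
  if Λ.AdjY v then if Λ.X (Λ.q v) < Λ.X v then 1 else -1 else 0

noncomputable def bend (Λ : Layout n) : Kind → Fin n → GridPoint
  | .vert, v => (3 * Λ.X v, 3 * Λ.Y (Λ.p v) + Λ.offY v)
  | .horiz, v => (3 * Λ.X (Λ.q v) + Λ.offX v, 3 * Λ.Y v)
  | .steep, v => (3 * Λ.X v + 1, 3 * Λ.Y (Λ.q v))

/-- The conditions under which the layout is a 1-bend RAC drawing. -/
structure Good (Λ : Layout n) : Prop where
  X_inj : Function.Injective Λ.X
  Y_inj : Function.Injective Λ.Y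
  p_inj : Function.Injective Λ.p
  q_inj : Function.Injective Λ.q
  loopless : ∀ k v, Λ.real k v → Λ.tail k v ≠ v
  simple : ∀ k v k' v', Λ.real k v → Λ.real k' v' →
    s(Λ.tail k v, v) = s(Λ.tail k' v', v') → k = k' ∧ v = v'
  closing_vert : ∀ v, Λ.real .vert v → ¬ Λ.AdjX v → Λ.real .horiz (Λ.p v) →
    Λ.X (Λ.q (Λ.p v)) < Λ.X (Λ.p v) ∧ Λ.X (Λ.p v) < Λ.X v ∨
      Λ.X (Λ.p v) < Λ.X (Λ.q (Λ.p v)) ∧ Λ.X v < Λ.X (Λ.p v)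
  closing_vert_steep : ∀ v r, Λ.real .vert v → ¬ Λ.AdjX v → Λ.real .steep r → Λ.q r ≠ Λ.p v
  closing_horiz : ∀ v, Λ.real .horiz v → ¬ Λ.AdjY v → Λ.real .vert (Λ.q v) →
    Λ.Y (Λ.p (Λ.q v)) < Λ.Y (Λ.q v) ∧ Λ.Y (Λ.q v) < Λ.Y v ∨
      Λ.Y (Λ.q v) < Λ.Y (Λ.p (Λ.q v)) ∧ Λ.Y v < Λ.Y (Λ.q v)
  steep_lt : ∀ r, Λ.real .steep r → Λ.real .horiz (Λ.q r) → Λ.X (Λ.q (Λ.q r)) < Λ.X (Λ.q r)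
  lab_p : ∀ r v, Λ.real .steep r → (Λ.lab (Λ.p v) = Λ.lab r ↔ Λ.lab v = Λ.lab r)
  lab_q : ∀ r v, Λ.real .steep r → (Λ.lab (Λ.q v) = Λ.lab r ↔ Λ.lab v = Λ.lab r)
  lab_le : ∀ r v, Λ.real .steep r → Λ.lab v = Λ.lab r → Λ.X v ≤ Λ.X r
  lab_between : ∀ r v, Λ.real .steep r →
    Λ.Y r < Λ.Y v ∧ Λ.Y v < Λ.Y (Λ.q r) ∨ Λ.Y (Λ.q r) < Λ.Y v ∧ Λ.Y v < Λ.Y r →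
    Λ.lab v = Λ.lab r
  steep_unique : ∀ r r', Λ.real .steep r → Λ.real .steep r' → Λ.lab r' = Λ.lab r → r' = r

/-- The edge has a horizontal segment in the row of `w`, from `w` to the abscissa `ξ`. -/
def RowOf (Λ : Layout n) : Kind → Fin n → Fin n → ℤ → Prop
  | .vert, v, w, ξ => ¬ Λ.AdjX v ∧ w = Λ.p v ∧ ξ = 3 * Λ.X v
  | .horiz, v, w, ξ => w = v ∧ ξ = 3 * Λ.X (Λ.q v) + Λ.offX v
  | .steep, v, w, ξ => w = Λ.q v ∧ ξ = 3 * Λ.X v + 1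

/-- The edge has a vertical segment in the column of `w`, from `w` to the ordinate `η`. -/
def ColOf (Λ : Layout n) : Kind → Fin n → Fin n → ℤ → Prop
  | .vert, v, w, η => w = v ∧ η = 3 * Λ.Y (Λ.p v) + Λ.offY v
  | .horiz, v, w, η => ¬ Λ.AdjY v ∧ w = Λ.q v ∧ η = 3 * Λ.Y v
  | .steep, _, _, _ => False

/-- The horizontal part of an edge, without its vertex. -/
def InRow (Λ : Layout n) (k : Kind) (v : Fin n) (x : ℝ × ℝ) : Prop :=
  ∃ w ξ, Λ.RowOf k v w ξ ∧ x.2 = ((3 * Λ.Y w : ℤ) : ℝ) ∧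
    (((3 * Λ.X w : ℤ) : ℝ) < x.1 ∧ x.1 ≤ ξ ∨ (ξ : ℝ) ≤ x.1 ∧ x.1 < ((3 * Λ.X w : ℤ) : ℝ))

/-- The vertical part of an edge, without its vertex. -/
def InCol (Λ : Layout n) (k : Kind) (v : Fin n) (x : ℝ × ℝ) : Prop :=
  ∃ w η, Λ.ColOf k v w η ∧ x.1 = ((3 * Λ.X w : ℤ) : ℝ) ∧
    (((3 * Λ.Y w : ℤ) : ℝ) < x.2 ∧ x.2 ≤ η ∨ (η : ℝ) ≤ x.2 ∧ x.2 < ((3 * Λ.Y w : ℤ) : ℝ))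

/-- The interior of the segment of an edge that is neither horizontal nor vertical. -/
def InSlant (Λ : Layout n) : Kind → Fin n → ℝ × ℝ → Prop
  | .vert, v, x => Λ.AdjX v ∧ ∃ t : ℝ, 0 < t ∧ t < 1 ∧
      x.1 = 3 * Λ.X (Λ.p v) + t * (3 * (Λ.X v - Λ.X (Λ.p v))) ∧
      x.2 = 3 * Λ.Y (Λ.p v) + t * Λ.offY v
  | .horiz, v, x => Λ.AdjY v ∧ ∃ t : ℝ, 0 < t ∧ t < 1 ∧
      x.1 = 3 * Λ.X (Λ.q v) + t * Λ.offX v ∧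
      x.2 = 3 * Λ.Y (Λ.q v) + t * (3 * (Λ.Y v - Λ.Y (Λ.q v)))
  | .steep, v, x => ∃ t : ℝ, 0 < t ∧ t < 1 ∧ x.1 = 3 * Λ.X v + t ∧
      x.2 = 3 * Λ.Y v + t * (3 * (Λ.Y (Λ.q v) - Λ.Y v))

theorem offX_cases (Λ : Layout n) (v : Fin n) :
    ¬ Λ.AdjY v ∧ Λ.offX v = 0 ∨ Λ.AdjY v ∧
      (Λ.X (Λ.q v) < Λ.X v ∧ Λ.offX v = 1 ∨ Λ.X v ≤ Λ.X (Λ.q v) ∧ Λ.offX v = -1) := by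
  unfold offX; split_ifs <;> simp_all

theorem offY_cases (Λ : Layout n) (v : Fin n) :
    ¬ Λ.AdjX v ∧ Λ.offY v = 0 ∨ Λ.AdjX v ∧
      (Λ.Y (Λ.p v) < Λ.Y v ∧ Λ.offY v = 1 ∨ Λ.Y v ≤ Λ.Y (Λ.p v) ∧ Λ.offY v = -1) := by
  unfold offY; split_ifs <;> simp_all

variable {Λ : Layout n}

theorem pos_inj (hΛ : Λ.Good) : Function.Injective Λ.pos := by
  intro u v h
  have := congrArg Prod.fst h
  exact hΛ.X_inj (by simpa [pos] using this)

/-- The points of an edge. -/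
def curve (Λ : Layout n) (k : Kind) (v : Fin n) : Set (ℝ × ℝ) :=
  closedSeg (Λ.pos (Λ.tail k v), Λ.bend k v) ∪ closedSeg (Λ.bend k v, Λ.pos v)

/-- The end `a`, which will be a vertex, is split off, while the end `b`, which will be a bend,
stays in the part. -/
theorem rowPart {x : ℝ × ℝ} {a b c : ℤ} (h : x ∈ closedSeg ((a, c), (b, c))) :
    x = toPlane (a, c) ∨ x.2 = c ∧ ((a : ℝ) < x.1 ∧ x.1 ≤ b ∨ (b : ℝ) ≤ x.1 ∧ x.1 < a) := by
  obtain ⟨t, h0, h1, hx, hy⟩ := exists_of_mem_closedSeg h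
  have hy' : x.2 = c := by rw [hy]; simp
  rcases lt_trichotomy (a : ℝ) x.1 with h' | h' | h'
  · refine .inr ⟨hy', .inl ⟨h', ?_⟩⟩
    simp only at hx
    -- The product of the signed distances to the ends is nonnegative, which places `x` between them
    -- whichever end is on the left.
    have h2 : (x.1 - a) * (b - x.1) = t * (1 - t) * (b - a : ℝ) ^ 2 := by rw [hx]; ring
    have h3 : 0 ≤ t * (1 - t) * (b - a : ℝ) ^ 2 := by
      have : 0 ≤ 1 - t := by linarith
      positivity
    nlinarith
  · exact .inl (Prod.ext h'.symm hy')
  · refine .inr ⟨hy', .inr ⟨?_, h'⟩⟩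
    simp only at hx
    have h2 : (x.1 - a) * (b - x.1) = t * (1 - t) * (b - a : ℝ) ^ 2 := by rw [hx]; ring
    have h3 : 0 ≤ t * (1 - t) * (b - a : ℝ) ^ 2 := by
      have : 0 ≤ 1 - t := by linarith
      positivity
    nlinarith

theorem colPart {x : ℝ × ℝ} {a b c : ℤ} (h : x ∈ closedSeg ((c, a), (c, b))) :
    x = toPlane (c, a) ∨ x.1 = c ∧ ((a : ℝ) < x.2 ∧ x.2 ≤ b ∨ (b : ℝ) ≤ x.2 ∧ x.2 < a) := by
  obtain ⟨t, h0, h1, hx, hy⟩ := exists_of_mem_closedSeg h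
  have hx' : x.1 = c := by rw [hx]; simp
  rcases lt_trichotomy (a : ℝ) x.2 with h' | h' | h'
  · refine .inr ⟨hx', .inl ⟨h', ?_⟩⟩
    simp only at hy
    have h2 : (x.2 - a) * (b - x.2) = t * (1 - t) * (b - a : ℝ) ^ 2 := by rw [hy]; ring
    have h3 : 0 ≤ t * (1 - t) * (b - a : ℝ) ^ 2 := by
      have : 0 ≤ 1 - t := by linarith
      positivity
    nlinarith
  · exact .inl (Prod.ext hx' h'.symm)
  · refine .inr ⟨hx', .inr ⟨?_, h'⟩⟩
    simp only at hy
    have h2 : (x.2 - a) * (b - x.2) = t * (1 - t) * (b - a : ℝ) ^ 2 := by rw [hy]; ring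
    have h3 : 0 ≤ t * (1 - t) * (b - a : ℝ) ^ 2 := by
      have : 0 ≤ 1 - t := by linarith
      positivity
    nlinarith

theorem slantPart {x : ℝ × ℝ} {a b : GridPoint} (h : x ∈ closedSeg (a, b)) :
    x = toPlane a ∨ x = toPlane b ∨ ∃ t : ℝ, 0 < t ∧ t < 1 ∧
      x.1 = a.1 + t * (b.1 - a.1) ∧ x.2 = a.2 + t * (b.2 - a.2) := by
  obtain ⟨t, h0, h1, hx, hy⟩ := exists_of_mem_closedSeg h
  rcases h0.eq_or_lt with rfl | h0
  · exact .inl (Prod.ext (by simpa [toPlane] using hx) (by simpa [toPlane] using hy))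
  rcases h1.eq_or_lt with rfl | h1
  · exact .inr (.inl (Prod.ext (by simpa [toPlane] using hx) (by simpa [toPlane] using hy)))
  exact .inr (.inr ⟨t, h0, h1, hx, hy⟩)

/-- Every point of an edge is one of its ends or lies in one of its parts. -/
theorem parts (hΛ : Λ.Good) {k : Kind} {v : Fin n} (hr : Λ.real k v) {x : ℝ × ℝ}
    (hx : x ∈ Λ.curve k v) :
    x = toPlane (Λ.pos (Λ.tail k v)) ∨ x = toPlane (Λ.pos v) ∨ Λ.InRow k v x ∨ Λ.InCol k v x ∨
      Λ.InSlant k v x := by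
  have hne := hΛ.loopless k v hr
  have hX := hΛ.X_inj.ne hne
  have hY := hΛ.Y_inj.ne hne
  cases k with
  | vert =>
    simp only [tail] at hne hX hY
    -- Used twice: for the segment at the head, and for the bend itself when it is reached as the
    -- far end of the slanted segment.
    have key : x ∈ closedSeg (Λ.bend .vert v, Λ.pos v) →
        x = toPlane (Λ.pos v) ∨ Λ.InCol .vert v x := fun h => by
      rw [closedSeg_swap] at h
      exact (colPart h).imp_right fun h => ⟨v, _, ⟨rfl, rfl⟩, h⟩
    rcases hx with hx | hx
    · rcases Λ.offY_cases v with ⟨h1, h2⟩ | ⟨h1, h2⟩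
      · simp only [pos, bend, tail, h2, add_zero] at hx
        rcases rowPart hx with h | h
        · exact .inl h
        · exact .inr (.inr (.inl ⟨_, _, ⟨h1, rfl, rfl⟩, h⟩))
      · rcases slantPart hx with h | h | ⟨t, h3, h4, h5, h6⟩
        · exact .inl h
        · rcases key (h ▸ left_mem_closedSeg _ _) with h | h <;> tauto
        · refine .inr (.inr (.inr (.inr ⟨h1, t, h3, h4, ?_, ?_⟩)))
          · rw [h5]; simp only [pos, bend, tail]; push_cast; ring
          · rw [h6]; simp [pos, bend, tail]
    · rcases key hx with h | h <;> tauto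
  | horiz =>
    simp only [tail] at hne hX hY
    have key : x ∈ closedSeg (Λ.bend .horiz v, Λ.pos v) →
        x = toPlane (Λ.pos v) ∨ Λ.InRow .horiz v x := fun h => by
      rw [closedSeg_swap] at h
      exact (rowPart h).imp_right fun h => ⟨v, _, ⟨rfl, rfl⟩, h⟩
    rcases hx with hx | hx
    · rcases Λ.offX_cases v with ⟨h1, h2⟩ | ⟨h1, h2⟩
      · simp only [pos, bend, tail, h2, add_zero] at hx
        rcases colPart hx with h | h
        · exact .inl h
        · exact .inr (.inr (.inr (.inl ⟨_, _, ⟨h1, rfl, rfl⟩, h⟩)))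
      · rcases slantPart hx with h | h | ⟨t, h3, h4, h5, h6⟩
        · exact .inl h
        · rcases key (h ▸ left_mem_closedSeg _ _) with h | h <;> tauto
        · refine .inr (.inr (.inr (.inr ⟨h1, t, h3, h4, ?_, ?_⟩)))
          · rw [h5]; simp [pos, bend, tail]
          · rw [h6]; simp only [pos, bend, tail]; push_cast; ring
    · rcases key hx with h | h <;> tauto
  | steep =>
    have key : x ∈ closedSeg (Λ.pos (Λ.q v), Λ.bend .steep v) →
        x = toPlane (Λ.pos (Λ.q v)) ∨ Λ.InRow .steep v x := fun h =>
      (rowPart h).imp_right fun h => ⟨_, _, ⟨rfl, rfl⟩, h⟩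
    rcases hx with hx | hx
    · rcases key hx with h | h
      · exact .inl h
      · tauto
    · rw [closedSeg_swap] at hx
      rcases slantPart hx with h | h | ⟨t, h3, h4, h5, h6⟩
      · tauto
      · rcases key (h ▸ right_mem_closedSeg _ _) with h | h
        · exact .inl h
        · tauto
      · refine .inr (.inr (.inr (.inr ⟨t, h3, h4, ?_, ?_⟩)))
        · rw [h5]; simp [pos, bend]
        · rw [h6]; simp only [pos, bend]; push_cast; ring

end Layout

end OneBendRAC

namespace OneBendRAC

/-! ### Which parts of two edges of a good layout can meet -/

namespace Layout

variable {n : ℕ} {Λ : Layout n}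

/-- The offset moves the bend from the tail towards the head. As vertices have coordinates divisible
by three, it never changes the side of the head on which the bend lies. -/
theorem offX_bounds (Λ : Layout n) (v : Fin n) :
    (Λ.X (Λ.q v) < Λ.X v → 0 ≤ Λ.offX v ∧ Λ.offX v ≤ 1) ∧
      (Λ.X v < Λ.X (Λ.q v) → -1 ≤ Λ.offX v ∧ Λ.offX v ≤ 0) := by
  rcases Λ.offX_cases v with h | ⟨-, h | h⟩ <;> omega

theorem offY_bounds (Λ : Layout n) (v : Fin n) :
    (Λ.Y (Λ.p v) < Λ.Y v → 0 ≤ Λ.offY v ∧ Λ.offY v ≤ 1) ∧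
      (Λ.Y v < Λ.Y (Λ.p v) → -1 ≤ Λ.offY v ∧ Λ.offY v ≤ 0) := by
  rcases Λ.offY_cases v with h | ⟨-, h | h⟩ <;> omega

/-- Three kinds of edges may use the row of `w`: the second-factor edge entering `w`, a closing edge
of the first factor leaving `w`, and a steep edge leaving `w`. The closing conditions and `steep_lt`
send them in different directions; a closing and a steep edge never share their tail. -/
theorem rowOf_unique (hΛ : Λ.Good) {k k' : Kind} {v v' w : Fin n} {ξ ξ' : ℤ} (hr : Λ.real k v)
    (hr' : Λ.real k' v') (h : Λ.RowOf k v w ξ) (h' : Λ.RowOf k' v' w ξ')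
    (hs : 3 * Λ.X w < ξ ∧ 3 * Λ.X w < ξ' ∨ ξ < 3 * Λ.X w ∧ ξ' < 3 * Λ.X w) : k = k' ∧ v = v' := by
  have HV : ∀ v v' w ξ ξ', Λ.real .horiz v → Λ.real .vert v' → Λ.RowOf .horiz v w ξ →
      Λ.RowOf .vert v' w ξ' →
      ¬ (3 * Λ.X w < ξ ∧ 3 * Λ.X w < ξ' ∨ ξ < 3 * Λ.X w ∧ ξ' < 3 * Λ.X w) := by
    rintro v v' w ξ ξ' hr hr' ⟨rfl, rfl⟩ ⟨h1, rfl, rfl⟩ hs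
    have := hΛ.closing_vert v' hr' h1 hr
    have := Λ.offX_bounds (Λ.p v')
    omega
  have HS : ∀ v r w ξ ξ', Λ.real .horiz v → Λ.real .steep r → Λ.RowOf .horiz v w ξ →
      Λ.RowOf .steep r w ξ' → (3 * Λ.X w < ξ ∧ 3 * Λ.X w < ξ' ∨ ξ < 3 * Λ.X w ∧ ξ' < 3 * Λ.X w) →
      Λ.X r < Λ.X (Λ.q r) := by
    rintro v r w ξ ξ' hr hr' ⟨rfl, rfl⟩ ⟨rfl, rfl⟩ hs
    have := hΛ.steep_lt r hr' hr
    have := Λ.offX_bounds (Λ.q r)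
    omega
  have VS : ∀ v r w ξ ξ', Λ.real .vert v → Λ.real .steep r → Λ.RowOf .vert v w ξ →
      ¬ Λ.RowOf .steep r w ξ' := by
    rintro v r w ξ ξ' hr hr' ⟨h1, rfl, rfl⟩ ⟨h2, rfl⟩
    exact hΛ.closing_vert_steep v r hr h1 hr' h2.symm
  have S : ∀ r, Λ.real .steep r → Λ.X (Λ.q r) ≤ Λ.X r := fun r hr =>
    hΛ.lab_le r _ hr ((hΛ.lab_q r r hr).2 rfl)
  cases k <;> cases k'
  · exact ⟨rfl, hΛ.p_inj (h.2.1.symm.trans h'.2.1)⟩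
  · exact (HV _ _ _ _ _ hr' hr h' h (by tauto)).elim
  · exact (VS _ _ _ _ _ hr hr' h h').elim
  · exact (HV _ _ _ _ _ hr hr' h h' hs).elim
  · exact ⟨rfl, h.1.symm.trans h'.1⟩
  · exact absurd (HS _ _ _ _ _ hr hr' h h' hs) (not_lt.2 (S _ hr'))
  · exact (VS _ _ _ _ _ hr' hr h' h).elim
  · exact absurd (HS _ _ _ _ _ hr' hr h' h (by tauto)) (not_lt.2 (S _ hr))
  · exact ⟨rfl, hΛ.q_inj (h.1.symm.trans h'.1)⟩

theorem colOf_unique (hΛ : Λ.Good) {k k' : Kind} {v v' w : Fin n} {η η' : ℤ} (hr : Λ.real k v)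
    (hr' : Λ.real k' v') (h : Λ.ColOf k v w η) (h' : Λ.ColOf k' v' w η')
    (hs : 3 * Λ.Y w < η ∧ 3 * Λ.Y w < η' ∨ η < 3 * Λ.Y w ∧ η' < 3 * Λ.Y w) : k = k' ∧ v = v' := by
  have HV : ∀ v v' w η η', Λ.real .vert v → Λ.real .horiz v' → Λ.ColOf .vert v w η →
      Λ.ColOf .horiz v' w η' →
      ¬ (3 * Λ.Y w < η ∧ 3 * Λ.Y w < η' ∨ η < 3 * Λ.Y w ∧ η' < 3 * Λ.Y w) := by
    rintro v v' w η η' hr hr' ⟨rfl, rfl⟩ ⟨h1, rfl, rfl⟩ hs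
    have := hΛ.closing_horiz v' hr' h1 hr
    have := Λ.offY_bounds (Λ.q v')
    omega
  cases k <;> cases k'
  · exact ⟨rfl, h.1.symm.trans h'.1⟩
  · exact (HV _ _ _ _ _ hr hr' h h' hs).elim
  · exact h'.elim
  · exact (HV _ _ _ _ _ hr' hr h' h (by tauto)).elim
  · exact ⟨rfl, hΛ.q_inj (h.2.1.symm.trans h'.2.1)⟩
  · exact h'.elim
  · exact h.elim
  · exact h.elim
  · exact h.elim

theorem row_unique (hΛ : Λ.Good) {k k' : Kind} {v v' : Fin n} {x : ℝ × ℝ} (hr : Λ.real k v)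
    (hr' : Λ.real k' v') (h : Λ.InRow k v x) (h' : Λ.InRow k' v' x) : k = k' ∧ v = v' := by
  obtain ⟨w, ξ, hw, hy, hx⟩ := h
  obtain ⟨w', ξ', hw', hy', hx'⟩ := h'
  obtain rfl : w = w' := hΛ.Y_inj (by
    have : (3 * Λ.Y w : ℤ) = 3 * Λ.Y w' := by exact_mod_cast hy.symm.trans hy'
    omega)
  refine rowOf_unique hΛ hr hr' hw hw' ?_
  rcases hx with ⟨h1, h2⟩ | ⟨h1, h2⟩ <;> rcases hx' with ⟨h3, h4⟩ | ⟨h3, h4⟩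
  · exact .inl ⟨by exact_mod_cast h1.trans_le h2, by exact_mod_cast h3.trans_le h4⟩
  · linarith
  · linarith
  · exact .inr ⟨by exact_mod_cast h1.trans_lt h2, by exact_mod_cast h3.trans_lt h4⟩

theorem col_unique (hΛ : Λ.Good) {k k' : Kind} {v v' : Fin n} {x : ℝ × ℝ} (hr : Λ.real k v)
    (hr' : Λ.real k' v') (h : Λ.InCol k v x) (h' : Λ.InCol k' v' x) : k = k' ∧ v = v' := by
  obtain ⟨w, ξ, hw, hy, hx⟩ := h
  obtain ⟨w', ξ', hw', hy', hx'⟩ := h'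
  obtain rfl : w = w' := hΛ.X_inj (by
    have : (3 * Λ.X w : ℤ) = 3 * Λ.X w' := by exact_mod_cast hy.symm.trans hy'
    omega)
  refine colOf_unique hΛ hr hr' hw hw' ?_
  rcases hx with ⟨h1, h2⟩ | ⟨h1, h2⟩ <;> rcases hx' with ⟨h3, h4⟩ | ⟨h3, h4⟩
  · exact .inl ⟨by exact_mod_cast h1.trans_le h2, by exact_mod_cast h3.trans_le h4⟩
  · linarith
  · linarith
  · exact .inr ⟨by exact_mod_cast h1.trans_lt h2, by exact_mod_cast h3.trans_lt h4⟩

theorem ne_of_between {c a : ℤ} {x : ℝ} (h : ((3 * c : ℤ) : ℝ) < x ∧ x < ((3 * c + 3 : ℤ) : ℝ)) :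
    x ≠ ((3 * a : ℤ) : ℝ) := by
  rintro rfl
  have h1 : 3 * c < 3 * a := by exact_mod_cast h.1
  have h2 : 3 * a < 3 * c + 3 := by exact_mod_cast h.2
  omega

theorem between_eq {c a : ℤ} {x : ℝ} (h : ((3 * c : ℤ) : ℝ) < x ∧ x < ((3 * c + 3 : ℤ) : ℝ))
    (h' : ((3 * a : ℤ) : ℝ) < x ∧ x < ((3 * a + 3 : ℤ) : ℝ)) : c = a := by
  have h1 : 3 * c < 3 * a + 3 := by exact_mod_cast h.1.trans h'.2
  have h2 : 3 * a < 3 * c + 3 := by exact_mod_cast h'.1.trans h.2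
  omega

/-- A point strictly inside the segment of a pair of consecutive columns or rows. -/
theorem between_of_param {a b : ℤ} {x t : ℝ} (hab : a = b + 1 ∨ b = a + 1) (h0 : 0 < t)
    (h1 : t < 1) (hx : x = 3 * a + t * (3 * (b - a))) :
    ((3 * min a b : ℤ) : ℝ) < x ∧ x < ((3 * min a b + 3 : ℤ) : ℝ) := by
  rcases hab with rfl | rfl
  · rw [min_eq_right (by omega)]; push_cast at hx ⊢; constructor <;> nlinarith
  · rw [min_eq_left (by omega)]; push_cast at hx ⊢; constructor <;> nlinarith

/-- Localisation of a slanted segment: it stays in the strip between two consecutive columns and in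
a unit strip along the row of its tail. All disjointness statements about slanted segments rest on
such boxes. -/
theorem slant_vert {v : Fin n} {x : ℝ × ℝ} (h : Λ.InSlant .vert v x) :
    (((3 * min (Λ.X (Λ.p v)) (Λ.X v) : ℤ) : ℝ) < x.1 ∧
      x.1 < ((3 * min (Λ.X (Λ.p v)) (Λ.X v) + 3 : ℤ) : ℝ)) ∧
    ((((3 * Λ.Y (Λ.p v) : ℤ) : ℝ) < x.2 ∧ x.2 < ((3 * Λ.Y (Λ.p v) + 1 : ℤ) : ℝ)) ∨
      ((3 * Λ.Y (Λ.p v) - 1 : ℤ) : ℝ) < x.2 ∧ x.2 < ((3 * Λ.Y (Λ.p v) : ℤ) : ℝ)) := by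
  obtain ⟨ha, t, h0, h1, hx, hy⟩ := h
  refine ⟨between_of_param ha h0 h1 hx, ?_⟩
  rcases Λ.offY_cases v with h | ⟨-, ⟨-, h⟩ | ⟨-, h⟩⟩
  · exact absurd ha h.1
  · rw [h] at hy; left; push_cast at hy ⊢; constructor <;> linarith
  · rw [h] at hy; right; push_cast at hy ⊢; constructor <;> linarith

theorem slant_horiz {v : Fin n} {x : ℝ × ℝ} (h : Λ.InSlant .horiz v x) :
    (((3 * min (Λ.Y (Λ.q v)) (Λ.Y v) : ℤ) : ℝ) < x.2 ∧
      x.2 < ((3 * min (Λ.Y (Λ.q v)) (Λ.Y v) + 3 : ℤ) : ℝ)) ∧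
    ((((3 * Λ.X (Λ.q v) : ℤ) : ℝ) < x.1 ∧ x.1 < ((3 * Λ.X (Λ.q v) + 1 : ℤ) : ℝ)) ∧
        Λ.X (Λ.q v) < Λ.X v ∨
      ((3 * Λ.X (Λ.q v) - 1 : ℤ) : ℝ) < x.1 ∧ x.1 < ((3 * Λ.X (Λ.q v) : ℤ) : ℝ)) := by
  obtain ⟨ha, t, h0, h1, hx, hy⟩ := h
  refine ⟨between_of_param ha h0 h1 hy, ?_⟩
  rcases Λ.offX_cases v with h | ⟨-, ⟨h', h⟩ | ⟨-, h⟩⟩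
  · exact absurd ha h.1
  · rw [h] at hx; left; push_cast at hx ⊢; refine ⟨⟨?_, ?_⟩, h'⟩ <;> linarith
  · rw [h] at hx; right; push_cast at hx ⊢; constructor <;> linarith

theorem slant_steep {v : Fin n} {x : ℝ × ℝ} (h : Λ.InSlant .steep v x) :
    ((3 * Λ.X v : ℤ) : ℝ) < x.1 ∧ x.1 < ((3 * Λ.X v + 1 : ℤ) : ℝ) := by
  obtain ⟨t, h0, h1, hx, -⟩ := h
  push_cast; constructor <;> linarith

/-- Vertex columns are the multiples of three, and every slanted segment lies strictly between two
of them. Hence slanted segments meet neither vertices nor vertical parts. -/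
theorem slant_ne_col {k : Kind} {v : Fin n} {x : ℝ × ℝ} (h : Λ.InSlant k v x) (a : ℤ) :
    x.1 ≠ ((3 * a : ℤ) : ℝ) := by
  cases k with
  | vert => exact ne_of_between (slant_vert h).1
  | horiz =>
    rcases (slant_horiz h).2 with ⟨⟨h1, h2⟩, -⟩ | ⟨h1, h2⟩
    · refine ne_of_between (c := Λ.X (Λ.q v)) ⟨h1, h2.trans ?_⟩; push_cast; linarith
    · refine ne_of_between (c := Λ.X (Λ.q v) - 1) ⟨lt_trans ?_ h1, ?_⟩
      · push_cast; linarith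
      · push_cast at h2 ⊢; linarith
  | steep =>
    obtain ⟨h1, h2⟩ := slant_steep h
    refine ne_of_between (c := Λ.X v) ⟨h1, h2.trans ?_⟩; push_cast; linarith

theorem not_inRow_pos (hΛ : Λ.Good) {k : Kind} {v u : Fin n} :
    ¬ Λ.InRow k v (toPlane (Λ.pos u)) := by
  rintro ⟨w, ξ, -, hy, hx⟩
  obtain rfl : u = w := hΛ.Y_inj (by
    have : (3 * Λ.Y u : ℤ) = 3 * Λ.Y w := Int.cast_injective (α := ℝ) hy
    omega)
  rcases hx with h | h
  · exact lt_irrefl _ h.1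
  · exact lt_irrefl _ h.2

theorem not_inCol_pos (hΛ : Λ.Good) {k : Kind} {v u : Fin n} :
    ¬ Λ.InCol k v (toPlane (Λ.pos u)) := by
  rintro ⟨w, ξ, -, hy, hx⟩
  obtain rfl : u = w := hΛ.X_inj (by
    have : (3 * Λ.X u : ℤ) = 3 * Λ.X w := Int.cast_injective (α := ℝ) hy
    omega)
  rcases hx with h | h
  · exact lt_irrefl _ h.1
  · exact lt_irrefl _ h.2

theorem eq_of_pos_mem_curve (hΛ : Λ.Good) {k : Kind} {v w : Fin n} (hr : Λ.real k v)
    (h : toPlane (Λ.pos w) ∈ Λ.curve k v) : w = Λ.tail k v ∨ w = v := by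
  have inj : ∀ u, toPlane (Λ.pos w) = toPlane (Λ.pos u) → w = u := fun u h => by
    have h1 := congrArg Prod.fst h
    refine hΛ.X_inj ?_
    have : (3 * Λ.X w : ℤ) = 3 * Λ.X u := Int.cast_injective (α := ℝ) h1
    omega
  rcases parts hΛ hr h with h | h | h | h | h
  · exact .inl (inj _ h)
  · exact .inr (inj _ h)
  · exact (not_inRow_pos hΛ h).elim
  · exact (not_inCol_pos hΛ h).elim
  · exact (slant_ne_col h (Λ.X w) rfl).elim

/-- A horizontal part that ends on a vertex column has no offset, so its end is the corner of an
L-shaped edge and lies on the vertical part of the same edge too. -/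
theorem row_end (hΛ : Λ.Good) {k : Kind} {v w : Fin n} {ξ a : ℤ} {x : ℝ × ℝ} (hr : Λ.real k v)
    (h : Λ.RowOf k v w ξ) (hy : x.2 = ((3 * Λ.Y w : ℤ) : ℝ)) (hx : x.1 = ξ) (ha : ξ = 3 * a) :
    Λ.InCol k v x := by
  have hY := hΛ.Y_inj.ne (hΛ.loopless k v hr)
  cases k with
  | vert =>
    obtain ⟨h1, rfl, rfl⟩ := h
    refine ⟨v, _, ⟨rfl, rfl⟩, hx, ?_⟩
    have : Λ.offY v = 0 := by rcases Λ.offY_cases v with h | h <;> tauto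
    simp only [tail] at hY
    rw [hy, this, add_zero]
    simp only [Int.cast_lt, Int.cast_le]; omega
  | horiz =>
    obtain ⟨rfl, rfl⟩ := h
    -- An offset of one would make the abscissa of the bend indivisible by three.
    have : ¬ Λ.AdjY w ∧ Λ.offX w = 0 := by
      rcases Λ.offX_cases w with h | h
      · exact h
      · omega
    refine ⟨_, _, ⟨this.1, rfl, rfl⟩, by simpa [this.2] using hx, ?_⟩
    simp only [tail] at hY
    rw [hy]
    simp only [Int.cast_lt, Int.cast_le]; omega
  | steep =>
    obtain ⟨rfl, rfl⟩ := h
    omega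

theorem col_end (hΛ : Λ.Good) {k : Kind} {v w : Fin n} {η a : ℤ} {x : ℝ × ℝ} (hr : Λ.real k v)
    (h : Λ.ColOf k v w η) (hx : x.1 = ((3 * Λ.X w : ℤ) : ℝ)) (hy : x.2 = η) (ha : η = 3 * a) :
    Λ.InRow k v x := by
  have hX := hΛ.X_inj.ne (hΛ.loopless k v hr)
  cases k with
  | horiz =>
    obtain ⟨h1, rfl, rfl⟩ := h
    refine ⟨v, _, ⟨rfl, rfl⟩, hy, ?_⟩
    have : Λ.offX v = 0 := by rcases Λ.offX_cases v with h | h <;> tauto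
    simp only [tail] at hX
    rw [hx, this, add_zero]
    simp only [Int.cast_lt, Int.cast_le]; omega
  | vert =>
    obtain ⟨rfl, rfl⟩ := h
    have : ¬ Λ.AdjX w ∧ Λ.offY w = 0 := by
      rcases Λ.offY_cases w with h | h
      · exact h
      · omega
    refine ⟨_, _, ⟨this.1, rfl, rfl⟩, by simpa [this.2] using hy, ?_⟩
    simp only [tail] at hX
    rw [hx]
    simp only [Int.cast_lt, Int.cast_le]; omega
  | steep => exact h.elim

/-- Edges of both factors stay inside the component of `r`, whose rightmost vertex is `r`, and an
offset to the right occurs only if the head is still further right. The steep edge at `r` is the one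
exception. -/
theorem rowOf_le (hΛ : Λ.Good) {k : Kind} {v w r : Fin n} {ξ : ℤ} (hr : Λ.real k v)
    (hs : Λ.real .steep r) (hne : ¬ (k = .steep ∧ v = r)) (h : Λ.RowOf k v w ξ)
    (hw : Λ.lab w = Λ.lab r) : ξ ≤ 3 * Λ.X r := by
  cases k with
  | vert =>
    obtain ⟨h1, rfl, rfl⟩ := h
    have := hΛ.lab_le r v hs ((hΛ.lab_p r v hs).1 hw)
    omega
  | horiz =>
    obtain ⟨rfl, rfl⟩ := h
    have h1 := hΛ.lab_le r w hs hw
    have h2 := hΛ.lab_le r _ hs ((hΛ.lab_q r w hs).2 hw)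
    rcases Λ.offX_cases w with h | ⟨-, h | h⟩ <;> omega
  | steep =>
    obtain ⟨rfl, rfl⟩ := h
    exact (hne ⟨rfl, hΛ.steep_unique r v hs hr ((hΛ.lab_q r v hs).1 hw)⟩).elim

/-- Slanted segments of the kinds `vert` and `horiz` lie strictly between rows. A steep segment does
cross rows, but only those of its own component, and it lies to the right of the column where their
horizontal parts end. -/
theorem not_inRow_inSlant (hΛ : Λ.Good) {k k' : Kind} {v v' : Fin n} {x : ℝ × ℝ}
    (hr : Λ.real k v) (hr' : Λ.real k' v') (hne : ¬ (k = k' ∧ v = v')) (h : Λ.InRow k v x)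
    (h' : Λ.InSlant k' v' x) : False := by
  obtain ⟨w, ξ, hw, hy, hx⟩ := h
  cases k' with
  | vert =>
    rcases (slant_vert h').2 with ⟨h1, h2⟩ | ⟨h1, h2⟩
    · refine ne_of_between (c := Λ.Y (Λ.p v')) ⟨h1, h2.trans ?_⟩ hy; push_cast; linarith
    · refine ne_of_between (c := Λ.Y (Λ.p v') - 1) ⟨lt_trans ?_ h1, ?_⟩ hy
      · push_cast; linarith
      · push_cast at h2 ⊢; linarith
  | horiz => exact ne_of_between (slant_horiz h').1 hy
  | steep =>
    have hY : Λ.Y (Λ.q v') ≠ Λ.Y v' := hΛ.Y_inj.ne (hΛ.loopless .steep v' hr')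
    obtain ⟨t, h0, h1, h2, h3⟩ := h'
    have hlab : Λ.lab w = Λ.lab v' := by
      refine hΛ.lab_between v' w hr' ?_
      have h4 : (Λ.Y w : ℝ) = Λ.Y v' + t * (Λ.Y (Λ.q v') - Λ.Y v') := by
        have := hy.symm.trans h3; push_cast at this; linarith
      rcases lt_or_gt_of_ne hY with h | h
      · have h' : (Λ.Y (Λ.q v') : ℝ) < Λ.Y v' := by exact_mod_cast h
        right; constructor
        · have : (Λ.Y (Λ.q v') : ℝ) < Λ.Y w := by nlinarith
          exact_mod_cast this
        · have : (Λ.Y w : ℝ) < Λ.Y v' := by nlinarith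
          exact_mod_cast this
      · have h' : (Λ.Y v' : ℝ) < Λ.Y (Λ.q v') := by exact_mod_cast h
        left; constructor
        · have : (Λ.Y v' : ℝ) < Λ.Y w := by nlinarith
          exact_mod_cast this
        · have : (Λ.Y w : ℝ) < Λ.Y (Λ.q v') := by nlinarith
          exact_mod_cast this
    have h4 : (ξ : ℝ) ≤ ((3 * Λ.X v' : ℤ) : ℝ) := by
      exact_mod_cast rowOf_le hΛ hr hr' hne hw hlab
    have h5 : ((3 * Λ.X w : ℤ) : ℝ) ≤ ((3 * Λ.X v' : ℤ) : ℝ) := by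
      have := hΛ.lab_le v' w hr' hlab
      exact_mod_cast (by omega : 3 * Λ.X w ≤ 3 * Λ.X v')
    have h6 : ((3 * Λ.X v' : ℤ) : ℝ) < x.1 := by push_cast; linarith
    rcases hx with h | h <;> linarith

theorem not_inCol_inSlant {k k' : Kind} {v v' : Fin n} {x : ℝ × ℝ} (h : Λ.InCol k v x)
    (h' : Λ.InSlant k' v' x) : False := by
  obtain ⟨w, η, hw, hx, hy⟩ := h
  exact slant_ne_col h' _ hx

/-- Two slanted segments of the same kind lie in disjoint unit strips, one for each tail (head, for
steep ones). Mixed kinds need the box of `slant_vert` against that of `slant_horiz`, and the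
extremality of `r` against steep segments. -/
theorem slant_unique (hΛ : Λ.Good) {k k' : Kind} {v v' : Fin n} {x : ℝ × ℝ}
    (hr : Λ.real k v) (hr' : Λ.real k' v') (h : Λ.InSlant k v x) (h' : Λ.InSlant k' v' x) :
    k = k' ∧ v = v' := by
  have VH : ∀ v v', Λ.real .vert v → Λ.real .horiz v' → Λ.InSlant .vert v x →
      ¬ Λ.InSlant .horiz v' x := by
    intro v v' hr hr' h h'
    obtain ⟨a1, a2⟩ := slant_vert h
    obtain ⟨b1, b2⟩ := slant_horiz h'
    have c1 : Λ.q v' = Λ.p v ∨ Λ.q v' = v := by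
      have hd := h.1
      have h1 : 3 * min (Λ.X (Λ.p v)) (Λ.X v) < 3 * Λ.X (Λ.q v') + 1 ∧
          3 * Λ.X (Λ.q v') - 1 < 3 * min (Λ.X (Λ.p v)) (Λ.X v) + 3 := by
        rcases b2 with ⟨⟨h1, h2⟩, -⟩ | ⟨h1, h2⟩
        · refine ⟨by exact_mod_cast a1.1.trans h2, ?_⟩
          have : 3 * Λ.X (Λ.q v') < 3 * min (Λ.X (Λ.p v)) (Λ.X v) + 3 := by
            exact_mod_cast h1.trans a1.2
          omega
        · refine ⟨?_, by exact_mod_cast h1.trans a1.2⟩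
          have : 3 * min (Λ.X (Λ.p v)) (Λ.X v) < 3 * Λ.X (Λ.q v') := by
            exact_mod_cast a1.1.trans h2
          omega
      have : Λ.X (Λ.q v') = Λ.X (Λ.p v) ∨ Λ.X (Λ.q v') = Λ.X v := by
        unfold AdjX at hd; omega
      exact this.imp (fun h => hΛ.X_inj h) (fun h => hΛ.X_inj h)
    have c2 : Λ.p v = Λ.q v' ∨ Λ.p v = v' := by
      have hd := h'.1
      have h1 : 3 * min (Λ.Y (Λ.q v')) (Λ.Y v') < 3 * Λ.Y (Λ.p v) + 1 ∧
          3 * Λ.Y (Λ.p v) - 1 < 3 * min (Λ.Y (Λ.q v')) (Λ.Y v') + 3 := by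
        rcases a2 with ⟨h1, h2⟩ | ⟨h1, h2⟩
        · refine ⟨by exact_mod_cast b1.1.trans h2, ?_⟩
          have : 3 * Λ.Y (Λ.p v) < 3 * min (Λ.Y (Λ.q v')) (Λ.Y v') + 3 := by
            exact_mod_cast h1.trans b1.2
          omega
        · refine ⟨?_, by exact_mod_cast h1.trans b1.2⟩
          have : 3 * min (Λ.Y (Λ.q v')) (Λ.Y v') < 3 * Λ.Y (Λ.p v) := by
            exact_mod_cast b1.1.trans h2
          omega
      have : Λ.Y (Λ.p v) = Λ.Y (Λ.q v') ∨ Λ.Y (Λ.p v) = Λ.Y v' := by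
        unfold AdjY at hd; omega
      exact this.imp (fun h => hΛ.Y_inj h) (fun h => hΛ.Y_inj h)
    -- With a common tail, an intersection would force both `t' = 3 * t` and `t = 3 * t'`: one
    -- segment has slope at most a third in absolute value, the other at least three. Otherwise the
    -- boxes meet only if the two edges join the same vertices in opposite directions, against
    -- `simple`.
    by_cases huu : Λ.q v' = Λ.p v
    · obtain ⟨ha, t, h0, h1, hx, hy⟩ := h
      obtain ⟨ha', t', h0', h1', hx', hy'⟩ := h'
      rw [huu] at hx' hy'
      unfold AdjX at ha
      unfold AdjY at ha'
      rw [huu] at ha'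
      have e1 : t' * (Λ.offX v' : ℝ) = t * (3 * (Λ.X v - Λ.X (Λ.p v))) := by linarith
      have e2 : t * (Λ.offY v : ℝ) = t' * (3 * (Λ.Y v' - Λ.Y (Λ.p v))) := by linarith
      have hX : ((Λ.X v - Λ.X (Λ.p v) : ℤ) : ℝ) = 1 ∨ ((Λ.X v - Λ.X (Λ.p v) : ℤ) : ℝ) = -1 := by
        rcases ha with h | h
        · right; exact_mod_cast (by omega : Λ.X v - Λ.X (Λ.p v) = -1)
        · left; exact_mod_cast (by omega : Λ.X v - Λ.X (Λ.p v) = 1)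
      have hY : ((Λ.Y v' - Λ.Y (Λ.p v) : ℤ) : ℝ) = 1 ∨
          ((Λ.Y v' - Λ.Y (Λ.p v) : ℤ) : ℝ) = -1 := by
        rcases ha' with h | h
        · right; exact_mod_cast (by omega : Λ.Y v' - Λ.Y (Λ.p v) = -1)
        · left; exact_mod_cast (by omega : Λ.Y v' - Λ.Y (Λ.p v) = 1)
      have hoX : (Λ.offX v' : ℝ) = 0 ∨ (Λ.offX v' : ℝ) = 1 ∨ (Λ.offX v' : ℝ) = -1 := by
        rcases Λ.offX_cases v' with h | ⟨-, h | h⟩ <;> simp [h]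
      push_cast at hX hY
      have k1 : t' = 3 * t ∨ t' ≤ 0 ∨ t ≤ 0 := by
        rcases hX with h | h <;> rcases hoX with h' | h' | h' <;> rw [h, h'] at e1
        · right; right; linarith
        · left; linarith
        · right; right; linarith
        · right; right; linarith
        · right; right; linarith
        · left; linarith
      have hoY : (Λ.offY v : ℝ) = 0 ∨ (Λ.offY v : ℝ) = 1 ∨ (Λ.offY v : ℝ) = -1 := by
        rcases Λ.offY_cases v with h | ⟨-, h | h⟩ <;> simp [h]
      have k2 : t = 3 * t' ∨ t' ≤ 0 ∨ t ≤ 0 := by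
        rcases hY with h | h <;> rcases hoY with h' | h' | h' <;> rw [h, h'] at e2
        · right; left; linarith
        · left; linarith
        · right; left; linarith
        · right; left; linarith
        · right; left; linarith
        · left; linarith
      rcases k1 with h | h | h <;> rcases k2 with h' | h' | h' <;> linarith
    · have h1 := c1.resolve_left huu
      have h2 := c2.resolve_left (Ne.symm huu)
      have := (hΛ.simple _ _ _ _ hr hr' (by
        simp only [tail]; rw [h1, h2]; exact Sym2.eq_swap)).1
      simp at this
  have VS : ∀ v r, Λ.real .steep r → Λ.InSlant .vert v x → ¬ Λ.InSlant .steep r x := by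
    intro v r hr h h'
    have a := (slant_vert h).1
    obtain ⟨b1, b2⟩ := slant_steep h'
    have hd := h.1
    -- Both ends of the first-factor edge are in one block; if the left one is `r`, the other would
    -- be to the right of the rightmost vertex.
    have hm : min (Λ.X (Λ.p v)) (Λ.X v) = Λ.X r :=
      between_eq a ⟨b1, b2.trans (by push_cast; linarith)⟩
    have hlp := hΛ.lab_p r v hr
    have hle := hΛ.lab_le r v hr
    have hle' := hΛ.lab_le r (Λ.p v) hr
    unfold AdjX at hd
    rcases min_choice (Λ.X (Λ.p v)) (Λ.X v) with h1 | h1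
    · have h2 : Λ.p v = r := hΛ.X_inj (by omega)
      have h3 := hle (hlp.1 (by rw [h2]))
      omega
    · have h2 : v = r := hΛ.X_inj (by omega)
      have h3 := hle' (hlp.2 (by rw [h2]))
      omega
  have HS : ∀ v r, Λ.real .steep r → Λ.InSlant .horiz v x → ¬ Λ.InSlant .steep r x := by
    intro v r hr h h'
    obtain ⟨b1, b2⟩ := slant_steep h'
    rcases (slant_horiz h).2 with ⟨⟨h1, h2⟩, h3⟩ | ⟨h1, h2⟩
    · have h4 : Λ.q v = r := hΛ.X_inj (between_eq ⟨h1, h2.trans (by push_cast; linarith)⟩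
        ⟨b1, b2.trans (by push_cast; linarith)⟩)
      have := hΛ.lab_le r v hr ((hΛ.lab_q r v hr).1 (by rw [h4]))
      rw [h4] at h3; omega
    · have h4 : 3 * Λ.X r < 3 * Λ.X (Λ.q v) := by exact_mod_cast b1.trans h2
      have h5 : 3 * Λ.X (Λ.q v) - 1 < 3 * Λ.X r + 1 := by exact_mod_cast h1.trans b2
      omega
  cases k <;> cases k'
  · refine ⟨rfl, hΛ.p_inj (hΛ.Y_inj ?_)⟩
    rcases (slant_vert h).2 with ⟨h1, h2⟩ | ⟨h1, h2⟩ <;>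
      rcases (slant_vert h').2 with ⟨h3, h4⟩ | ⟨h3, h4⟩ <;>
      have h5 := Int.cast_lt.1 (h1.trans h4) <;> have h6 := Int.cast_lt.1 (h3.trans h2) <;> omega
  · exact (VH _ _ hr hr' h h').elim
  · exact (VS _ _ hr' h h').elim
  · exact (VH _ _ hr' hr h' h).elim
  · refine ⟨rfl, hΛ.q_inj (hΛ.X_inj ?_)⟩
    rcases (slant_horiz h).2 with ⟨⟨h1, h2⟩, -⟩ | ⟨h1, h2⟩ <;>
      rcases (slant_horiz h').2 with ⟨⟨h3, h4⟩, -⟩ | ⟨h3, h4⟩ <;>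
      have h5 := Int.cast_lt.1 (h1.trans h4) <;> have h6 := Int.cast_lt.1 (h3.trans h2) <;> omega
  · exact (HS _ _ hr' h h').elim
  · exact (VS _ _ hr h' h).elim
  · exact (HS _ _ hr h' h).elim
  · refine ⟨rfl, hΛ.X_inj ?_⟩
    obtain ⟨h1, h2⟩ := slant_steep h
    obtain ⟨h3, h4⟩ := slant_steep h'
    have h5 := Int.cast_lt.1 (h1.trans h4)
    have h6 := Int.cast_lt.1 (h3.trans h2)
    omega

/-- The two segments of an edge. -/
noncomputable def segs (Λ : Layout n) (k : Kind) (v : Fin n) : List (GridPoint × GridPoint) :=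
  [(Λ.pos (Λ.tail k v), Λ.bend k v), (Λ.bend k v, Λ.pos v)]

theorem row_seg {k : Kind} {v w : Fin n} {ξ : ℤ} (h : Λ.RowOf k v w ξ) :
    ∃ s ∈ Λ.segs k v, s = (Λ.pos w, (ξ, 3 * Λ.Y w)) ∨ s = ((ξ, 3 * Λ.Y w), Λ.pos w) := by
  cases k with
  | vert =>
    obtain ⟨h1, rfl, rfl⟩ := h
    refine ⟨_, List.mem_cons_self, .inl ?_⟩
    have : Λ.offY v = 0 := by rcases Λ.offY_cases v with h | h <;> tauto
    simp [bend, tail, this]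
  | horiz =>
    obtain ⟨rfl, rfl⟩ := h
    exact ⟨_, List.mem_cons_of_mem _ List.mem_cons_self, .inr rfl⟩
  | steep =>
    obtain ⟨rfl, rfl⟩ := h
    exact ⟨_, List.mem_cons_self, .inl rfl⟩

theorem col_seg {k : Kind} {v w : Fin n} {η : ℤ} (h : Λ.ColOf k v w η) :
    ∃ s ∈ Λ.segs k v, s = (Λ.pos w, (3 * Λ.X w, η)) ∨ s = ((3 * Λ.X w, η), Λ.pos w) := by
  cases k with
  | horiz =>
    obtain ⟨h1, rfl, rfl⟩ := h
    refine ⟨_, List.mem_cons_self, .inl ?_⟩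
    have : Λ.offX v = 0 := by rcases Λ.offX_cases v with h | h <;> tauto
    simp [bend, tail, this]
  | vert =>
    obtain ⟨rfl, rfl⟩ := h
    exact ⟨_, List.mem_cons_of_mem _ List.mem_cons_self, .inr rfl⟩
  | steep => exact h.elim

/-- The edges cross in `x` at a right angle. -/
def Cross (Λ : Layout n) (k : Kind) (v : Fin n) (k' : Kind) (v' : Fin n) (x : ℝ × ℝ) : Prop :=
  ∃ s ∈ Λ.segs k v, ∃ t ∈ Λ.segs k' v', x ∈ openSeg s ∧ x ∈ openSeg t ∧ Perp s t

theorem Cross.symm {k k' : Kind} {v v' : Fin n} {x : ℝ × ℝ} (h : Λ.Cross k v k' v' x) :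
    Λ.Cross k' v' k v x := by
  obtain ⟨s, hs, t, ht, h1, h2, h3⟩ := h
  exact ⟨t, ht, s, hs, h2, h1, by unfold Perp at *; linarith⟩

/-- Perpendicularity is automatic. The point to check is that `x` is not an end of either segment,
that is, not a bend. -/
theorem cross_of_row_col (hΛ : Λ.Good) {k k' : Kind} {v v' : Fin n} {x : ℝ × ℝ}
    (hr : Λ.real k v) (hr' : Λ.real k' v') (hne : ¬ (k = k' ∧ v = v')) (h : Λ.InRow k v x)
    (h' : Λ.InCol k' v' x) : Λ.Cross k v k' v' x := by
  have h₀ := h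
  have h₀' := h'
  obtain ⟨w, ξ, hw, hy, hx⟩ := h
  obtain ⟨w', η, hw', hx', hy'⟩ := h'
  -- A bend on a vertex column is a corner, and by `row_end` it belongs to the vertical part of its
  -- own edge; two different edges would then overlap in a column.
  have n1 : x.1 ≠ ξ := fun he => hne (col_unique hΛ hr hr'
    (row_end hΛ hr hw hy he (by exact_mod_cast he.symm.trans hx')) h₀')
  have n2 : x.2 ≠ η := fun he => hne (row_unique hΛ hr hr' h₀
    (col_end hΛ hr' hw' hx' he (by exact_mod_cast he.symm.trans hy)))
  obtain ⟨s, hs, es⟩ := row_seg hw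
  obtain ⟨t, ht, et⟩ := col_seg hw'
  refine ⟨s, hs, t, ht, ?_, ?_, ?_⟩
  · have : x ∈ openSeg (Λ.pos w, (ξ, 3 * Λ.Y w)) := by
      refine mem_openSeg_horizontal hy ?_
      exact hx.imp (fun h => ⟨h.1, h.2.lt_of_ne n1⟩) (fun h => ⟨h.1.lt_of_ne' n1, h.2⟩)
    rcases es with rfl | rfl
    · exact this
    · rwa [openSeg_swap]
  · have : x ∈ openSeg (Λ.pos w', (3 * Λ.X w', η)) := by
      refine mem_openSeg_vertical hx' ?_
      exact hy'.imp (fun h => ⟨h.1, h.2.lt_of_ne n2⟩) (fun h => ⟨h.1.lt_of_ne' n2, h.2⟩)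
    rcases et with rfl | rfl
    · exact this
    · rwa [openSeg_swap]
  · rcases es with rfl | rfl <;> rcases et with rfl | rfl <;> simp [Perp, pos]

/-- Common points of two edges of a good layout. -/
theorem common_point (hΛ : Λ.Good) {k k' : Kind} {v v' : Fin n} {x : ℝ × ℝ}
    (hr : Λ.real k v) (hr' : Λ.real k' v') (hne : ¬ (k = k' ∧ v = v')) (h : x ∈ Λ.curve k v)
    (h' : x ∈ Λ.curve k' v') :
    (∃ w, w ∈ s(Λ.tail k v, v) ∧ w ∈ s(Λ.tail k' v', v') ∧ x = toPlane (Λ.pos w)) ∨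
      Λ.Cross k v k' v' x := by
  by_cases hw : ∃ w, x = toPlane (Λ.pos w)
  · obtain ⟨w, rfl⟩ := hw
    refine .inl ⟨w, ?_, ?_, rfl⟩
    · simpa using eq_of_pos_mem_curve hΛ hr h
    · simpa using eq_of_pos_mem_curve hΛ hr' h'
  · push Not at hw
    have hne' : ¬ (k' = k ∧ v' = v) := fun h => hne ⟨h.1.symm, h.2.symm⟩
    rcases parts hΛ hr h with a | a | a | a | a
    · exact (hw _ a).elim
    · exact (hw _ a).elim
    all_goals
      rcases parts hΛ hr' h' with b | b | b | b | b
      · exact (hw _ b).elim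
      · exact (hw _ b).elim
    · exact (hne (row_unique hΛ hr hr' a b)).elim
    · exact .inr (cross_of_row_col hΛ hr hr' hne a b)
    · exact (not_inRow_inSlant hΛ hr hr' hne a b).elim
    · exact .inr (cross_of_row_col hΛ hr' hr hne' b a).symm
    · exact (hne (col_unique hΛ hr hr' a b)).elim
    · exact (not_inCol_inSlant a b).elim
    · exact (not_inRow_inSlant hΛ hr' hr hne' b a).elim
    · exact (not_inCol_inSlant b a).elim
    · exact (hne (slant_unique hΛ hr hr' a b)).elim

/-- One segment of each edge is parallel to an axis, so one coordinate is constant along it; on the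
other segment this coordinate is strictly monotone, because tail and head differ in both
coordinates. -/
theorem inter_eq_bend (hΛ : Λ.Good) {k : Kind} {v : Fin n} (hr : Λ.real k v) :
    closedSeg (Λ.pos (Λ.tail k v), Λ.bend k v) ∩ closedSeg (Λ.bend k v, Λ.pos v) =
      {toPlane (Λ.bend k v)} := by
  have hne := hΛ.loopless k v hr
  have hX : ((3 * Λ.X v : ℤ) : ℝ) - ((3 * Λ.X (Λ.tail k v) : ℤ) : ℝ) ≠ 0 :=
    sub_ne_zero.2 (Int.cast_injective.ne (by have := hΛ.X_inj.ne hne; omega))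
  have hY : ((3 * Λ.Y v : ℤ) : ℝ) - ((3 * Λ.Y (Λ.tail k v) : ℤ) : ℝ) ≠ 0 :=
    sub_ne_zero.2 (Int.cast_injective.ne (by have := hΛ.Y_inj.ne hne; omega))
  refine Set.Subset.antisymm ?_ (Set.singleton_subset_iff.2
    ⟨right_mem_closedSeg _ _, left_mem_closedSeg _ _⟩)
  rintro x ⟨h, h'⟩
  obtain ⟨t, -, -, hx, hy⟩ := exists_of_mem_closedSeg h
  obtain ⟨t', -, -, hx', hy'⟩ := exists_of_mem_closedSeg h'
  cases k with
  | vert =>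
    have : t = 1 := by
      simp only [bend, pos, tail] at hx hx' hX
      rw [sub_self, mul_zero, add_zero] at hx'
      refine mul_right_cancel₀ hX ?_
      linarith
    subst this
    exact Prod.ext (by simpa [toPlane] using hx) (by simpa [toPlane] using hy)
  | horiz =>
    have : t = 1 := by
      simp only [bend, pos, tail] at hy hy' hY
      rw [sub_self, mul_zero, add_zero] at hy'
      refine mul_right_cancel₀ hY ?_
      linarith
    subst this
    exact Prod.ext (by simpa [toPlane] using hx) (by simpa [toPlane] using hy)
  | steep =>
    have : t' = 0 := by
      simp only [bend, pos, tail] at hy hy' hY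
      rw [sub_self, mul_zero, add_zero] at hy
      refine mul_right_cancel₀ hY ?_
      linarith
    subst this
    exact Prod.ext (by simpa [toPlane] using hx') (by simpa [toPlane] using hy')

theorem bend_ne_pos (hΛ : Λ.Good) {k : Kind} {v : Fin n} (hr : Λ.real k v) :
    Λ.bend k v ≠ Λ.pos (Λ.tail k v) ∧ Λ.bend k v ≠ Λ.pos v := by
  have hne := hΛ.loopless k v hr
  have hX := hΛ.X_inj.ne hne
  have hY := hΛ.Y_inj.ne hne
  cases k with
  | vert =>
    have := Λ.offY_cases v
    simp only [tail, bend, pos, ne_eq, Prod.mk.injEq] at *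
    omega
  | horiz =>
    have := Λ.offX_cases v
    simp only [tail, bend, pos, ne_eq, Prod.mk.injEq] at *
    omega
  | steep =>
    simp only [tail, bend, pos, ne_eq, Prod.mk.injEq] at *
    omega

/-- A drawing according to a good layout is a 1-bend RAC drawing. -/
theorem isOneBendRAC (hΛ : Λ.Good) {G : SimpleGraph (Fin n)} {Γ : Drawing (Fin n)}
    (hpos : ∀ v, Γ.pos v = Λ.pos v)
    (hbend : ∀ k v, Λ.real k v → Γ.bend s(Λ.tail k v, v) = some (Λ.bend k v))
    (hadj : ∀ a b, G.Adj a b → ∃ k v, Λ.real k v ∧ s(a, b) = s(Λ.tail k v, v)) :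
    Γ.IsOneBendRAC G := by
  have hpc : ∀ a b k v, Λ.real k v → s(a, b) = s(Λ.tail k v, v) →
      Γ.pieces a b = [(Λ.pos a, Λ.bend k v), (Λ.bend k v, Λ.pos b)] := by
    intro a b k v hr h
    simp only [Drawing.pieces, h, hbend k v hr, hpos]
  have hcurve : ∀ a b k v, Λ.real k v → s(a, b) = s(Λ.tail k v, v) → Γ.curve a b = Λ.curve k v := by
    intro a b k v hr h
    ext x
    simp only [Drawing.curve, hpc a b k v hr h, List.mem_cons, List.not_mem_nil, or_false,
      exists_eq_or_imp, exists_eq_left, Set.mem_ofPred_eq, curve, Set.mem_union]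
    rcases Sym2.eq_iff.1 h with ⟨rfl, rfl⟩ | ⟨rfl, rfl⟩
    · rfl
    · rw [closedSeg_swap (Λ.pos a) (Λ.bend k a), closedSeg_swap (Λ.bend k a) (Λ.pos (Λ.tail k a)),
        or_comm]
  have hseg : ∀ a b k v, Λ.real k v → s(a, b) = s(Λ.tail k v, v) → ∀ s ∈ Λ.segs k v,
      s ∈ Γ.pieces a b ∨ s.swap ∈ Γ.pieces a b := by
    intro a b k v hr h s hs
    rw [hpc a b k v hr h]
    simp only [segs, List.mem_cons, List.not_mem_nil, or_false] at hs
    rcases Sym2.eq_iff.1 h with ⟨rfl, rfl⟩ | ⟨rfl, rfl⟩ <;> rcases hs with rfl | rfl <;> simp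
  refine ⟨fun u v h => pos_inj hΛ (by rw [← hpos, ← hpos, h]), ?_, ?_, ?_, ?_⟩
  · intro a b c hab hb
    obtain ⟨k, v, hr, h⟩ := hadj a b hab
    rw [h, hbend k v hr, Option.some_inj] at hb
    subst hb
    have := bend_ne_pos hΛ hr
    rw [hpos, hpos]
    rcases Sym2.eq_iff.1 h with ⟨rfl, rfl⟩ | ⟨rfl, rfl⟩
    exacts [this, this.symm]
  · intro a b c hab hb
    obtain ⟨k, v, hr, h⟩ := hadj a b hab
    rw [h, hbend k v hr, Option.some_inj] at hb
    subst hb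
    have := inter_eq_bend hΛ hr
    rw [hpos, hpos]
    rcases Sym2.eq_iff.1 h with ⟨rfl, rfl⟩ | ⟨rfl, rfl⟩
    · exact this
    · rw [Set.inter_comm, closedSeg_swap (Λ.bend k a), closedSeg_swap (Λ.pos a)]; exact this
  · intro a b w hab hw
    obtain ⟨k, v, hr, h⟩ := hadj a b hab
    rw [hcurve a b k v hr h, hpos] at hw
    have := eq_of_pos_mem_curve hΛ hr hw
    rcases Sym2.eq_iff.1 h with ⟨rfl, rfl⟩ | ⟨rfl, rfl⟩
    exacts [this, this.symm]
  · intro a b a' b' hab hab' hne x hx hx'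
    obtain ⟨k, v, hr, h⟩ := hadj a b hab
    obtain ⟨k', v', hr', h'⟩ := hadj a' b' hab'
    rw [hcurve a b k v hr h] at hx
    rw [hcurve a' b' k' v' hr' h'] at hx'
    have hkv : ¬ (k = k' ∧ v = v') := by
      rintro ⟨rfl, rfl⟩; exact hne (h.trans h'.symm)
    rcases common_point hΛ hr hr' hkv hx hx' with ⟨w, h1, h2, h3⟩ | ⟨s, hs, t, ht, h1, h2, h3⟩
    · exact .inl ⟨w, h ▸ h1, h' ▸ h2, by rw [hpos]; exact h3⟩
    · right
      rcases hseg a b k v hr h s hs with hs | hs <;>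
        rcases hseg a' b' k' v' hr' h' t ht with ht | ht
      · exact ⟨s, hs, t, ht, h1, h2, h3⟩
      · exact ⟨s, hs, _, ht, h1, openSeg_swap t.1 t.2 ▸ h2, by
          unfold Perp at *; simp only [Prod.fst_swap, Prod.snd_swap]; linarith⟩
      · exact ⟨_, hs, t, ht, openSeg_swap s.1 s.2 ▸ h1, h2, by
          unfold Perp at *; simp only [Prod.fst_swap, Prod.snd_swap]; linarith⟩
      · exact ⟨_, hs, _, ht, openSeg_swap s.1 s.2 ▸ h1, openSeg_swap t.1 t.2 ▸ h2, by
          unfold Perp at *; simp only [Prod.fst_swap, Prod.snd_swap]; linarith⟩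

end Layout

end OneBendRAC

namespace OneBendRAC

open Equiv

set_option linter.unusedSectionVars false

/-! ### Labelled cycles of a permutation -/

/-- `lab` is a canonical point of the cycle, and `idx` numbers the points such that those of a cycle
get consecutive numbers in cyclic order, starting with `lab`. -/
structure IsLabel {V : Type*} (s : Perm V) (lab : V → V) (idx : V → ℕ) : Prop where
  inj : Function.Injective idx
  lab_lab : ∀ v, lab (lab v) = lab v
  lab_apply : ∀ v, lab (s v) = lab v
  step : ∀ v, s v = lab v ∨ idx (s v) = idx v + 1

namespace IsLabel

variable {V : Type*} [Finite V] {s : Perm V} {lab : V → V} {idx : V → ℕ}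

/-- The image of `S` lies in `S` and has the same finite cardinality, so it equals `S`. -/
theorem _root_.Equiv.Perm.inv_mem_of_closed {V : Type*} [Finite V] (s : Perm V) {S : Set V}
    (h : ∀ v ∈ S, s v ∈ S) {v : V} (hv : v ∈ S) : s⁻¹ v ∈ S := by
  have h1 : s '' S = S := Set.eq_of_subset_of_ncard_le (Set.image_subset_iff.2 h)
    (Set.ncard_image_of_injective S s.injective).ge S.toFinite
  rw [← h1] at hv
  obtain ⟨u, hu, rfl⟩ := hv
  simpa using hu

theorem lab_inv (h : IsLabel s lab idx) (v : V) : lab (s⁻¹ v) = lab v := by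
  have := h.lab_apply (s⁻¹ v); simpa using this.symm

theorem step' (h : IsLabel s lab idx) (v : V) : v = lab v ∨ idx v = idx (s⁻¹ v) + 1 := by
  have := h.step (s⁻¹ v); rw [h.lab_inv] at this; simpa using this

theorem lab_mem_of_closed (h : IsLabel s lab idx) {S : Set V} (hS : ∀ v ∈ S, s v ∈ S) {v : V}
    (hv : v ∈ S) : lab v ∈ S := by
  induction hi : idx v using Nat.strong_induction_on generalizing v with
  | _ i ih =>
    rcases h.step' v with h1 | h1
    · rwa [← h1]
    · rw [← h.lab_inv]
      exact ih _ (by omega) (s.inv_mem_of_closed hS hv) rfl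

/-- This is how `lab` is known to separate cycles exactly: from `v` one goes back to the canonical
point and from there forward to `u`. It is the main tool for comparing cycles of different
permutations. -/
theorem mem_of_closed (h : IsLabel s lab idx) {S : Set V} (hS : ∀ v ∈ S, s v ∈ S) {u v : V}
    (hv : v ∈ S) (huv : lab u = lab v) : u ∈ S := by
  have h0 := h.lab_mem_of_closed hS hv
  induction hi : idx u using Nat.strong_induction_on generalizing u with
  | _ i ih =>
    rcases h.step' u with h1 | h1
    · rwa [h1, huv]
    · have := hS _ (ih (idx (s⁻¹ u)) (by omega) (by rw [h.lab_inv, huv]) rfl)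
      simpa using this

theorem idx_lab_le (h : IsLabel s lab idx) (v : V) : idx (lab v) ≤ idx v := by
  induction hi : idx v using Nat.strong_induction_on generalizing v with
  | _ i ih =>
    rcases h.step' v with h1 | h1
    · rw [← h1]; omega
    · have := ih (idx (s⁻¹ v)) (by omega) _ rfl
      rw [h.lab_inv] at this; omega

/-- Going forward, `idx` increases until the cycle returns to `lab v`; the point just before that
has the largest number. -/
theorem idx_le_last (h : IsLabel s lab idx) (v : V) : idx v ≤ idx (s⁻¹ (lab v)) := by
  obtain ⟨B, hB⟩ := (Set.finite_range idx).bddAbove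
  have hB : ∀ v, idx v ≤ B := fun v => hB ⟨v, rfl⟩
  induction hi : B - idx v using Nat.strong_induction_on generalizing v with
  | _ i ih =>
    rcases h.step v with h1 | h1
    · rw [← h1]; simp
    · have h2 := ih (B - idx (s v)) (by have := hB (s v); omega) _ rfl
      rw [h.lab_apply] at h2; omega

theorem exists_idx_eq (h : IsLabel s lab idx) {u : V} {i : ℕ} (h0 : idx (lab u) ≤ i)
    (h1 : i ≤ idx u) : ∃ w, lab w = lab u ∧ idx w = i := by
  induction hj : idx u using Nat.strong_induction_on generalizing u with
  | _ j ih =>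
    rcases h1.eq_or_lt with rfl | h1
    · exact ⟨u, rfl, rfl⟩
    rcases h.step' u with h2 | h2
    · rw [← h2] at h0; omega
    · obtain ⟨w, hw, hw'⟩ := ih (idx (s⁻¹ u)) (by omega) (by rwa [h.lab_inv]) (by omega) rfl
      exact ⟨w, by rw [hw, h.lab_inv], hw'⟩

theorem lab_eq_of_between (h : IsLabel s lab idx) {u v : V} (h0 : idx (lab u) ≤ idx v)
    (h1 : idx v ≤ idx (s⁻¹ (lab u))) : lab v = lab u := by
  have e : lab (s⁻¹ (lab u)) = lab u := by rw [h.lab_inv, h.lab_lab]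
  obtain ⟨w, hw, hw'⟩ := h.exists_idx_eq (u := s⁻¹ (lab u)) (by rwa [e]) h1
  rw [← h.inj hw', hw, e]

/-- The blocks of different cycles are disjoint intervals. -/
theorem last_lt (h : IsLabel s lab idx) {u v : V} (hne : lab u ≠ lab v) (hlt : idx u < idx v) :
    idx (s⁻¹ (lab u)) < idx (lab v) := by
  by_contra! hle
  have h1 : idx (s⁻¹ (lab u)) < idx v := by
    by_contra! h2
    exact hne (h.lab_eq_of_between ((h.idx_lab_le u).trans hlt.le) h2).symm
  have e : lab (s⁻¹ (lab u)) = lab u := by rw [h.lab_inv, h.lab_lab]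
  refine hne ?_
  rw [← e]
  exact h.lab_eq_of_between hle (h1.le.trans (h.idx_le_last v))

end IsLabel

/-! ### Placing cycles one after the other -/

open Classical in
/-- The position of `v` when each cycle is cut behind `cut`, and laid out in its block in forward
order, or in backward order if `left`.  If `rv`, it is cut behind the canonical point instead, and
the other points are in backward order. -/
noncomputable def place {V : Type*} (s : Perm V) (lab : V → V) (idx : V → ℕ) (cut : V → V)
    (left rv : V → Prop) (v : V) : ℕ :=
  if rv (lab v) then idx (lab v) + idx (s⁻¹ (lab v)) - idx v
  else
    let q := if idx v ≤ idx (cut (lab v)) then idx v + idx (s⁻¹ (lab v)) - idx (cut (lab v))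
      else idx v - idx (cut (lab v)) - 1 + idx (lab v)
    if left (lab v) then idx (lab v) + idx (s⁻¹ (lab v)) - q else q

section place

variable {V : Type*} [Finite V] {s : Perm V} {lab : V → V} {idx : V → ℕ} {cut : V → V}
  {left rv : V → Prop}

/-- Cyclic shifts and reflections permute the interval of numbers of a cycle, so the order of the
blocks is independent of all choices of cuts and directions. -/
theorem place_mem (h : IsLabel s lab idx) (hcut : ∀ v, lab (cut (lab v)) = lab v) (v : V) :
    idx (lab v) ≤ place s lab idx cut left rv v ∧
      place s lab idx cut left rv v ≤ idx (s⁻¹ (lab v)) := by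
  have h1 := h.idx_lab_le v
  have h2 := h.idx_le_last v
  have h3 := h.idx_lab_le (cut (lab v))
  have h4 := h.idx_le_last (cut (lab v))
  rw [hcut] at h3 h4
  simp only [place]
  split_ifs <;> omega

theorem place_lt_of_idx_lt (h : IsLabel s lab idx) (hcut : ∀ v, lab (cut (lab v)) = lab v)
    {u v : V} (hne : lab u ≠ lab v) (hlt : idx u < idx v) :
    place s lab idx cut left rv u < place s lab idx cut left rv v :=
  (place_mem h hcut u).2.trans_lt ((h.last_lt hne hlt).trans_le (place_mem h hcut v).1)

theorem lab_eq_of_place_between (h : IsLabel s lab idx) (hcut : ∀ v, lab (cut (lab v)) = lab v)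
    {u v w : V} (huw : lab u = lab w)
    (h1 : place s lab idx cut left rv u ≤ place s lab idx cut left rv v)
    (h2 : place s lab idx cut left rv v ≤ place s lab idx cut left rv w) : lab v = lab u := by
  by_contra hne
  have hu := place_mem (left := left) (rv := rv) h hcut u
  have hv := place_mem (left := left) (rv := rv) h hcut v
  have hw := place_mem (left := left) (rv := rv) h hcut w
  rw [← huw] at hw
  have n : idx u ≠ idx v := fun e => hne (by rw [h.inj e])
  rcases lt_or_gt_of_ne n with h3 | h3
  · have := h.last_lt (Ne.symm hne) h3; omega
  · have := h.last_lt hne h3; omega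

theorem place_injective (h : IsLabel s lab idx) (hcut : ∀ v, lab (cut (lab v)) = lab v) :
    Function.Injective (place s lab idx cut left rv) := by
  intro u v huv
  have hl : lab v = lab u := lab_eq_of_place_between h hcut rfl huv.le huv.ge
  refine h.inj ?_
  have h1 := h.idx_lab_le v
  have h2 := h.idx_le_last v
  have h3 := h.idx_lab_le (cut (lab v))
  have h4 := h.idx_le_last (cut (lab v))
  have h5 := h.idx_lab_le u
  have h6 := h.idx_le_last u
  rw [hcut] at h3 h4
  rw [hl] at h1 h2 h3 h4
  by_cases hr : rv (lab u)
  · have hr' : rv (lab v) := hl ▸ hr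
    simp only [place, if_pos hr, if_pos hr', hl] at huv
    omega
  have hr' : ¬ rv (lab v) := hl ▸ hr
  by_cases hf : left (lab u)
  · have hf' : left (lab v) := hl ▸ hf
    simp only [place, if_neg hr, if_neg hr', if_pos hf, if_pos hf', hl] at huv
    split_ifs at huv <;> omega
  · have hf' : ¬ left (lab v) := hl ▸ hf
    simp only [place, if_neg hr, if_neg hr', if_neg hf, if_neg hf', hl] at huv
    split_ifs at huv <;> omega

/-- Only the step leaving the cut vertex is torn apart. The step from the last to the first number
of a block becomes adjacent through the cyclic shift. -/
theorem place_apply (h : IsLabel s lab idx) (hcut : ∀ v, lab (cut (lab v)) = lab v) {v : V}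
    (hrv : ¬ rv (lab v)) (hv : v ≠ cut (lab v)) :
    place s lab idx cut left rv (s v) = place s lab idx cut left rv v + 1 ∨
      place s lab idx cut left rv v = place s lab idx cut left rv (s v) + 1 := by
  have h1 := h.idx_lab_le v
  have h2 := h.idx_le_last v
  have h3 := h.idx_lab_le (cut (lab v))
  have h4 := h.idx_le_last (cut (lab v))
  have h5 := h.idx_le_last (s v)
  rw [hcut] at h3 h4
  have hl := h.lab_apply v
  rw [hl] at h5
  have n : idx v ≠ idx (cut (lab v)) := fun e => hv (h.inj e)
  -- Either `v` has the last number of the block and its successor the first, or the numbers are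
  -- consecutive.
  have hs : idx (s⁻¹ (lab v)) = idx v ∧ idx (s v) = idx (lab v) ∨ idx (s v) = idx v + 1 := by
    rcases h.step v with e | e
    · left; rw [e, ← e]; simp
    · exact .inr e
  have hrv' : ¬ rv (lab (s v)) := hl.symm ▸ hrv
  by_cases hf : left (lab v)
  · have hf' : left (lab (s v)) := hl.symm ▸ hf
    simp only [place, if_neg hrv, if_neg hrv', if_pos hf, if_pos hf', hl]
    split_ifs <;> omega
  · have hf' : ¬ left (lab (s v)) := hl.symm ▸ hf
    simp only [place, if_neg hrv, if_neg hrv', if_neg hf, if_neg hf', hl]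
    split_ifs <;> omega

/-- The cut vertex ends the linear order of its cycle, so it is at the right end of the block, or at
the left end after reflection. -/
theorem place_cut (h : IsLabel s lab idx) (hcut : ∀ v, lab (cut (lab v)) = lab v) {v : V}
    (hrv : ¬ rv (lab v)) :
    (¬ left (lab v) → place s lab idx cut left rv v ≤ place s lab idx cut left rv (cut (lab v))) ∧
    (left (lab v) → place s lab idx cut left rv (cut (lab v)) ≤ place s lab idx cut left rv v) := by
  have h1 := h.idx_lab_le v
  have h2 := h.idx_le_last v
  have h3 := h.idx_lab_le (cut (lab v))
  have h4 := h.idx_le_last (cut (lab v))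
  rw [hcut] at h3 h4
  have hrv' : ¬ rv (lab (cut (lab v))) := (hcut v).symm ▸ hrv
  constructor <;> intro hf
  · have hf' : ¬ left (lab (cut (lab v))) := (hcut v).symm ▸ hf
    simp only [place, if_neg hrv, if_neg hrv', if_neg hf, if_neg hf', hcut]
    split_ifs <;> omega
  · have hf' : left (lab (cut (lab v))) := (hcut v).symm ▸ hf
    simp only [place, if_neg hrv, if_neg hrv', if_pos hf, if_pos hf', hcut]
    split_ifs <;> omega

/-- In a reversed block the canonical point, which has the first number, comes last, and no shift is
involved. -/
theorem place_inv_of_rv (h : IsLabel s lab idx) {v : V} (hrv : rv (lab v)) (hv : v ≠ lab v) :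
    place s lab idx cut left rv (s⁻¹ v) = place s lab idx cut left rv v + 1 := by
  have h2 := h.idx_le_last v
  have := (h.step' v).resolve_left hv
  have hrv' : rv (lab (s⁻¹ v)) := (h.lab_inv v).symm ▸ hrv
  simp only [place, if_pos hrv, if_pos hrv', h.lab_inv]
  omega

theorem place_le_of_rv (h : IsLabel s lab idx) {v : V} (hrv : rv (lab v)) :
    place s lab idx cut left rv v ≤ place s lab idx cut left rv (lab v) := by
  have h2 := h.idx_lab_le v
  have hrv' : rv (lab (lab v)) := (h.lab_lab v).symm ▸ hrv
  simp only [place, if_pos hrv, if_pos hrv', h.lab_lab]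
  omega

theorem place_lt_iff_of_rv (h : IsLabel s lab idx) {u v : V} (hrv : rv (lab v))
    (huv : lab u = lab v) : place s lab idx cut left rv u < place s lab idx cut left rv v ↔
      idx v < idx u := by
  have h1 := h.idx_le_last u
  have h2 := h.idx_le_last v
  have hrv' : rv (lab u) := huv.symm ▸ hrv
  simp only [place, if_pos hrv, if_pos hrv', huv]
  rw [huv] at h1
  omega

end place

end OneBendRAC

namespace OneBendRAC

open Equiv

set_option linter.unusedSectionVars false

/-! ### Decompositions into two 2-factors -/

section

variable {V : Type*} [Finite V]

/-- Two directed 2-factors given by permutations.  The number of the edge that enters `v` is `j₁ v`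
resp. `j₂ v`, or `0` if it is not an edge of the graph; the graph has `m` edges `E 1, …, E m`. -/
structure Factors (m : ℕ) (E : ℕ → Sym2 V) (s₁ s₂ : Perm V) (j₁ j₂ : V → ℕ) : Prop where
  mem₁ : ∀ v, j₁ v ≠ 0 → j₁ v ≤ m ∧ E (j₁ v) = s(s₁⁻¹ v, v)
  mem₂ : ∀ v, j₂ v ≠ 0 → j₂ v ≤ m ∧ E (j₂ v) = s(s₂⁻¹ v, v)
  inj₁ : ∀ u v, j₁ u ≠ 0 → j₁ u = j₁ v → u = v
  inj₂ : ∀ u v, j₂ u ≠ 0 → j₂ u = j₂ v → u = v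
  disj : ∀ u v, j₁ u ≠ 0 → j₁ u ≠ j₂ v
  surj : ∀ e, e ≠ 0 → e ≤ m → (∃ v, j₁ v = e) ∨ ∃ v, j₂ v = e

-- A set closed under two permutations of a finite type is closed under their inverses as well, so
-- switching between them along it gives a permutation. This is used both to exchange the factors
-- and to reverse cycles.
open Classical in
theorem exists_blend (f g : Perm V) (B : V → Prop) (hf : ∀ v, B v → B (f v))
    (hg : ∀ v, B v → B (g v)) :
    ∃ h : Perm V, (∀ v, h v = if B v then f v else g v) ∧
      (∀ v, h⁻¹ v = if B v then f⁻¹ v else g⁻¹ v) ∧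
      (∀ v, B (f v) ↔ B v) ∧ ∀ v, B (g v) ↔ B v := by
  have hf' : ∀ v, B (f v) ↔ B v := fun v =>
    ⟨fun h => by simpa using f.inv_mem_of_closed (S := {v | B v}) hf h, hf v⟩
  have hg' : ∀ v, B (g v) ↔ B v := fun v =>
    ⟨fun h => by simpa using g.inv_mem_of_closed (S := {v | B v}) hg h, hg v⟩
  have hfi : ∀ v, B (f⁻¹ v) ↔ B v := fun v => by have := hf' (f⁻¹ v); simpa using this.symm
  have hgi : ∀ v, B (g⁻¹ v) ↔ B v := fun v => by have := hg' (g⁻¹ v); simpa using this.symm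
  refine ⟨⟨fun v => if B v then f v else g v, fun v => if B v then f⁻¹ v else g⁻¹ v, ?_, ?_⟩,
    fun v => rfl, fun v => rfl, hf', hg'⟩
  · intro v; by_cases h : B v <;> simp [h, hf', hg']
  · intro v
    by_cases h : B v
    · simp only [if_pos h, if_pos ((hfi v).2 h)]; simp
    · simp only [if_neg h, if_neg (mt (hgi v).1 h)]; simp

open Classical in
/-- Exchanging the two factors in a union of components. -/
theorem Factors.blend {m : ℕ} {E : ℕ → Sym2 V} {s₁ s₂ S₁ S₂ : Perm V} {j₁ j₂ : V → ℕ}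
    (h : Factors m E s₁ s₂ j₁ j₂) (B : V → Prop)
    (h₁ : ∀ v, S₁⁻¹ v = if B v then s₂⁻¹ v else s₁⁻¹ v)
    (h₂ : ∀ v, S₂⁻¹ v = if B v then s₁⁻¹ v else s₂⁻¹ v) :
    Factors m E S₁ S₂ (fun v => if B v then j₂ v else j₁ v)
      (fun v => if B v then j₁ v else j₂ v) := by
  have d := h.disj
  have i₁ := h.inj₁
  have i₂ := h.inj₂
  refine ⟨fun v hv => ?_, fun v hv => ?_, fun u v hu huv => ?_, fun u v hu huv => ?_,
    fun u v hu huv => ?_, fun e he he' => ?_⟩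
  · rw [h₁]; by_cases hB : B v <;> simp only [hB, if_true, if_false] at hv ⊢
    exacts [h.mem₂ v hv, h.mem₁ v hv]
  · rw [h₂]; by_cases hB : B v <;> simp only [hB, if_true, if_false] at hv ⊢
    exacts [h.mem₁ v hv, h.mem₂ v hv]
  · by_cases hB : B u <;> by_cases hB' : B v <;>
      simp only [hB, hB', if_true, if_false] at hu huv
    · exact i₂ u v hu huv
    · exact (d v u (huv ▸ hu) huv.symm).elim
    · exact (d u v hu huv).elim
    · exact i₁ u v hu huv
  · by_cases hB : B u <;> by_cases hB' : B v <;>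
      simp only [hB, hB', if_true, if_false] at hu huv
    · exact i₁ u v hu huv
    · exact (d u v hu huv).elim
    · exact (d v u (huv ▸ hu) huv.symm).elim
    · exact i₂ u v hu huv
  · by_cases hB : B u <;> by_cases hB' : B v <;>
      simp only [hB, hB', if_true, if_false] at hu huv
    · exact d v u (huv ▸ hu) huv.symm
    · exact hB' (i₂ u v hu huv ▸ hB)
    · exact hB (i₁ u v hu huv ▸ hB')
    · exact d u v hu huv
  · rcases h.surj e he he' with ⟨v, hv⟩ | ⟨v, hv⟩ <;> by_cases hB : B v
    · exact .inr ⟨v, by simp [hB, hv]⟩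
    · exact .inl ⟨v, by simp [hB, hv]⟩
    · exact .inl ⟨v, by simp [hB, hv]⟩
    · exact .inr ⟨v, by simp [hB, hv]⟩

open Classical in
/-- Reversing some cycles of the first factor. -/
theorem Factors.reverse {m : ℕ} {E : ℕ → Sym2 V} {s₁ s₂ T : Perm V} {j₁ j₂ : V → ℕ}
    (h : Factors m E s₁ s₂ j₁ j₂) (B : V → Prop) (hB : ∀ v, B (s₁ v) ↔ B v)
    (hT : ∀ v, T⁻¹ v = if B v then s₁ v else s₁⁻¹ v) :
    Factors m E T s₂ (fun v => if B v then j₁ (s₁ v) else j₁ v) j₂ := by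
  have d := h.disj
  have i₁ := h.inj₁
  refine ⟨fun v hv => ?_, h.mem₂, fun u v hu huv => ?_, h.inj₂, fun u v hu huv => ?_,
    fun e he he' => ?_⟩
  · rw [hT]; by_cases hB : B v <;> simp only [hB, if_true, if_false] at hv ⊢
    · have := h.mem₁ _ hv
      rw [this.2, Sym2.eq_swap]; simpa using this.1
    · exact h.mem₁ v hv
  · by_cases hu' : B u <;> by_cases hv' : B v <;>
      simp only [hu', hv', if_true, if_false] at hu huv
    · exact s₁.injective (i₁ _ _ hu huv)
    · exact (hv' ((i₁ _ _ hu huv) ▸ (hB u).2 hu')).elim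
    · exact (hu' ((i₁ _ _ hu huv).symm ▸ (hB v).2 hv')).elim
    · exact i₁ u v hu huv
  · by_cases hu' : B u <;> simp only [hu', if_true, if_false] at hu huv <;> exact d _ _ hu huv
  · rcases h.surj e he he' with ⟨v, hv⟩ | h
    · by_cases hv' : B v
      · refine .inl ⟨s₁⁻¹ v, ?_⟩
        have : B (s₁⁻¹ v) := by rw [← hB]; simpa using hv'
        simp only [if_pos this]; simpa using hv
      · exact .inl ⟨v, by simp [hv', hv]⟩
    · exact .inr h

/-- The edge of the first factor that leaves `u` and the edge of the second one that enters `u` are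
edges of the graph, and the latter joins two vertices of the same cycle of the first factor. -/
def Whole (s t : Perm V) (j k : V → ℕ) (lab : V → V) (u : V) : Prop :=
  j (s u) ≠ 0 ∧ k u ≠ 0 ∧ lab (t⁻¹ u) = lab u

/-- If no vertex of a cycle of `s` is a suitable cut, all edges of `t` entering the cycle start on
it; by finiteness none leaves it. So an uncuttable cycle spans a component. -/
theorem Whole.closed {s t : Perm V} {j k : V → ℕ} {lab : V → V} {r : V}
    (h : ∀ u, lab u = r → Whole s t j k lab u) (u : V) :
    (lab (t⁻¹ u) = r ↔ lab u = r) ∧ (lab (t u) = r ↔ lab u = r) := by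
  have h1 : ∀ u ∈ {u | lab u = r}, t⁻¹ u ∈ {u | lab u = r} := fun u hu => by
    have := (h u hu).2.2; rw [hu] at this; exact this
  have h2 : ∀ u, lab u = r → lab (t u) = r := fun u hu => by
    simpa using Equiv.Perm.inv_mem_of_closed t⁻¹ h1 hu
  have h3 : ∀ u, lab (t⁻¹ u) = r → lab u = r := fun u hu => by simpa using h2 _ hu
  exact ⟨⟨h3 u, h1 u⟩, fun hu => by simpa using h1 _ hu, h2 u⟩

theorem Whole.left_ne {s t : Perm V} {j k : V → ℕ} {lab : V → V} {idx : V → ℕ} {r : V}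
    (hl : IsLabel s lab idx) (h : ∀ u, lab u = r → Whole s t j k lab u) {u : V} (hu : lab u = r) :
    j u ≠ 0 := by
  have := (h (s⁻¹ u) (by rw [hl.lab_inv, hu])).1
  simpa using this

open Classical in
/-- The choices made by the algorithm for a decomposition `s₁, s₂` into two 2-factors: the factors
are exchanged in some components (giving `S₁, S₂`), some cycles of the first factor are reversed
(giving `T, S₂`), some edges `S₂⁻¹ r → r` of the second factor are put aside (`spec r`), and every
cycle is cut. -/
structure Choices (V : Type*) [Finite V] where
  s₁ : Perm V
  s₂ : Perm V
  j₁ : V → ℕ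
  j₂ : V → ℕ
  lab : V → V
  idx : V → ℕ
  isLabel : IsLabel s₂ lab idx
  bad : V → Prop
  bad_iff : ∀ v, bad (lab v) ↔ ∀ u, lab u = lab v → Whole s₂ s₁ j₂ j₁ lab u
  S₁ : Perm V
  S₂ : Perm V
  S₁_apply : ∀ v, S₁ v = if bad (lab v) then s₂ v else s₁ v
  S₂_apply : ∀ v, S₂ v = if bad (lab v) then s₁ v else s₂ v
  S₁_inv : ∀ v, S₁⁻¹ v = if bad (lab v) then s₂⁻¹ v else s₁⁻¹ v
  S₂_inv : ∀ v, S₂⁻¹ v = if bad (lab v) then s₁⁻¹ v else s₂⁻¹ v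
  J₁ : V → ℕ
  J₂ : V → ℕ
  J₁_eq : ∀ v, J₁ v = if bad (lab v) then j₂ v else j₁ v
  J₂_eq : ∀ v, J₂ v = if bad (lab v) then j₁ v else j₂ v
  lab₁ : V → V
  idx₁ : V → ℕ
  isLabel₁ : IsLabel S₁ lab₁ idx₁
  lab₂ : V → V
  idx₂ : V → ℕ
  isLabel₂ : IsLabel S₂ lab₂ idx₂
  spec : V → Prop
  spec_iff : ∀ r, spec r ↔ lab₁ r = r ∧ ∀ u, lab₁ u = r → Whole S₁ S₂ J₁ J₂ lab₁ u
  cut₁ : V → V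
  lab_cut₁ : ∀ v, lab₁ (cut₁ (lab₁ v)) = lab₁ v
  cut₁_spec : ∀ v, spec (lab₁ v) → cut₁ (lab₁ v) = lab₁ v
  cut₁_not_spec : ∀ v, ¬ spec (lab₁ v) → ¬ Whole S₁ S₂ J₁ J₂ lab₁ (cut₁ (lab₁ v))
  rv : V → Prop
  rv_iff : ∀ r, rv r ↔ spec r ∧ idx₁ (S₂⁻¹ r) < idx₁ (S₂⁻¹ (S₂⁻¹ r))
  T : Perm V
  T_apply : ∀ v, T v = if rv (lab₁ v) then S₁⁻¹ v else S₁ v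
  T_inv : ∀ v, T⁻¹ v = if rv (lab₁ v) then S₁ v else S₁⁻¹ v
  K₁ : V → ℕ
  K₂ : V → ℕ
  K₁_eq : ∀ v, K₁ v = if rv (lab₁ v) then J₁ (S₁ v) else J₁ v
  K₂_eq : ∀ v, K₂ v = if spec v then 0 else J₂ v

namespace Choices

theorem lab_s₁_of_bad (c : Choices V) {v : V} (h : c.bad (c.lab v)) :
    c.lab (c.s₁ v) = c.lab v ∧ c.lab (c.s₁⁻¹ v) = c.lab v :=
  let H := Whole.closed ((c.bad_iff v).1 h) v
  ⟨H.2.2 rfl, H.1.2 rfl⟩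

/-- The exchanged set is a union of components, hence invariant under the new permutation too. -/
theorem bad_closed (c : Choices V) (v : V) :
    (c.bad (c.lab (c.S₂ v)) ↔ c.bad (c.lab v)) := by
  have h2 : ∀ v, c.bad (c.lab v) → c.bad (c.lab (c.S₂ v)) := fun v h => by
    rw [c.S₂_apply, if_pos h, (c.lab_s₁_of_bad h).1]; exact h
  refine ⟨fun h => ?_, h2 v⟩
  have := Equiv.Perm.inv_mem_of_closed c.S₂ (S := {v | c.bad (c.lab v)}) h2 h
  simpa using this

/-- Every cycle of the second factor can be cut. -/
theorem exists_not_whole (c : Choices V) (v : V) :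
    ∃ u, c.lab₂ u = c.lab₂ v ∧ ¬ Whole c.S₂ c.T c.K₂ c.K₁ c.lab₂ u := by
  by_contra! H
  set r := c.lab₂ v
  have hT := Whole.closed H
  have hK₂ : ∀ u, c.lab₂ u = r → c.K₂ u ≠ 0 := fun u hu => Whole.left_ne c.isLabel₂ H hu
  have hS₂ : ∀ u, c.lab₂ u = r → c.lab₂ (c.S₂ u) = r := fun u hu => by
    rw [c.isLabel₂.lab_apply, hu]
  -- `T` follows `S₁` forwards or backwards, depending on the cycle; closure under both `T` and its
  -- inverse gives closure under `S₁` in either case.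
  have hS₁ : ∀ u, c.lab₂ u = r → c.lab₂ (c.S₁ u) = r := fun u hu => by
    by_cases h : c.rv (c.lab₁ u)
    · have := (hT u).1.2 hu; rwa [c.T_inv, if_pos h] at this
    · have := (hT u).2.2 hu; rwa [c.T_apply, if_neg h] at this
  have hS₁' : ∀ u, c.lab₂ u = r → c.lab₂ (c.S₁⁻¹ u) = r := fun u hu =>
    c.S₁.inv_mem_of_closed (S := {u | c.lab₂ u = r}) hS₁ hu
  -- An edge put aside counts as missing in `K₂`, and a missing edge would allow a cut.
  have hnspec : ∀ u, c.lab₂ u = r → ¬ c.spec u := fun u hu hs =>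
    hK₂ u hu (by rw [c.K₂_eq, if_pos hs])
  by_cases hv : c.bad (c.lab v)
  · have hb := (c.bad_iff v).1 hv
    have bad_of : ∀ u, c.lab u = c.lab v → c.bad (c.lab u) := fun u hu => hu ▸ hv
    -- the cycle of the first factor through `v` is the component of `v`
    have hcl₁ : ∀ u ∈ {u | c.lab u = c.lab v}, c.S₁ u ∈ {u | c.lab u = c.lab v} := fun u hu => by
      have hu' : c.lab u = c.lab v := hu
      change c.lab (c.S₁ u) = _
      rw [c.S₁_apply, if_pos (bad_of u hu'), c.isLabel.lab_apply, hu']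
    have hsub : ∀ u, c.lab u = c.lab v → c.lab₂ u = r := by
      intro u hu
      refine (c.isLabel.mem_of_closed (S := {u | c.lab u = c.lab v ∧ c.lab₂ u = r}) ?_
        (v := v) ⟨rfl, rfl⟩ hu).2
      rintro w ⟨hw, hw'⟩
      have h1 : c.s₂ w = c.S₁ w := by rw [c.S₁_apply, if_pos (bad_of w hw)]
      exact ⟨by rw [c.isLabel.lab_apply, hw], by rw [h1]; exact hS₁ w hw'⟩
    have hlab₁ : ∀ u, c.lab₁ u = c.lab₁ v → c.lab u = c.lab v := fun u hu =>
      c.isLabel₁.mem_of_closed hcl₁ (v := v) rfl hu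
    have hlab₁' : ∀ u, c.lab u = c.lab v → c.lab₁ u = c.lab₁ v := by
      intro u hu
      refine (c.isLabel.mem_of_closed (S := {u | c.lab u = c.lab v ∧ c.lab₁ u = c.lab₁ v}) ?_
        (v := v) ⟨rfl, rfl⟩ hu).2
      rintro w ⟨hw, hw'⟩
      have h1 : c.s₂ w = c.S₁ w := by rw [c.S₁_apply, if_pos (bad_of w hw)]
      exact ⟨by rw [c.isLabel.lab_apply, hw], by rw [h1, c.isLabel₁.lab_apply, hw']⟩
    have hr := hlab₁ (c.lab₁ v) (c.isLabel₁.lab_lab v)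
    -- The exchanged component was chosen because its cycle was uncuttable. This cycle is now in the
    -- first factor, so one of the edges has been put aside at its canonical vertex, which is a
    -- contradiction.
    refine hnspec (c.lab₁ v) (hsub _ hr) ((c.spec_iff _).2 ⟨c.isLabel₁.lab_lab v, fun u hu => ?_⟩)
    have hu' := hlab₁ u hu
    obtain ⟨w1, w2, w3⟩ := hb u hu'
    refine ⟨?_, ?_, ?_⟩
    · have h1 : c.lab (c.S₁ u) = c.lab v := hcl₁ u hu'
      rw [c.J₁_eq, if_pos (bad_of _ h1), c.S₁_apply, if_pos (bad_of u hu')]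
      exact w1
    · rw [c.J₂_eq, if_pos (bad_of u hu')]; exact w2
    · rw [c.S₂_inv, if_pos (bad_of u hu'), hlab₁' _ (w3.trans hu'), hu]
  · have hnb : ∀ u, c.lab₂ u = r → ¬ c.bad (c.lab u) := fun u hu =>
      c.isLabel₂.mem_of_closed (S := {u | ¬ c.bad (c.lab u)})
        (fun w hw h => hw ((c.bad_closed w).1 h)) (v := v) hv hu
    -- Without an exchange the cycle is an original cycle of the second factor, and `Whole` for the
    -- modified data implies `Whole` for the original data, so the cycle would have been exchanged.
    refine hv ((c.bad_iff v).2 fun u hu => ?_)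
    -- the cycle of `v` has not been exchanged
    have hcl : ∀ u, c.lab₂ u = r → c.lab₂ (c.s₂ u) = r := fun u hu => by
      have := hS₂ u hu; rwa [c.S₂_apply, if_neg (hnb u hu)] at this
    have hu₂ : c.lab₂ u = r := c.isLabel.mem_of_closed (S := {u | c.lab₂ u = r}) hcl (v := v) rfl hu
    have hlab : ∀ w, c.lab₂ w = r → c.lab w = c.lab v := fun w hw => by
      refine (c.isLabel₂.mem_of_closed (S := {w | c.lab₂ w = r ∧ c.lab w = c.lab v}) ?_
        (v := v) ⟨rfl, rfl⟩ hw).2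
      rintro w ⟨hw, hw'⟩
      refine ⟨hS₂ w hw, ?_⟩
      rw [c.S₂_apply, if_neg (hnb w hw), c.isLabel.lab_apply, hw']
    refine ⟨?_, ?_, ?_⟩
    · have h1 := hK₂ _ (hcl u hu₂)
      rw [c.K₂_eq, if_neg (hnspec _ (hcl u hu₂)), c.J₂_eq, if_neg (hnb _ (hcl u hu₂))] at h1
      exact h1
    · by_cases h : c.rv (c.lab₁ u)
      · have hs := ((c.rv_iff _).1 h).1
        have := Whole.left_ne c.isLabel₁ ((c.spec_iff _).1 hs).2 (u := u) rfl
        rwa [c.J₁_eq, if_neg (hnb u hu₂)] at this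
      · have := (H u hu₂).2.1
        rwa [c.K₁_eq, if_neg h, c.J₁_eq, if_neg (hnb u hu₂)] at this
    · have h1 := hS₁' u hu₂
      rw [c.S₁_inv, if_neg (hnb u hu₂)] at h1
      rw [hlab _ h1, hu]

end Choices

end

end OneBendRAC

/-! ### Goodness of the layout determined by the choices -/

namespace OneBendRAC

open Equiv

set_option linter.unusedSectionVars false

theorem perm_apply_inv {V : Type*} (s : Perm V) (v : V) : s (s⁻¹ v) = v := s.apply_symm_apply v

theorem perm_inv_apply {V : Type*} (s : Perm V) (v : V) : s⁻¹ (s v) = v := s.symm_apply_apply v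

section place

variable {V : Type*} [Finite V] {s : Perm V} {lab : V → V} {idx : V → ℕ} {cut : V → V}
  {left rv : V → Prop}

/-- A point of another cycle lies on the other side of the end of a cycle than the cycle itself, if
the direction of the cycle is chosen accordingly. -/
theorem place_side (h : IsLabel s lab idx) (hcut : ∀ v, lab (cut (lab v)) = lab v) {u v o : V}
    (hrv : ¬ rv (lab u)) (hu : u = cut (lab u)) (ho : lab o ≠ lab u)
    (hleft : left (lab u) ↔ idx o < idx (lab u)) (hv : lab v = lab u) (hne : u ≠ v) :
    place s lab idx cut left rv o < place s lab idx cut left rv u ∧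
        place s lab idx cut left rv u < place s lab idx cut left rv v ∨
      place s lab idx cut left rv u < place s lab idx cut left rv o ∧
        place s lab idx cut left rv v < place s lab idx cut left rv u := by
  have hne' := (place_injective (left := left) (rv := rv) h hcut).ne hne
  have hc := place_cut (v := v) (left := left) (rv := rv) h hcut (hv.symm ▸ hrv)
  rw [hv, ← hu] at hc
  -- With the other cycle on the left, `u` is put at the left end of its block, so all other points
  -- of its cycle lie to its right; otherwise the mirror image.
  by_cases hl : left (lab u)
  · left
    have h1 := hleft.1 hl
    exact ⟨place_lt_of_idx_lt h hcut ho (h1.trans_le (h.idx_lab_le u)), (hc.2 hl).lt_of_ne hne'⟩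
  · right
    have h1 := fun h => hl (hleft.2 h)
    have h2 : idx u < idx o := by
      by_contra! h2
      rcases h2.eq_or_lt with h2 | h2
      · exact ho (by rw [h.inj h2])
      · exact h1 ((h.idx_le_last o).trans_lt (h.last_lt ho h2))
    exact ⟨place_lt_of_idx_lt h hcut ho.symm h2, (hc.1 hl).lt_of_ne hne'.symm⟩

/-- When the cut is behind the canonical point, that point moves from the first to the last place
and all others move down by one, keeping their order. -/
theorem place_lt_of_cut_eq (h : IsLabel s lab idx) {u v r : V}
    (hrv : ¬ rv r) (hl : ¬ left r) (hc : cut r = r) (hu : lab u = r) (hv : lab v = r)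
    (hur : u ≠ r) (huv : idx u < idx v) :
    place s lab idx cut left rv u < place s lab idx cut left rv v := by
  have h1 := h.idx_lab_le u
  have h2 := h.inj.ne hur
  rw [hu] at h1
  have e : ∀ w, lab w = r → place s lab idx cut left rv w =
      if idx w ≤ idx r then idx w + idx (s⁻¹ r) - idx r else idx w - idx r - 1 + idx r := by
    intro w hw
    have hrv' : ¬ rv (lab w) := hw.symm ▸ hrv
    have hl' : ¬ left (lab w) := hw.symm ▸ hl
    simp only [place, if_neg hrv', if_neg hl', hw, hc]
  rw [e u hu, e v hv, if_neg (by omega), if_neg (by omega)]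
  omega

end place

namespace Choices

variable {n : ℕ}

/-- The layout determined by the choices of the algorithm. -/
noncomputable def layout (c : Choices (Fin n)) (cut₂ : Fin n → Fin n) : Layout n where
  -- A cycle is laid out backwards exactly when the second-factor edge entering its cut vertex
  -- starts in an earlier block; this is the hypothesis `hleft` of `place_side`.
  X v := place c.S₁ c.lab₁ c.idx₁ c.cut₁
    (fun r => c.idx₁ (c.S₂⁻¹ (c.cut₁ r)) < c.idx₁ r) c.rv v
  Y v := place c.S₂ c.lab₂ c.idx₂ cut₂
    (fun r => c.idx₂ (c.T⁻¹ (cut₂ r)) < c.idx₂ r) (fun _ => False) v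
  p v := c.T⁻¹ v
  q v := c.S₂⁻¹ v
  real
    | .vert, v => c.K₁ v ≠ 0
    | .horiz, v => c.K₂ v ≠ 0
    | .steep, v => c.spec v
  lab v := c.lab₁ v

open Classical in
theorem factors (c : Choices (Fin n)) {m : ℕ} {E : ℕ → Sym2 (Fin n)}
    (hF : Factors m E c.s₁ c.s₂ c.j₁ c.j₂) : Factors m E c.T c.S₂ c.K₁ c.J₂ := by
  have h1 := hF.blend (S₁ := c.S₁) (S₂ := c.S₂) (fun v => c.bad (c.lab v)) c.S₁_inv c.S₂_inv
  rw [← funext c.J₁_eq, ← funext c.J₂_eq] at h1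
  have h2 := h1.reverse (T := c.T) (fun v => c.rv (c.lab₁ v))
    (fun v => by rw [c.isLabel₁.lab_apply]) c.T_inv
  rwa [← funext c.K₁_eq] at h2

theorem lab_T_inv (c : Choices (Fin n)) (v : Fin n) : c.lab₁ (c.T⁻¹ v) = c.lab₁ v := by
  rw [c.T_inv]; split_ifs
  exacts [c.isLabel₁.lab_apply v, c.isLabel₁.lab_inv v]

/-- All steps except the one leaving the cut vertex join neighbouring columns, so a non-adjacent
edge closes its cycle. In a reversed cycle the cut vertex is the canonical one. -/
theorem tail_eq_cut₁ (c : Choices (Fin n)) {cut₂ : Fin n → Fin n} {v : Fin n}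
    (hv : ¬ (c.layout cut₂).AdjX v) :
    c.T⁻¹ v = c.cut₁ (c.lab₁ v) ∧ (c.rv (c.lab₁ v) ∧ c.spec (c.lab₁ v) ∨
      ¬ c.rv (c.lab₁ v) ∧ c.T⁻¹ v = c.S₁⁻¹ v) := by
  simp only [Layout.AdjX, layout] at hv
  by_cases hr : c.rv (c.lab₁ v)
  · have hs := ((c.rv_iff _).1 hr).1
    refine ⟨?_, .inl ⟨hr, hs⟩⟩
    rw [c.cut₁_spec v hs]
    rw [c.T_inv, if_pos hr] at hv ⊢
    by_contra hne
    have hl := c.isLabel₁.lab_apply v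
    have := place_inv_of_rv (cut := c.cut₁) (rv := c.rv)
      (left := fun r => c.idx₁ (c.S₂⁻¹ (c.cut₁ r)) < c.idx₁ r) c.isLabel₁
      (v := c.S₁ v) (by rwa [hl]) (by rwa [hl])
    rw [perm_inv_apply] at this
    exact hv (.inr (by exact_mod_cast this))
  · have e : c.T⁻¹ v = c.S₁⁻¹ v := by rw [c.T_inv, if_neg hr]
    refine ⟨?_, .inr ⟨hr, e⟩⟩
    rw [e] at hv ⊢
    by_contra hne
    have hl := c.isLabel₁.lab_inv v
    have := place_apply (cut := c.cut₁) (rv := c.rv)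
      (left := fun r => c.idx₁ (c.S₂⁻¹ (c.cut₁ r)) < c.idx₁ r) c.isLabel₁ c.lab_cut₁
      (v := c.S₁⁻¹ v) (by rwa [hl]) (by rwa [hl])
    rw [perm_apply_inv] at this
    exact hv (this.symm.imp (fun h => by exact_mod_cast h) (fun h => by exact_mod_cast h))

theorem tail_eq_cut₂ (c : Choices (Fin n)) {cut₂ : Fin n → Fin n}
    (hcut₂ : ∀ v, c.lab₂ (cut₂ (c.lab₂ v)) = c.lab₂ v) {v : Fin n}
    (hv : ¬ (c.layout cut₂).AdjY v) : c.S₂⁻¹ v = cut₂ (c.lab₂ v) := by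
  simp only [Layout.AdjY, layout] at hv
  by_contra hne
  have hl := c.isLabel₂.lab_inv v
  have := place_apply (cut := cut₂) (rv := fun _ => False)
    (left := fun r => c.idx₂ (c.T⁻¹ (cut₂ r)) < c.idx₂ r) c.isLabel₂ hcut₂
    (v := c.S₂⁻¹ v) (fun h => h) (by rwa [hl])
  rw [perm_apply_inv] at this
  exact hv (this.symm.imp (fun h => by exact_mod_cast h) (fun h => by exact_mod_cast h))

theorem spec_closed (c : Choices (Fin n)) {r : Fin n} (hr : c.spec r) (v : Fin n) :
    (c.lab₁ (c.S₂⁻¹ v) = r ↔ c.lab₁ v = r) ∧ (c.lab₁ (c.S₂ v) = r ↔ c.lab₁ v = r) :=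
  Whole.closed ((c.spec_iff r).1 hr).2 v

/-- In an uncuttable cycle the second-factor edge entering `r` starts on the cycle itself, hence not
in an earlier block; so the cycle is laid out forwards, with `r` at the right end. -/
theorem spec_not_left (c : Choices (Fin n)) {r : Fin n} (hr : c.spec r) :
    c.cut₁ r = r ∧ ¬ c.idx₁ (c.S₂⁻¹ (c.cut₁ r)) < c.idx₁ r := by
  have hl := ((c.spec_iff r).1 hr).1
  have hc : c.cut₁ r = r := by have := c.cut₁_spec r (by rwa [hl]); rwa [hl] at this
  refine ⟨hc, ?_⟩
  have h1 := c.isLabel₁.idx_lab_le (c.S₂⁻¹ r)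
  rw [(c.spec_closed hr r).1.2 hl] at h1
  rw [hc]; omega

/-- The closing conditions come from `place_side`, applicable because cuts avoid `Whole`. The
conditions on steep edges come from the fact that an uncuttable cycle is a component and is laid out
with the head of its steep edge at the right end. Simplicity of the graph enters through injectivity
of `E`. -/
theorem layout_good (c : Choices (Fin n)) {m : ℕ} {E : ℕ → Sym2 (Fin n)}
    (hF : Factors m E c.s₁ c.s₂ c.j₁ c.j₂) (hE : ∀ e, e ≠ 0 → e ≤ m → ¬ (E e).IsDiag)
    (hE' : ∀ e f, e ≠ 0 → e ≤ m → f ≠ 0 → f ≤ m → E e = E f → e = f) {cut₂ : Fin n → Fin n}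
    (hcut₂ : ∀ v, c.lab₂ (cut₂ (c.lab₂ v)) = c.lab₂ v)
    (hcut₂' : ∀ v, ¬ Whole c.S₂ c.T c.K₂ c.K₁ c.lab₂ (cut₂ (c.lab₂ v))) :
    (c.layout cut₂).Good := by
  have hF' := c.factors hF
  have hK₂ : ∀ v, c.K₂ v ≠ 0 → c.J₂ v ≠ 0 ∧ ¬ c.spec v ∧ c.K₂ v = c.J₂ v := fun v h => by
    rw [c.K₂_eq] at h ⊢
    by_cases hs : c.spec v
    · simp [hs] at h
    · rw [if_neg hs] at h ⊢; exact ⟨h, hs, rfl⟩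
  have hspec : ∀ r, c.spec r → c.lab₁ r = r ∧
      ∀ u, c.lab₁ u = r → Whole c.S₁ c.S₂ c.J₁ c.J₂ c.lab₁ u := fun r hr => (c.spec_iff r).1 hr
  have hJ : ∀ r, c.spec r → c.J₂ r ≠ 0 := fun r hr => ((hspec r hr).2 r (hspec r hr).1).2.1
  have nd₂ : ∀ v, c.J₂ v ≠ 0 → c.S₂⁻¹ v ≠ v := fun v h e => by
    obtain ⟨h1, h2⟩ := hF'.mem₂ v h
    exact hE _ h h1 (by rw [h2, e]; simp)
  have nd₁ : ∀ v, c.K₁ v ≠ 0 → c.T⁻¹ v ≠ v := fun v h e => by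
    obtain ⟨h1, h2⟩ := hF'.mem₁ v h
    exact hE _ h h1 (by rw [h2, e]; simp)
  have num : ∀ k v, (c.layout cut₂).real k v → ∃ e, e ≠ 0 ∧ e ≤ m ∧
      E e = s((c.layout cut₂).tail k v, v) ∧
      (k = .vert ∧ e = c.K₁ v ∨ k = .horiz ∧ e = c.J₂ v ∧ ¬ c.spec v ∨
        k = .steep ∧ e = c.J₂ v ∧ c.spec v) := by
    intro k v h
    cases k with
    | vert => exact ⟨_, h, (hF'.mem₁ v h).1, (hF'.mem₁ v h).2, .inl ⟨rfl, rfl⟩⟩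
    | horiz =>
      obtain ⟨h1, h2, -⟩ := hK₂ v h
      exact ⟨_, h1, (hF'.mem₂ v h1).1, (hF'.mem₂ v h1).2, .inr (.inl ⟨rfl, rfl, h2⟩)⟩
    | steep =>
      have h1 := hJ v h
      exact ⟨_, h1, (hF'.mem₂ v h1).1, (hF'.mem₂ v h1).2, .inr (.inr ⟨rfl, rfl, h⟩)⟩
  refine
    { X_inj := fun u v h => place_injective c.isLabel₁ c.lab_cut₁ (Nat.cast_injective (R := ℤ) h)
      Y_inj := fun u v h => place_injective c.isLabel₂ hcut₂ (Nat.cast_injective (R := ℤ) h)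
      p_inj := c.T⁻¹.injective
      q_inj := c.S₂⁻¹.injective
      loopless := ?_, simple := ?_, closing_vert := ?_, closing_vert_steep := ?_
      closing_horiz := ?_, steep_lt := ?_
      lab_p := fun r v _ => by simp only [layout, c.lab_T_inv]
      lab_q := ?_, lab_le := ?_, lab_between := ?_, steep_unique := ?_ }
  · intro k v h
    cases k with
    | vert => exact nd₁ v h
    | horiz => exact nd₂ v (hK₂ v h).1
    | steep => exact nd₂ v (hJ v h)
  · intro k v k' v' h h' heq
    obtain ⟨e, e1, e2, e3, e4⟩ := num k v h
    obtain ⟨f, f1, f2, f3, f4⟩ := num k' v' h'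
    obtain rfl : e = f := hE' e f e1 e2 f1 f2 (by rw [e3, f3, heq])
    rcases e4 with ⟨rfl, rfl⟩ | ⟨rfl, rfl, hs⟩ | ⟨rfl, rfl, hs⟩ <;>
      rcases f4 with ⟨rfl, hf⟩ | ⟨rfl, hf, hs'⟩ | ⟨rfl, hf, hs'⟩
    · exact ⟨rfl, hF'.inj₁ _ _ e1 hf⟩
    · exact (hF'.disj _ _ e1 hf).elim
    · exact (hF'.disj _ _ e1 hf).elim
    · exact (hF'.disj _ _ (hf ▸ e1) hf.symm).elim
    · exact ⟨rfl, hF'.inj₂ _ _ e1 hf⟩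
    · exact (hs (hF'.inj₂ _ _ e1 hf ▸ hs')).elim
    · exact (hF'.disj _ _ (hf ▸ e1) hf.symm).elim
    · exact (hs' (hF'.inj₂ _ _ e1 hf ▸ hs)).elim
    · exact ⟨rfl, hF'.inj₂ _ _ e1 hf⟩
  · intro v hv hadj hu
    obtain ⟨h1, h2⟩ := c.tail_eq_cut₁ hadj
    have hv' : c.K₁ v ≠ 0 := hv
    obtain ⟨hJu, hsu, -⟩ := hK₂ (c.T⁻¹ v) hu
    have hlu := c.lab_T_inv v
    -- On a cycle with a steep edge the cut vertex is the head of that edge, so no horizontal edge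
    -- enters it and nothing competes with the closing edge.
    have hns : ¬ c.spec (c.lab₁ v) := fun hs => hsu (by rw [h1, c.cut₁_spec v hs]; exact hs)
    obtain ⟨hrv, e⟩ := h2.resolve_left fun h => hns h.2
    have ho : c.lab₁ (c.S₂⁻¹ (c.T⁻¹ v)) ≠ c.lab₁ (c.T⁻¹ v) := fun ho => by
      refine c.cut₁_not_spec v hns ?_
      rw [← h1]
      refine ⟨?_, hJu, ho⟩
      rw [e, perm_apply_inv]
      rwa [c.K₁_eq, if_neg hrv] at hv'
    have := place_side (left := fun r => c.idx₁ (c.S₂⁻¹ (c.cut₁ r)) < c.idx₁ r) (rv := c.rv)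
      c.isLabel₁ c.lab_cut₁ (u := c.T⁻¹ v) (v := v) (o := c.S₂⁻¹ (c.T⁻¹ v))
      (by rwa [hlu]) (by rwa [hlu]) ho (by rw [hlu, ← h1]) hlu.symm (nd₁ v hv)
    simpa only [layout, Nat.cast_lt] using this
  · intro v r hv hadj hr heq
    obtain ⟨h1, -⟩ := c.tail_eq_cut₁ hadj
    have heq' : c.S₂⁻¹ r = c.T⁻¹ v := heq
    have hl := (c.spec_closed hr r).1.2 (hspec r hr).1
    rw [heq', c.lab_T_inv] at hl
    rw [hl, (c.spec_not_left hr).1, ← heq'] at h1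
    -- The closing edge would start at the cut vertex `r` and also at the tail of the edge entering
    -- `r`, making the latter a loop.
    exact nd₂ r (hJ r hr) h1
  · intro v hv hadj hu
    have h1 := c.tail_eq_cut₂ hcut₂ hadj
    have hlu := c.isLabel₂.lab_inv v
    have ho : c.lab₂ (c.T⁻¹ (c.S₂⁻¹ v)) ≠ c.lab₂ (c.S₂⁻¹ v) := fun ho => by
      refine hcut₂' v ?_
      rw [← h1]
      refine ⟨?_, hu, ho⟩
      rw [perm_apply_inv]; exact hv
    have := place_side (left := fun r => c.idx₂ (c.T⁻¹ (cut₂ r)) < c.idx₂ r)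
      (rv := fun _ => False) c.isLabel₂ hcut₂ (u := c.S₂⁻¹ v) (v := v) (o := c.T⁻¹ (c.S₂⁻¹ v))
      (fun h => h) (by rwa [hlu]) ho (by rw [hlu, ← h1]) hlu.symm (nd₂ v (hK₂ v hv).1)
    simpa only [layout, Nat.cast_lt] using this
  · intro r hr _
    have hr : c.spec r := hr
    obtain ⟨hl, hw⟩ := hspec r hr
    have hz := (c.spec_closed hr r).1.2 hl
    have hw' := (c.spec_closed hr (c.S₂⁻¹ r)).1.2 hz
    have hJz : c.J₂ (c.S₂⁻¹ r) ≠ 0 := (hw _ hz).2.1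
    have n1 := nd₂ r (hJ r hr)
    have n2 := nd₂ _ hJz
    -- A second-factor cycle of length two consisting of edges of the graph would give two parallel
    -- edges.
    have n3 : c.S₂⁻¹ (c.S₂⁻¹ r) ≠ r := fun e => by
      obtain ⟨a1, a2⟩ := hF'.mem₂ _ hJz
      obtain ⟨b1, b2⟩ := hF'.mem₂ _ (hJ r hr)
      refine n1 (hF'.inj₂ _ _ hJz (hE' _ _ hJz a1 (hJ r hr) b1 ?_))
      rw [a2, b2, e]; exact Sym2.eq_swap
    have key : place c.S₁ c.lab₁ c.idx₁ c.cut₁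
          (fun r => c.idx₁ (c.S₂⁻¹ (c.cut₁ r)) < c.idx₁ r) c.rv (c.S₂⁻¹ (c.S₂⁻¹ r)) <
        place c.S₁ c.lab₁ c.idx₁ c.cut₁
          (fun r => c.idx₁ (c.S₂⁻¹ (c.cut₁ r)) < c.idx₁ r) c.rv (c.S₂⁻¹ r) := by
      by_cases hrv : c.rv r
      · exact (place_lt_iff_of_rv c.isLabel₁ (hz.symm ▸ hrv) (hw'.trans hz.symm)).2
          ((c.rv_iff r).1 hrv).2
      · refine place_lt_of_cut_eq c.isLabel₁ hrv (c.spec_not_left hr).2 (c.spec_not_left hr).1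
          hw' hz n3 ?_
        have h1 : ¬ c.idx₁ (c.S₂⁻¹ r) < c.idx₁ (c.S₂⁻¹ (c.S₂⁻¹ r)) := fun h =>
          hrv ((c.rv_iff r).2 ⟨hr, h⟩)
        exact (not_lt.1 h1).lt_of_ne (c.isLabel₁.inj.ne n2)
    simpa only [layout, Nat.cast_lt, Nat.cast_le] using key
  · intro r v hr
    have h := (c.spec_closed (r := r) hr v).1
    have hl := (hspec r hr).1
    simp only [layout, Fin.val_inj, hl, h]
  · intro r v hr hv
    have hr : c.spec r := hr
    have hl := (hspec r hr).1
    have hv : c.lab₁ v = r := by rw [← hl]; exact Fin.ext hv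
    have key : place c.S₁ c.lab₁ c.idx₁ c.cut₁
          (fun r => c.idx₁ (c.S₂⁻¹ (c.cut₁ r)) < c.idx₁ r) c.rv v ≤
        place c.S₁ c.lab₁ c.idx₁ c.cut₁
          (fun r => c.idx₁ (c.S₂⁻¹ (c.cut₁ r)) < c.idx₁ r) c.rv r := by
      by_cases hrv : c.rv r
      · have := place_le_of_rv (cut := c.cut₁) (rv := c.rv)
          (left := fun r => c.idx₁ (c.S₂⁻¹ (c.cut₁ r)) < c.idx₁ r) c.isLabel₁ (v := v)
          (hv.symm ▸ hrv)
        rwa [hv] at this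
      · have := (place_cut (rv := c.rv) (left := fun r => c.idx₁ (c.S₂⁻¹ (c.cut₁ r)) < c.idx₁ r)
          c.isLabel₁ c.lab_cut₁ (v := v) (hv.symm ▸ hrv)).1
          (by rw [hv]; exact (c.spec_not_left hr).2)
        rwa [hv, (c.spec_not_left hr).1] at this
    simpa only [layout, Nat.cast_lt, Nat.cast_le] using key
  · intro r v hr hb
    have hr : c.spec r := hr
    have hl := (hspec r hr).1
    simp only [layout, Nat.cast_lt] at hb
    have h2 : c.lab₂ v = c.lab₂ r := by
      rcases hb with ⟨h1, h2⟩ | ⟨h1, h2⟩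
      · exact lab_eq_of_place_between c.isLabel₂ hcut₂ (c.isLabel₂.lab_inv r).symm h1.le h2.le
      · exact (lab_eq_of_place_between c.isLabel₂ hcut₂ (c.isLabel₂.lab_inv r) h1.le h2.le).trans
          (c.isLabel₂.lab_inv r)
    -- Rows between those of `r` and its predecessor belong to the same second-factor cycle, and
    -- that cycle stays inside the component of `r`.
    have : c.lab₁ v = r := c.isLabel₂.mem_of_closed (S := {v | c.lab₁ v = r})
      (fun u hu => (c.spec_closed hr u).2.2 hu) (v := r) hl h2
    simp only [layout, hl, this]
  · intro r r' hr hr' h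
    have h1 := (hspec r hr).1
    have h2 := (hspec r' hr').1
    have : c.lab₁ r' = c.lab₁ r := Fin.ext h
    rw [← h2, this, h1]

/-- Every edge is drawn. -/
theorem exists_real (c : Choices (Fin n)) {m : ℕ} {E : ℕ → Sym2 (Fin n)}
    (hF : Factors m E c.s₁ c.s₂ c.j₁ c.j₂) (cut₂ : Fin n → Fin n) {e : ℕ} (h0 : e ≠ 0)
    (he : e ≤ m) : ∃ k v, (c.layout cut₂).real k v ∧ E e = s((c.layout cut₂).tail k v, v) ∧
      (k = .vert ∧ c.K₁ v = e ∨ k = .horiz ∧ c.K₂ v = e ∨ k = .steep ∧ c.J₂ v = e) := by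
  have hF' := c.factors hF
  rcases hF'.surj e h0 he with ⟨v, rfl⟩ | ⟨v, rfl⟩
  · exact ⟨.vert, v, h0, (hF'.mem₁ v h0).2, .inl ⟨rfl, rfl⟩⟩
  · by_cases hs : c.spec v
    · exact ⟨.steep, v, hs, (hF'.mem₂ v h0).2, .inr (.inr ⟨rfl, rfl⟩)⟩
    · have : c.K₂ v = c.J₂ v := by rw [c.K₂_eq, if_neg hs]
      exact ⟨.horiz, v, show c.K₂ v ≠ 0 by rwa [this], (hF'.mem₂ v h0).2, .inr (.inl ⟨rfl, this⟩)⟩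

end Choices

end OneBendRAC

namespace OneBendRAC

namespace Program

/-! ### Two-colouring of the union of two perfect matchings -/

/-- A fixed-point-free involution of `{0, …, N - 1}`. -/
def IsMatching (N : ℕ) (α : ℕ → ℕ) : Prop := ∀ d < N, α d < N ∧ α (α d) = d ∧ α d ≠ d

/-- Colours cell by cell the array `c` such that both matchings, in the arrays `a` and `b` of length
variable `2`, join cells of different colours. -/
def twoColor (a b c : ℕ) : Program :=
  .seq (.assign 3 (.lit 0)) (.seq (.assign 4 (.lit 0))
    (.loop (.lt (.var 3) (.var 2))
      (.ite (.eq (.get c (.var 4)) (.lit 0))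
        (.seq (.store c (.var 4) (.lit 1)) (.seq (.assign 5 (.get a (.var 4)))
          (.seq (.store c (.var 5) (.lit 2)) (.assign 4 (.get b (.var 5))))))
        (.seq (.assign 3 (.add (.var 3) (.lit 1))) (.assign 4 (.var 3))))))

/-- Here `k` scans for uncoloured cells, `x` is the current cell of the walk and `0` means
uncoloured. Pairs of `α` are coloured together; a pair of `β` may be pending only at `x`, as stated
in `right_two`. That the `β`-partner of a cell coloured `1` has colour `2` is not part of the
invariant: it fails at the start of an open walk. -/
structure ColorInv (N : ℕ) (α β col : ℕ → ℕ) (k x : ℕ) : Prop where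
  k_le : k ≤ N
  x_lt : x < N ∨ x = k
  done : ∀ d < k, col d ≠ 0
  start : x = k ∨ col k ≠ 0
  le_two : ∀ d < N, col d ≤ 2
  left_one : ∀ d < N, col d = 1 → col (α d) = 2
  left_two : ∀ d < N, col d = 2 → col (α d) = 1
  right_two : ∀ d < N, col d = 2 → col (β d) = 1 ∨ β d = x ∧ col x = 0

theorem ColorInv.color {N : ℕ} {α β col : ℕ → ℕ} {k x : ℕ} (hα : IsMatching N α)
    (hβ : IsMatching N β) (h : ColorInv N α β col k x) (hk : k < N) (hx : col x = 0) :
    ColorInv N α β (fun d => if d = α x then 2 else if d = x then 1 else col d) k (β (α x)) ∧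
      x < N ∧ α x ≠ x ∧ col (α x) = 0 := by
  have hxN : x < N := by rcases h.x_lt with h | h <;> omega
  obtain ⟨a1, a2, a3⟩ := hα x hxN
  obtain ⟨b1, b2, b3⟩ := hβ (α x) a1
  have hy : col (α x) = 0 := by
    have h1 := h.le_two _ a1
    have h2 := h.left_one _ a1
    have h3 := h.left_two _ a1
    rw [a2] at h2 h3
    by_contra h0
    omega
  refine ⟨⟨h.k_le, .inl b1, ?_, ?_, ?_, ?_, ?_, ?_⟩, hxN, a3, hy⟩
  · intro d hd; have := h.done d hd; split_ifs <;> simp_all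
  · right
    rcases h.start with rfl | h0
    · simp [a3.symm]
    · split_ifs <;> simp_all
  · intro d hd; have := h.le_two d hd; split_ifs <;> simp_all
  · intro d hd
    by_cases h1 : d = α x
    · simp [h1]
    by_cases h2 : d = x
    · simp [h2]
    · have h3 : α d ≠ α x := fun e => h2 (by rw [← (hα d hd).2.1, e, a2])
      have h4 : α d ≠ x := fun e => h1 (by rw [← e, (hα d hd).2.1])
      simp only [h1, h2, h3, h4, if_false]
      exact h.left_one d hd
  · intro d hd
    by_cases h1 : d = α x
    · simp [h1, a2, a3.symm]
    by_cases h2 : d = x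
    · simp [h2, a3.symm]
    · have h3 : α d ≠ α x := fun e => h2 (by rw [← (hα d hd).2.1, e, a2])
      have h4 : α d ≠ x := fun e => h1 (by rw [← e, (hα d hd).2.1])
      simp only [h1, h2, h3, h4, if_false]
      exact h.left_two d hd
  · intro d hd
    by_cases h1 : d = α x
    · subst h1
      intro _
      by_cases h2 : β (α x) = x
      · left; simp [h2, a3.symm]
      · simp only [b3, h2, if_false, true_and]
        -- If the next cell already had colour `2`, its `β`-partner `α x` would have colour `1` or
        -- be the current cell `x`; but `α x` was uncoloured and differs from `x`.
        by_contra! h0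
        have h3 := h.le_two _ b1
        have h4 := h.right_two _ b1 (by omega)
        rw [b2] at h4
        rcases h4 with h4 | h4
        · omega
        · exact a3 h4.1
    by_cases h2 : d = x
    · simp [h2, a3.symm]
    · simp only [h1, h2, if_false]
      intro hd2
      rcases h.right_two d hd hd2 with h3 | ⟨h3, h4⟩
      · left
        split_ifs with h5 h6
        · rw [h5] at h3; omega
        · rfl
        · exact h3
      · left; simp [h3, a3.symm]

theorem ColorInv.next {N : ℕ} {α β col : ℕ → ℕ} {k x : ℕ} (h : ColorInv N α β col k x) (hk : k < N)
    (hx : col x ≠ 0) : ColorInv N α β col (k + 1) (k + 1) := by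
  refine ⟨hk, .inr rfl, ?_, .inl rfl, h.le_two, h.left_one, h.left_two, ?_⟩
  · intro d hd
    rcases Nat.lt_succ_iff_lt_or_eq.1 hd with h1 | rfl
    · exact h.done d h1
    · rcases h.start with h1 | h1
      · rwa [← h1]
      · exact h1
  · intro d hd h2
    exact .inl ((h.right_two d hd h2).resolve_right fun h3 => hx h3.2)

/-- The missing implication is obtained by counting: `α` embeds colour class `1` into class `2`, and
`β` embeds class `2` into class `1`, so `β` is onto class `1`. -/
theorem ColorInv.final {N : ℕ} {α β col : ℕ → ℕ} {k x : ℕ} (hα : IsMatching N α)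
    (hβ : IsMatching N β) (h : ColorInv N α β col k x) (hk : N ≤ k) :
    ∀ d < N, (col d = 1 ∨ col d = 2) ∧ col (α d) ≠ col d ∧ col (β d) ≠ col d := by
  have h12 : ∀ d < N, col d = 1 ∨ col d = 2 := fun d hd => by
    have h1 := h.done d (by omega)
    have h2 := h.le_two d hd
    omega
  have hb2 : ∀ d < N, col d = 2 → col (β d) = 1 := fun d hd h2 => by
    rcases h.right_two d hd h2 with h1 | ⟨h1, h3⟩
    · exact h1
    · exact (h.done (β d) (by have := (hβ d hd).1; omega) (h1 ▸ h3)).elim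
  have hb1 : ∀ d < N, col d = 1 → col (β d) = 2 := by
    set A := (Finset.range N).filter fun d => col d = 1
    set B := (Finset.range N).filter fun d => col d = 2
    have hAB : A.card ≤ B.card := by
      refine Finset.card_le_card_of_injOn α ?_ ?_
      · intro d hd
        obtain ⟨h1, h2⟩ := Finset.mem_filter.1 hd
        rw [Finset.mem_range] at h1
        exact Finset.mem_filter.2 ⟨Finset.mem_range.2 (hα d h1).1, h.left_one d h1 h2⟩
      · intro d hd e he hde
        obtain ⟨h1, h2⟩ := Finset.mem_filter.1 hd
        obtain ⟨h3, h4⟩ := Finset.mem_filter.1 he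
        rw [Finset.mem_range] at h1 h3
        rw [← (hα d h1).2.1, ← (hα e h3).2.1]
        exact congrArg α hde
    have hmaps : ∀ d ∈ B, β d ∈ A := fun d hd => by
      obtain ⟨h1, h2⟩ := Finset.mem_filter.1 hd
      rw [Finset.mem_range] at h1
      exact Finset.mem_filter.2 ⟨Finset.mem_range.2 (hβ d h1).1, hb2 d h1 h2⟩
    have hinj : Set.InjOn β B := by
      intro d hd e he hde
      obtain ⟨h1, h2⟩ := Finset.mem_filter.1 hd
      obtain ⟨h3, h4⟩ := Finset.mem_filter.1 he
      rw [Finset.mem_range] at h1 h3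
      rw [← (hβ d h1).2.1, ← (hβ e h3).2.1]
      exact congrArg β hde
    intro d hd h1
    obtain ⟨e, he, rfl⟩ := Finset.surjOn_of_injOn_of_card_le β hmaps hinj hAB
      (Finset.mem_coe.2 (Finset.mem_filter.2 ⟨Finset.mem_range.2 hd, h1⟩))
    obtain ⟨h3, h4⟩ := Finset.mem_filter.1 he
    rwa [(hβ e (Finset.mem_range.1 h3)).2.1]
  intro d hd
  have h1 := h.left_one d hd
  have h2 := h.left_two d hd
  have h3 := hb1 d hd
  have h4 := hb2 d hd
  rcases h12 d hd with h | h
  · exact ⟨.inl h, by rw [h1 h, h]; decide, by rw [h3 h, h]; decide⟩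
  · exact ⟨.inr h, by rw [h2 h, h]; decide, by rw [h4 h, h]; decide⟩

theorem card_filter_lt_of_update {N x : ℕ} {f g : ℕ → ℕ} (hx : x < N) (hf : f x = 0)
    (hg : g x ≠ 0) (h : ∀ d, g d = 0 → f d = 0) :
    ((Finset.range N).filter fun d => g d = 0).card <
      ((Finset.range N).filter fun d => f d = 0).card := by
  refine Finset.card_lt_card ⟨fun d hd => ?_, fun hsub => ?_⟩
  · simp only [Finset.mem_filter] at hd ⊢; exact ⟨hd.1, h d hd.2⟩
  · have := hsub (Finset.mem_filter.2 ⟨Finset.mem_range.2 hx, hf⟩)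
    exact hg (Finset.mem_filter.1 this).2

theorem exists_run_twoColor {M N a b c : ℕ} {ν : NState} (hν : ν.Bdd M) (hN : ν.var 2 = N)
    (hM : 2 ≤ M) (hca : c ≠ a) (hcb : c ≠ b) (hα : IsMatching N (ν.arr a))
    (hβ : IsMatching N (ν.arr b)) (h0 : ∀ d < N, ν.arr c d = 0) :
    ∃ τ, Run M (twoColor a b c) (80 * (N + 1)) ν τ ∧
      ∀ d < N, (τ.arr c d = 1 ∨ τ.arr c d = 2) ∧ τ.arr c (ν.arr a d) ≠ τ.arr c d ∧
        τ.arr c (ν.arr b d) ≠ τ.arr c d := by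
  have r1 : Run M (.assign 3 (.lit 0)) 2 ν (ν.setVar 3 0) :=
    run_of_ok (c := .assign 3 (.lit 0)) hν ⟨le_rfl, by positivity⟩
  have r2 : Run M (.assign 4 (.lit 0)) 2 (ν.setVar 3 0) ((ν.setVar 3 0).setVar 4 0) :=
    run_of_ok (c := .assign 4 (.lit 0)) r1.bdd ⟨le_rfl, by positivity⟩
  set ν' := (ν.setVar 3 0).setVar 4 0 with hν'
  obtain ⟨τ, hτ, hI, hp⟩ := exists_run_loop (M := M) (p := .lt (.var 3) (.var 2))
    (c := .ite (.eq (.get c (.var 4)) (.lit 0))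
        (.seq (.store c (.var 4) (.lit 1)) (.seq (.assign 5 (.get a (.var 4)))
          (.seq (.store c (.var 5) (.lit 2)) (.assign 4 (.get b (.var 5))))))
        (.seq (.assign 3 (.add (.var 3) (.lit 1))) (.assign 4 (.var 3))))
    (fun σ => ColorInv N (ν.arr a) (ν.arr b) (σ.arr c) (σ.var 3) (σ.var 4))
    -- Each pass either colours new cells or advances the scan, so the remaining scan plus the
    -- number of uncoloured cells is a linear measure.
    (fun σ => (N - σ.var 3) + ((Finset.range N).filter fun d => σ.arr c d = 0).card) r2.bdd
    (by
      simp only [hν', NState.setVar_var, NState.setVar_arr]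
      refine ⟨by simp, .inr (by simp), by simp, .inl (by simp), fun d hd => ?_, fun d hd h => ?_,
        fun d hd h => ?_, fun d hd h => ?_⟩ <;> have := h0 d hd <;> omega)
    (by
      intro σ hσ hf hI
      have h2 : σ.var 2 = N := by
        rw [hf.var 2 (by simp [vars]), hν']; simp [NState.setVar_var, hN]
      have ha : σ.arr a = ν.arr a := by rw [hf.arr a (by simp [arrs, hca.symm])]; rfl
      have hb : σ.arr b = ν.arr b := by rw [hf.arr b (by simp [arrs, hcb.symm])]; rfl
      refine ⟨by simp [Expr.Ok], fun hp => ?_⟩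
      have hk : σ.var 3 < N := by simpa [Expr.neval, h2] using hp
      have hNM : N ≤ M := h2 ▸ hσ.1 2
      by_cases hx : σ.arr c (σ.var 4) = 0
      · obtain ⟨hI', hxN, hne, hy⟩ := hI.color hα hβ hk hx
        have hbr : (Test.eq (.get c (.var 4)) (.lit 0)).NHolds σ := hx
        set x := σ.var 4
        have e : ((Program.ite (.eq (.get c (.var 4)) (.lit 0))
            (.seq (.store c (.var 4) (.lit 1)) (.seq (.assign 5 (.get a (.var 4)))
              (.seq (.store c (.var 5) (.lit 2)) (.assign 4 (.get b (.var 5))))))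
            (.seq (.assign 3 (.add (.var 3) (.lit 1))) (.assign 4 (.var 3)))).nrun σ) =
            (((σ.setArr c x 1).setVar 5 (ν.arr a x)).setArr c (ν.arr a x) 2).setVar 4
              (ν.arr b (ν.arr a x)) := by
          simp only [nrun, if_pos hbr, Expr.neval]
          simp [NState.setVar_var, NState.setArr_arr, hca.symm, hcb.symm, ha, hb, x]
        rw [e]
        have hcol : ((((σ.setArr c x 1).setVar 5 (ν.arr a x)).setArr c (ν.arr a x) 2).setVar 4
              (ν.arr b (ν.arr a x))).arr c =
            fun d => if d = ν.arr a x then 2 else if d = x then 1 else σ.arr c d := by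
          funext d; simp [NState.setArr_arr]
        refine ⟨?_, ?_, ?_⟩
        · simp [Ok, Test.Ok, Expr.Ok, Test.NHolds, Expr.neval, x, hx]; omega
        · simp only [hcol, NState.setVar_var, NState.setArr_var]
          simpa using hI'
        · simp only [hcol, NState.setVar_var, NState.setArr_var]
          have := card_filter_lt_of_update (N := N) (f := σ.arr c)
            (g := fun d => if d = ν.arr a x then 2 else if d = x then 1 else σ.arr c d) hxN hx
            (by simp [hne.symm]) (fun d => by split_ifs <;> simp)
          simpa using this
      · have hbr : ¬ (Test.eq (.get c (.var 4)) (.lit 0)).NHolds σ := hx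
        have e : ((Program.ite (.eq (.get c (.var 4)) (.lit 0))
            (.seq (.store c (.var 4) (.lit 1)) (.seq (.assign 5 (.get a (.var 4)))
              (.seq (.store c (.var 5) (.lit 2)) (.assign 4 (.get b (.var 5))))))
            (.seq (.assign 3 (.add (.var 3) (.lit 1))) (.assign 4 (.var 3)))).nrun σ) =
            (σ.setVar 3 (σ.var 3 + 1)).setVar 4 (σ.var 3 + 1) := by
          simp only [nrun, if_neg hbr, Expr.neval]
          simp [NState.setVar_var]
        rw [e]
        refine ⟨?_, ?_, ?_⟩
        · simp [Ok, Test.Ok, Expr.Ok, Test.NHolds, Expr.neval, hx]; omega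
        · have := hI.next hk hx
          simpa [NState.setVar_var] using this
        · refine Nat.add_lt_add_right (?_ : N - _ < N - _) _
          simp [NState.setVar_var]; omega)
  have hk : N ≤ τ.var 3 := by
    have : τ.var 2 = N := by
      rw [hτ.frame.var 2 (by simp [vars]), hν']; simp [NState.setVar_var, hN]
    simpa [Expr.neval, this] using hp
  refine ⟨τ, (r1.seq (r2.seq hτ)).mono ?_, hI.final hα hβ hk⟩
  have hcard : ((Finset.range N).filter fun d => ν'.arr c d = 0).card ≤ N :=
    (Finset.card_filter_le _ _).trans (by simp)
  have h3 : N - ν'.var 3 ≤ N := Nat.sub_le _ _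
  simp only [Test.lt, Test.cost, Expr.cost, bound]
  omega

end Program

end OneBendRAC

namespace OneBendRAC

/-! ### Straight-line data flow -/

namespace NState

/-- The arrays `A`, with all variables equal to `i`. -/
def view (A : ℕ → ℕ → ℕ) (i : ℕ) : NState := ⟨fun _ => i, A⟩

@[simp] theorem view_var (A : ℕ → ℕ → ℕ) (i x : ℕ) : (view A i).var x = i := rfl

@[simp] theorem view_arr (A : ℕ → ℕ → ℕ) (i : ℕ) : (view A i).arr = A := rfl

end NState

open NState

namespace Expr

/-- Built by addition from nonnegative constants, the loop counter and array cells. -/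
def plain : Expr → Bool
  | lit z => decide (0 ≤ z)
  | var x => decide (x = 3)
  | get _ i => i.plain
  | add e f => e.plain && f.plain
  | sub _ _ => false

/-- The arrays read by an expression. -/
def reads : Expr → List ℕ
  | lit _ => []
  | var _ => []
  | get a i => a :: i.reads
  | add e f => e.reads ++ f.reads
  | sub e f => e.reads ++ f.reads

/-- A number `K` such that all intermediate values are at most `K * M` if all words read are at most
`M`. -/
def size : Expr → ℕ
  | lit z => z.toNat + 1
  | var _ => 1
  | get _ i => i.size + 1
  | add e f => e.size + f.size
  | sub e f => e.size + f.size

/-- Plain expressions see nothing but the counter and the arrays in `reads`, so they may be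
evaluated in a `view` of the final arrays rather than in the running state. -/
theorem neval_congr {e : Expr} {ν σ : NState} (he : e.plain = true) (h3 : ν.var 3 = σ.var 3)
    (ha : ∀ a ∈ e.reads, ν.arr a = σ.arr a) : e.neval ν = e.neval σ := by
  induction e with
  | lit z => rfl
  | var x =>
    obtain rfl : x = 3 := by simpa [plain] using he
    exact h3
  | get a i ih =>
    have := ih he fun b hb => ha b (by simp [reads, hb])
    simp only [neval, this, ha a (by simp [reads])]
  | add e f ihe ihf =>
    simp only [plain, Bool.and_eq_true] at he
    simp only [neval, ihe he.1 fun b hb => ha b (by simp [reads, hb]),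
      ihf he.2 fun b hb => ha b (by simp [reads, hb])]
  | sub e f _ _ => simp [plain] at he

theorem ok_of_plain {e : Expr} {M : ℕ} {σ : NState} (he : e.plain = true) (h1 : 1 ≤ M)
    (h3 : σ.var 3 ≤ M) (ha : ∀ a ∈ e.reads, ∀ i, σ.arr a i ≤ M) :
    e.neval σ ≤ e.size * M ∧ ∀ B, e.size * M ≤ B → e.Ok B σ := by
  induction e with
  | lit z =>
    have h0 : 0 ≤ z := by simpa [plain] using he
    have : z.toNat ≤ (z.toNat + 1) * M := by nlinarith
    exact ⟨this, fun B hB => ⟨h0, by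
      have h2 : z.toNat ≤ B := this.trans hB
      omega⟩⟩
  | var x =>
    obtain rfl : x = 3 := by simpa [plain] using he
    exact ⟨by simpa [neval, size] using h3, fun _ _ => trivial⟩
  | get a i ih =>
    obtain ⟨-, h⟩ := ih he fun b hb => ha b (by simp [reads, hb])
    have := ha a (by simp [reads]) (i.neval σ)
    simp only [size, Nat.succ_mul]
    exact ⟨this.trans (Nat.le_add_left _ _), fun B hB => h B (by omega)⟩
  | add e f ihe ihf =>
    simp only [plain, Bool.and_eq_true] at he
    obtain ⟨e1, e2⟩ := ihe he.1 fun b hb => ha b (by simp [reads, hb])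
    obtain ⟨f1, f2⟩ := ihf he.2 fun b hb => ha b (by simp [reads, hb])
    simp only [size, Nat.add_mul]
    refine ⟨Nat.add_le_add e1 f1, fun B hB => ⟨e2 B (by omega), f2 B (by omega), by omega⟩⟩
  | sub e f _ _ => simp [plain] at he

end Expr

namespace Test

def plain : Test → Bool
  | le e f => e.plain && f.plain
  | eq e f => e.plain && f.plain
  | not p => p.plain
  | and p q => p.plain && q.plain

def reads : Test → List ℕ
  | le e f => e.reads ++ f.reads
  | eq e f => e.reads ++ f.reads
  | not p => p.reads
  | and p q => p.reads ++ q.reads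

def size : Test → ℕ
  | le e f => e.size + f.size
  | eq e f => e.size + f.size
  | not p => p.size
  | and p q => p.size + q.size

theorem nholds_congr {p : Test} {ν σ : NState} (hp : p.plain = true) (h3 : ν.var 3 = σ.var 3)
    (ha : ∀ a ∈ p.reads, ν.arr a = σ.arr a) : p.NHolds ν ↔ p.NHolds σ := by
  induction p with
  | le e f =>
    simp only [plain, Bool.and_eq_true] at hp
    simp only [NHolds, Expr.neval_congr hp.1 h3 fun b hb => ha b (by simp [reads, hb]),
      Expr.neval_congr hp.2 h3 fun b hb => ha b (by simp [reads, hb])]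
  | eq e f =>
    simp only [plain, Bool.and_eq_true] at hp
    simp only [NHolds, Expr.neval_congr hp.1 h3 fun b hb => ha b (by simp [reads, hb]),
      Expr.neval_congr hp.2 h3 fun b hb => ha b (by simp [reads, hb])]
  | not p ih => exact not_congr (ih hp ha)
  | and p q ihp ihq =>
    simp only [plain, Bool.and_eq_true] at hp
    exact and_congr (ihp hp.1 fun b hb => ha b (by simp [reads, hb]))
      (ihq hp.2 fun b hb => ha b (by simp [reads, hb]))

theorem ok_of_plain {p : Test} {M B : ℕ} {σ : NState} (hp : p.plain = true) (h1 : 1 ≤ M)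
    (h3 : σ.var 3 ≤ M) (ha : ∀ a ∈ p.reads, ∀ i, σ.arr a i ≤ M) (hB : p.size * M ≤ B) :
    p.Ok B σ := by
  induction p with
  | le e f =>
    simp only [plain, Bool.and_eq_true] at hp
    simp only [size, Nat.add_mul] at hB
    exact ⟨(Expr.ok_of_plain hp.1 h1 h3 fun b hb => ha b (by simp [reads, hb])).2 B (by omega),
      (Expr.ok_of_plain hp.2 h1 h3 fun b hb => ha b (by simp [reads, hb])).2 B (by omega)⟩
  | eq e f =>
    simp only [plain, Bool.and_eq_true] at hp
    simp only [size, Nat.add_mul] at hB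
    exact ⟨(Expr.ok_of_plain hp.1 h1 h3 fun b hb => ha b (by simp [reads, hb])).2 B (by omega),
      (Expr.ok_of_plain hp.2 h1 h3 fun b hb => ha b (by simp [reads, hb])).2 B (by omega)⟩
  | not p ih => exact ih hp ha hB
  | and p q ihp ihq =>
    simp only [plain, Bool.and_eq_true] at hp
    simp only [size, Nat.add_mul] at hB
    exact ⟨ihp hp.1 (fun b hb => ha b (by simp [reads, hb])) (by omega),
      ihq hp.2 (fun b hb => ha b (by simp [reads, hb])) (by omega)⟩

end Test

/-- A guarded store: `put p g e` writes `e` to cell `g` if `p` holds, and `diff p g x y` writes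
`x - y` to cell `g` if moreover `y ≤ x`. -/
inductive Put where
  | put (p : Test) (g e : Expr)
  | diff (p : Test) (g x y : Expr)

namespace Put

def guard : Put → Test
  | put p _ _ => p
  | diff p _ x y => .and (.le y x) p

def idx : Put → Expr
  | put _ g _ => g
  | diff _ g _ _ => g

def val : Put → Expr
  | put _ _ e => e
  | diff _ _ x y => .sub x y

def plain : Put → Bool
  | put p g e => p.plain && (g.plain && e.plain)
  | diff p g x y => p.plain && (g.plain && (x.plain && y.plain))

def reads (q : Put) : List ℕ := q.guard.reads ++ (q.idx.reads ++ q.val.reads)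

def size (q : Put) : ℕ := q.guard.size + (q.idx.size + q.val.size)

theorem guard_congr {q : Put} {ν σ : NState} (hq : q.plain = true) (h3 : ν.var 3 = σ.var 3)
    (ha : ∀ a ∈ q.reads, ν.arr a = σ.arr a) : q.guard.NHolds ν ↔ q.guard.NHolds σ := by
  refine Test.nholds_congr ?_ h3 fun a h => ha a (by simp [reads, h])
  cases q <;> simp_all [plain, guard, Test.plain]

theorem idx_congr {q : Put} {ν σ : NState} (hq : q.plain = true) (h3 : ν.var 3 = σ.var 3)
    (ha : ∀ a ∈ q.reads, ν.arr a = σ.arr a) : q.idx.neval ν = q.idx.neval σ := by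
  refine Expr.neval_congr ?_ h3 fun a h => ha a (by simp [reads, h])
  cases q <;> simp_all [plain, idx]

theorem val_congr {q : Put} {ν σ : NState} (hq : q.plain = true) (h3 : ν.var 3 = σ.var 3)
    (ha : ∀ a ∈ q.reads, ν.arr a = σ.arr a) : q.val.neval ν = q.val.neval σ := by
  cases q with
  | put p g e =>
    refine Expr.neval_congr ?_ h3 fun a h => ha a (by simp [reads, h])
    simp_all [plain, val]
  | diff p g x y =>
    simp only [plain, Bool.and_eq_true] at hq
    simp only [val, Expr.neval]
    rw [Expr.neval_congr hq.2.2.1 h3 fun a h => ha a (by simp [reads, val, Expr.reads, h]),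
      Expr.neval_congr hq.2.2.2 h3 fun a h => ha a (by simp [reads, val, Expr.reads, h])]

theorem ok_of_plain {q : Put} {M B : ℕ} {σ : NState} (hq : q.plain = true) (h1 : 1 ≤ M)
    (h3 : σ.var 3 ≤ M) (ha : ∀ a ∈ q.reads, ∀ i, σ.arr a i ≤ M) (hB : q.size * M ≤ B) :
    q.guard.Ok B σ ∧ (q.guard.NHolds σ → q.idx.Ok B σ ∧ q.val.Ok B σ) := by
  simp only [size, Nat.add_mul] at hB
  have hi : q.idx.Ok B σ := by
    refine (Expr.ok_of_plain ?_ h1 h3 fun a h => ha a (by simp [reads, h])).2 B (by omega)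
    cases q <;> simp_all [plain, idx]
  refine ⟨?_, fun h => ⟨hi, ?_⟩⟩
  · refine Test.ok_of_plain ?_ h1 h3 (fun a h => ha a (by simp [reads, h])) (by omega)
    cases q <;> simp_all [plain, guard, Test.plain]
  · cases q with
    | put p g e =>
      refine (Expr.ok_of_plain ?_ h1 h3 fun a h => ha a (by simp [reads, h])).2 B (by omega)
      simp_all [plain, val]
    | diff p g x y =>
      simp only [plain, Bool.and_eq_true] at hq
      simp only [val, Expr.size, Nat.add_mul] at hB
      exact ⟨(Expr.ok_of_plain hq.2.2.1 h1 h3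
          fun a h => ha a (by simp [reads, val, Expr.reads, h])).2 B (by omega),
        (Expr.ok_of_plain hq.2.2.2 h1 h3
          fun a h => ha a (by simp [reads, val, Expr.reads, h])).2 B (by omega), h.1⟩

end Put

/-- A loop of the data flow.  `puts b a l` executes for all `i` below the variable `b` the stores `l`
into the array `a`; `rank b p key c o` counts in `c` how often a key occurs among the `i` with `p`
and writes to `o` the number of earlier occurrences. -/
inductive Stage where
  | puts (b a : ℕ) (l : List Put)
  | rank (b : ℕ) (p : Test) (key : Expr) (c o : ℕ)

open Classical in
/-- The number of `i < N` with `P i`. -/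
noncomputable def tally (P : ℕ → Prop) (N : ℕ) : ℕ := Nat.count P N

open Classical in
theorem tally_succ (P : ℕ → Prop) (N : ℕ) :
    tally P (N + 1) = tally P N + if P N then 1 else 0 := by
  simp [tally, Nat.count_succ]

theorem tally_le (P : ℕ → Prop) (N : ℕ) : tally P N ≤ N := by
  classical
  exact Nat.count_le _

/-! ### Meaning and compilation of stages -/

namespace Stage

def limit : Stage → ℕ
  | puts b _ _ => b
  | rank b _ _ _ _ => b

def plain : Stage → Bool
  | puts _ _ l => l.all Put.plain
  | rank _ p key _ _ => p.plain && key.plain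

def reads : Stage → List ℕ
  | puts _ _ l => l.flatMap Put.reads
  | rank _ p key _ _ => p.reads ++ key.reads

def writes : Stage → List ℕ
  | puts _ a _ => [a]
  | rank _ _ _ c o => [c, o]

/-- What the stage has achieved, in terms of the arrays after its execution. -/
def Post (A : ℕ → ℕ → ℕ) (w : ℕ → ℕ) : Stage → Prop
  | puts b a l => ∀ r,
      (A a r = 0 ∧ ∀ i < w b, ∀ q ∈ l, q.guard.NHolds (view A i) → q.idx.neval (view A i) ≠ r) ∨
      ∃ i < w b, ∃ q ∈ l, q.guard.NHolds (view A i) ∧ q.idx.neval (view A i) = r ∧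
        A a r = q.val.neval (view A i)
  | rank b p key c o =>
      (∀ r, A c r = tally (fun i => p.NHolds (view A i) ∧ key.neval (view A i) = r) (w b)) ∧
      ∀ i < w b, p.NHolds (view A i) → A o i =
        tally (fun j => p.NHolds (view A j) ∧ key.neval (view A j) = key.neval (view A i)) i

/-- A stage's result survives as long as the arrays it reads and writes are untouched; single
assignment guarantees that for all later stages. -/
theorem Post.congr {A A' : ℕ → ℕ → ℕ} {w w' : ℕ → ℕ} {s : Stage} (hs : s.plain = true)
    (hA : ∀ a ∈ s.writes ++ s.reads, A a = A' a) (hw : w s.limit = w' s.limit) (h : s.Post A w) :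
    s.Post A' w' := by
  cases s with
  | puts b a l =>
    simp only [limit] at hw
    have ha : A a = A' a := hA a (by simp [writes])
    have hpl : ∀ q ∈ l, q.plain = true := by simpa [plain] using hs
    have hrd : ∀ q ∈ l, ∀ i, ∀ b ∈ q.reads, (view A' i).arr b = (view A i).arr b :=
      fun q hq i b hb => (hA b (List.mem_append_right _ (List.mem_flatMap.2 ⟨q, hq, hb⟩))).symm
    have hg : ∀ q ∈ l, ∀ i, q.guard.NHolds (view A' i) ↔ q.guard.NHolds (view A i) :=
      fun q hq i => Put.guard_congr (hpl q hq) rfl (hrd q hq i)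
    have hx : ∀ q ∈ l, ∀ i, q.idx.neval (view A' i) = q.idx.neval (view A i) :=
      fun q hq i => Put.idx_congr (hpl q hq) rfl (hrd q hq i)
    have hv : ∀ q ∈ l, ∀ i, q.val.neval (view A' i) = q.val.neval (view A i) :=
      fun q hq i => Put.val_congr (hpl q hq) rfl (hrd q hq i)
    intro r
    rcases h r with ⟨h1, h2⟩ | ⟨i, hi, q, hq, h1, h2, h3⟩
    · refine .inl ⟨by rw [← ha, h1], fun i hi q hq hG => ?_⟩
      rw [hx q hq i]
      exact h2 i (hw ▸ hi) q hq ((hg q hq i).1 hG)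
    · refine .inr ⟨i, hw ▸ hi, q, hq, (hg q hq i).2 h1, ?_, ?_⟩
      · rw [hx q hq i, h2]
      · rw [hv q hq i, ← ha, h3]
  | rank b p key c o =>
    simp only [limit] at hw
    simp only [plain, Bool.and_eq_true] at hs
    have hc : A c = A' c := hA c (by simp [writes])
    have ho : A o = A' o := hA o (by simp [writes])
    have hp : ∀ i, p.NHolds (view A' i) ↔ p.NHolds (view A i) := fun i =>
      Test.nholds_congr hs.1 rfl fun b hb => (hA b (by simp [reads, hb])).symm
    have hk : ∀ i, key.neval (view A' i) = key.neval (view A i) := fun i =>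
      Expr.neval_congr hs.2 rfl fun b hb => (hA b (by simp [reads, hb])).symm
    simpa only [Post, hp, hk, ← hc, ← ho, ← hw] using h

/-- The program executing the guarded stores into `a` one after the other. -/
def stores (a : ℕ) : List Put → Program
  | [] => .skip
  | q :: l => .seq (.ite q.guard (.store a q.idx q.val) .skip) (stores a l)

def compile : Stage → Program
  | puts b a l => .upto b (stores a l)
  | rank b p key c o => .upto b (.ite p
      (.seq (.store o (.var 3) (.get c key)) (.store c key (.add (.get c key) (.lit 1)))) .skip)

theorem vars_stores (a : ℕ) (l : List Put) : (stores a l).vars = [] := by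
  induction l with
  | nil => rfl
  | cons q l ih => simp [stores, Program.vars, ih]

theorem arrs_stores {a b : ℕ} {l : List Put} (h : b ∈ (stores a l).arrs) : b = a := by
  induction l with
  | nil => simp [stores, Program.arrs] at h
  | cons q l ih =>
    simp only [stores, Program.arrs, List.mem_append, List.mem_cons, List.not_mem_nil, or_false]
      at h
    exact h.elim id ih

/-- None of the stores reads the array `a` they write, so every guard, address and value can be
computed from the unchanged arrays `A`, whatever has already been stored. -/
theorem nrun_stores {a M B i : ℕ} {l : List Put} {A : ℕ → ℕ → ℕ} {σ : NState} (h1 : 1 ≤ M)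
    (hl : ∀ q ∈ l, q.plain = true) (hB : ∀ q ∈ l, q.size * M ≤ B) (ha : ∀ q ∈ l, a ∉ q.reads)
    (hA : ∀ b i, A b i ≤ M) (h3 : σ.var 3 = i) (hi : i ≤ M) (hσ : ∀ b ≠ a, σ.arr b = A b) :
    (stores a l).Ok B σ ∧ ∀ r,
      (((stores a l).nrun σ).arr a r = σ.arr a r ∧
        ∀ q ∈ l, q.guard.NHolds (view A i) → q.idx.neval (view A i) ≠ r) ∨
      ∃ q ∈ l, q.guard.NHolds (view A i) ∧ q.idx.neval (view A i) = r ∧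
        ((stores a l).nrun σ).arr a r = q.val.neval (view A i) := by
  induction l generalizing σ with
  | nil => exact ⟨trivial, fun r => .inl ⟨rfl, by simp⟩⟩
  | cons q l ih =>
    have hq := hl q (by simp)
    have hrd : ∀ b ∈ q.reads, σ.arr b = (view A i).arr b := fun b hb => hσ b fun e =>
      ha q (by simp) (e ▸ hb)
    have hg := Put.guard_congr hq (ν := σ) (σ := view A i) h3 hrd
    have hx := Put.idx_congr hq (ν := σ) (σ := view A i) h3 hrd
    have hv := Put.val_congr hq (ν := σ) (σ := view A i) h3 hrd
    obtain ⟨ok1, ok2⟩ := Put.ok_of_plain (B := B) hq h1 (h3.le.trans hi)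
      (fun b hb j => by rw [hrd b hb]; exact hA b j) (hB q (by simp))
    have ih' := fun σ h3 hσ => ih (σ := σ) (fun q hq => hl q (by simp [hq]))
      (fun q hq => hB q (by simp [hq])) (fun q hq => ha q (by simp [hq])) h3 hσ
    by_cases hG : q.guard.NHolds σ
    · obtain ⟨j1, j2⟩ := ih' (σ.setArr a (q.idx.neval σ) (q.val.neval σ)) h3
        (fun b hb => by funext r; rw [NState.setArr_arr, if_neg hb, hσ b hb])
      have e : (Program.ite q.guard (.store a q.idx q.val) .skip).nrun σ =
          σ.setArr a (q.idx.neval σ) (q.val.neval σ) := by simp [Program.nrun, hG]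
      refine ⟨⟨⟨ok1, fun h => ok2 h, fun _ => trivial⟩, by rw [e]; exact j1⟩, fun r => ?_⟩
      simp only [stores, Program.nrun.eq_4, e]
      rcases j2 r with ⟨k1, k2⟩ | ⟨q', hq', k1, k2, k3⟩
      · by_cases hr : r = q.idx.neval σ
        · refine .inr ⟨q, by simp, hg.1 hG, by rw [← hx, hr], ?_⟩
          rw [k1, NState.setArr_arr, if_pos rfl, if_pos hr, hv]
        · refine .inl ⟨by rw [k1, NState.setArr_arr, if_pos rfl, if_neg hr], ?_⟩
          intro q' hq'
          rcases List.mem_cons.1 hq' with rfl | hq'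
          · intro _ h; exact hr (by rw [hx, h])
          · exact k2 q' hq'
      · exact .inr ⟨q', by simp [hq'], k1, k2, k3⟩
    · obtain ⟨j1, j2⟩ := ih' σ h3 hσ
      have e : (Program.ite q.guard (.store a q.idx q.val) .skip).nrun σ = σ := by
        simp [Program.nrun, hG]
      refine ⟨⟨⟨ok1, fun h => ok2 h, fun _ => trivial⟩, by rw [e]; exact j1⟩, fun r => ?_⟩
      simp only [stores, Program.nrun.eq_4, e]
      rcases j2 r with ⟨k1, k2⟩ | ⟨q', hq', k1, k2, k3⟩
      · refine .inl ⟨k1, fun q' hq' => ?_⟩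
        rcases List.mem_cons.1 hq' with rfl | hq'
        · intro h; exact (hG (hg.2 h)).elim
        · exact k2 q' hq'
      · exact .inr ⟨q', by simp [hq'], k1, k2, k3⟩

end Stage

end OneBendRAC

namespace OneBendRAC

open NState

/-! ### Linear running time -/

theorem NState.Bdd.mono {M M' : ℕ} {ν : NState} (h : ν.Bdd M) (hM : M ≤ M') : ν.Bdd M' :=
  ⟨fun x => (h.1 x).trans hM, fun a i => (h.2 a i).trans hM⟩

theorem Expr.Fits.mono {B B' : ℕ} {σ : State} {e : Expr} (h : e.Fits B σ) (hB : B ≤ B') :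
    e.Fits B' σ := by
  have hB' : (B : ℤ) ≤ B' := by exact_mod_cast hB
  induction e with
  | lit z => exact h.trans hB'
  | var x => exact h.trans hB'
  | get a i ih => exact ⟨ih h.1, h.2.1, h.2.2.trans hB'⟩
  | add e f ihe ihf => exact ⟨ihe h.1, ihf h.2.1, h.2.2.trans hB'⟩
  | sub e f ihe ihf => exact ⟨ihe h.1, ihf h.2.1, h.2.2.trans hB'⟩

theorem Test.Fits.mono {B B' : ℕ} {σ : State} {p : Test} (h : p.Fits B σ) (hB : B ≤ B') :
    p.Fits B' σ := by
  induction p with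
  | le e f => exact ⟨h.1.mono hB, h.2.mono hB⟩
  | eq e f => exact ⟨h.1.mono hB, h.2.mono hB⟩
  | not p ih => exact ih h
  | and p q ihp ihq => exact ⟨ihp h.1, ihq h.2⟩

theorem Exec.mono {B B' : ℕ} {c : Program} {σ τ : State} {t : ℕ} (h : Exec B c σ t τ)
    (hB : B ≤ B') : Exec B' c σ t τ := by
  induction h with
  | skip σ => exact .skip σ
  | assign σ x e he => exact .assign σ x e (he.mono hB)
  | store σ a i e hi hi0 he => exact .store σ a i e (hi.mono hB) hi0 (he.mono hB)
  | seq _ _ ihc ihd => exact .seq ihc ihd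
  | ite_true hf hp _ ih => exact .ite_true (hf.mono hB) hp ih
  | ite_false hf hp _ ih => exact .ite_false (hf.mono hB) hp ih
  | loop_true hf hp _ _ ihc ihl => exact .loop_true (hf.mono hB) hp ihc ihl
  | loop_false hf hp => exact .loop_false (hf.mono hB) hp

namespace Program

/-- From any state satisfying `I`, the program halts in a state related by `Q` to it, after a number
of steps and with words bounded by a constant times the words of the initial state. -/
def Linear (I : NState → Prop) (c : Program) (Q : NState → NState → Prop) : Prop :=
  ∃ K : ℕ, ∀ (M : ℕ) (ν : NState), 1 ≤ M → ν.Bdd M → I ν →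
    ∃ τ, Run (K * M) c (K * M) ν τ ∧ Q ν τ

theorem Linear.seq {I J : NState → Prop} {c d : Program} {Q R S : NState → NState → Prop}
    (hc : Linear I c Q) (hd : Linear J d R) (hJ : ∀ ν τ, I ν → Q ν τ → J τ)
    (hS : ∀ ν τ ρ, I ν → Q ν τ → R τ ρ → S ν ρ) : Linear I (.seq c d) S := by
  obtain ⟨K, hK⟩ := hc
  obtain ⟨L, hL⟩ := hd
  refine ⟨K + L * (K + 1), fun M ν hM hν hI => ?_⟩
  obtain ⟨τ, hτ, hQ⟩ := hK M ν hM hν hI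
  -- The second program starts from words bounded by `K * M`. The factor `K + 1` keeps the bound at
  -- least one when `K = 0`.
  obtain ⟨ρ, hρ, hR⟩ := hL ((K + 1) * M) τ (by nlinarith)
    (hτ.bdd.mono (Nat.mul_le_mul_right _ (Nat.le_succ K))) (hJ ν τ hI hQ)
  have e : (K + L * (K + 1)) * M = K * M + L * ((K + 1) * M) := by ring
  obtain ⟨s, hs, es⟩ := hτ.exec
  obtain ⟨t, ht, et⟩ := hρ.exec
  have h1 : Run ((K + L * (K + 1)) * M) c (K * M) ν τ :=
    ⟨⟨s, hs, es.mono (by omega)⟩, hτ.bdd.mono (by omega), hτ.frame⟩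
  have h2 : Run ((K + L * (K + 1)) * M) d (L * ((K + 1) * M)) τ ρ :=
    ⟨⟨t, ht, et.mono (by omega)⟩, hρ.bdd.mono (by omega), hρ.frame⟩
  exact ⟨ρ, (h1.seq h2).mono (by omega), hS ν τ ρ hI hQ hR⟩

theorem Linear.mono {I J : NState → Prop} {c : Program} {Q R : NState → NState → Prop}
    (h : Linear I c Q) (hI : ∀ ν, J ν → I ν) (hQ : ∀ ν τ, J ν → Q ν τ → R ν τ) : Linear J c R := by
  obtain ⟨K, hK⟩ := h
  refine ⟨K, fun M ν hM hν hJ => ?_⟩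
  obtain ⟨τ, hτ, h⟩ := hK M ν hM hν (hI ν hJ)
  exact ⟨τ, hτ, hQ ν τ hJ h⟩

/-- The loop invariant evaluates everything in the initial arrays; as only `a` changes and `a` is
not read, it can be transferred to the final arrays at the end. Initial zeros in `a` account for
cells never addressed. -/
theorem exists_run_stores {b a : ℕ} {l : List Put} (hl : ∀ q ∈ l, q.plain = true)
    (ha : ∀ q ∈ l, a ∉ q.reads) (hb : b ≠ 3) :
    Linear (fun ν => ∀ i, ν.arr a i = 0) (Stage.puts b a l).compile
      (fun _ τ => (Stage.puts b a l).Post τ.arr τ.var) := by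
  set c := Stage.stores a l
  have hvars : c.vars = [] := Stage.vars_stores a l
  refine ⟨(l.map Put.size).sum + 2 * c.bound + 20, fun M ν hM hν h0 => ?_⟩
  set B := ((l.map Put.size).sum + 2 * c.bound + 20) * M with hB
  have hMB : M ≤ B := by rw [hB]; exact Nat.le_mul_of_pos_left _ (by omega)
  obtain ⟨τ, hτ, hI⟩ := exists_run_upto (M := B) (b := b) (c := c)
    (fun i σ => ∀ r, (σ.arr a r = 0 ∧ ∀ i' < i, ∀ q ∈ l, q.guard.NHolds (view ν.arr i') →
        q.idx.neval (view ν.arr i') ≠ r) ∨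
      ∃ i' < i, ∃ q ∈ l, q.guard.NHolds (view ν.arr i') ∧ q.idx.neval (view ν.arr i') = r ∧
        σ.arr a r = q.val.neval (view ν.arr i'))
    (hν.mono hMB) rfl hb (by simp [hvars]) (by simp [hvars]) (by omega)
    (fun r => .inl ⟨h0 r, by simp⟩) (by
      intro i σ hi hσ h3 hf hI
      have hiM : i ≤ M := hi.le.trans (hν.1 b)
      have hsz : ∀ q ∈ l, q.size * M ≤ B := fun q hq => by
        rw [hB]
        refine Nat.mul_le_mul_right _ ?_
        have := List.single_le_sum (l := l.map Put.size) (by simp) _ (List.mem_map_of_mem hq)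
        omega
      obtain ⟨h1, h2⟩ := Stage.nrun_stores hM hl hsz ha hν.2 h3 hiM
        (fun a' ha' => hf.arr a' fun h => ha' (Stage.arrs_stores h))
      refine ⟨h1, fun r => ?_⟩
      simp only [setVar_arr]
      rcases h2 r with ⟨k1, k2⟩ | ⟨q, hq, k1, k2, k3⟩
      · rw [k1]
        rcases hI r with ⟨l1, l2⟩ | ⟨i', hi', l1⟩
        · refine .inl ⟨l1, fun i' hi' => ?_⟩
          rcases Nat.lt_succ_iff_lt_or_eq.1 hi' with h | rfl
          · exact l2 i' h
          · exact k2
        · exact .inr ⟨i', hi'.trans (Nat.lt_succ_self _), l1⟩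
      · exact .inr ⟨i, Nat.lt_succ_self _, q, hq, k1, k2, k3⟩)
  refine ⟨τ, hτ.mono ?_, ?_⟩
  · have hN : ν.var b ≤ M := hν.1 b
    have h1 : (c.bound + 9) * (ν.var b + 1) ≤ (c.bound + 9) * (2 * M) :=
      Nat.mul_le_mul_left _ (by omega)
    have h2 : B = (l.map Put.size).sum * M + (c.bound + 9) * (2 * M) + 2 * M := by rw [hB]; ring
    omega
  · have hfa : ∀ a' ≠ a, τ.arr a' = ν.arr a' := fun a' ha' =>
      hτ.frame.arr a' fun h => ha' (Stage.arrs_stores (a := a) (l := l) (by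
        simpa [Program.upto, Program.arrs] using h))
    have hw : τ.var b = ν.var b := hτ.frame.var b (by simp [Program.upto, Program.vars, hvars, hb])
    have hrd : ∀ q ∈ l, ∀ i, ∀ b ∈ q.reads, (view τ.arr i).arr b = (view ν.arr i).arr b :=
      fun q hq i b hb => hfa b fun h => ha q hq (h ▸ hb)
    have hg : ∀ q ∈ l, ∀ i, q.guard.NHolds (view τ.arr i) ↔ q.guard.NHolds (view ν.arr i) :=
      fun q hq i => Put.guard_congr (hl q hq) rfl (hrd q hq i)
    have hx : ∀ q ∈ l, ∀ i, q.idx.neval (view τ.arr i) = q.idx.neval (view ν.arr i) :=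
      fun q hq i => Put.idx_congr (hl q hq) rfl (hrd q hq i)
    have hv : ∀ q ∈ l, ∀ i, q.val.neval (view τ.arr i) = q.val.neval (view ν.arr i) :=
      fun q hq i => Put.val_congr (hl q hq) rfl (hrd q hq i)
    intro r
    rw [hw]
    rcases hI r with ⟨h1, h2⟩ | ⟨i, hi, q, hq, h1, h2, h3⟩
    · refine .inl ⟨h1, fun i hi q hq hG => ?_⟩
      rw [hx q hq i]
      exact h2 i hi q hq ((hg q hq i).1 hG)
    · exact .inr ⟨i, hi, q, hq, (hg q hq i).2 h1, by rw [hx q hq i, h2], by rw [hv q hq i, h3]⟩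

theorem exists_run_rank {b c o : ℕ} {p : Test} {key : Expr} (hp : p.plain = true)
    (hk : key.plain = true) (hb : b ≠ 3) (hco : c ≠ o) (hcp : c ∉ p.reads) (hop : o ∉ p.reads)
    (hck : c ∉ key.reads) (hok : o ∉ key.reads) :
    Linear (fun ν => ∀ i, ν.arr c i = 0) (Stage.rank b p key c o).compile
      (fun _ τ => (Stage.rank b p key c o).Post τ.arr τ.var) := by
  set d : Program := .ite p
    (.seq (.store o (.var 3) (.get c key)) (.store c key (.add (.get c key) (.lit 1)))) .skip
    with hd
  have hvars : d.vars = [] := rfl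
  refine ⟨p.size + key.size + 2 * d.bound + 20, fun M ν hM hν h0 => ?_⟩
  set B := (p.size + key.size + 2 * d.bound + 20) * M with hB
  have hB' : B = p.size * M + key.size * M + (d.bound + 9) * (2 * M) + 2 * M := by rw [hB]; ring
  have hMB : M ≤ B := by omega
  set P : ℕ → ℕ → Prop := fun r i => p.NHolds (view ν.arr i) ∧ key.neval (view ν.arr i) = r with hP
  obtain ⟨τ, hτ, hI⟩ := exists_run_upto (M := B) (b := b) (c := d)
    (fun i σ => (∀ r, σ.arr c r = tally (P r) i) ∧
      ∀ j < i, p.NHolds (view ν.arr j) → σ.arr o j = tally (P (key.neval (view ν.arr j))) j)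
    (hν.mono hMB) rfl hb (by simp [hvars]) (by simp [hvars]) (by omega)
    ⟨fun r => by simp [h0, tally], by simp⟩ (by
      intro i σ hi hσ h3 hf ⟨hI, hJ⟩
      have hiM : i < M := hi.trans_le (hν.1 b)
      have hfa : ∀ a, a ≠ c → a ≠ o → σ.arr a = ν.arr a := fun a h1 h2 =>
        hf.arr a (by simp [hd, Program.arrs, h1, h2])
      have hpr : ∀ a ∈ p.reads, σ.arr a = (view ν.arr i).arr a := fun a ha =>
        hfa a (fun e => hcp (e ▸ ha)) (fun e => hop (e ▸ ha))
      have hkr : ∀ a ∈ key.reads, σ.arr a = (view ν.arr i).arr a := fun a ha =>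
        hfa a (fun e => hck (e ▸ ha)) (fun e => hok (e ▸ ha))
      -- The key is evaluated again after the rank has been stored in `o`, and must still denote the
      -- same counter cell.
      have hkr' : ∀ x, ∀ a ∈ key.reads, (σ.setArr o i x).arr a = (view ν.arr i).arr a := by
        intro x a ha
        rw [← hkr a ha]; funext r
        rw [NState.setArr_arr, if_neg (fun e : a = o => hok (e ▸ ha))]
      have hpe := Test.nholds_congr (ν := σ) (σ := view ν.arr i) hp h3 hpr
      have hke := Expr.neval_congr (ν := σ) (σ := view ν.arr i) hk h3 hkr
      have hke' := fun x => Expr.neval_congr (ν := σ.setArr o i x) (σ := view ν.arr i) hk h3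
        (hkr' x)
      have okp : p.Ok B σ := Test.ok_of_plain hp hM (h3.le.trans hiM.le)
        (fun a ha j => by rw [hpr a ha]; exact hν.2 a j) (by omega)
      have okk : key.Ok B σ := (Expr.ok_of_plain hk hM (h3.le.trans hiM.le)
        (fun a ha j => by rw [hkr a ha]; exact hν.2 a j)).2 B (by omega)
      have okk' : ∀ x, key.Ok B (σ.setArr o i x) := fun x =>
        (Expr.ok_of_plain (σ := σ.setArr o i x) hk hM (h3.le.trans hiM.le)
          (fun a ha j => by rw [hkr' x a ha]; exact hν.2 a j)).2 B (by omega)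
      set k := key.neval (view ν.arr i) with hkdef
      by_cases hG : p.NHolds (view ν.arr i)
      · have e : d.nrun σ = (σ.setArr o i (σ.arr c k)).setArr c k (σ.arr c k + 1) := by
          simp [hd, nrun, hpe.2 hG, Expr.neval, hke, hke', h3, NState.setArr_arr, hco]
        refine ⟨⟨okp, fun _ => ⟨⟨trivial, okk⟩, ?_⟩, fun _ => trivial⟩, ?_⟩
        · simp only [nrun, Expr.neval, hke, h3]
          refine ⟨okk' _, okk' _, ⟨by simp, by exact_mod_cast hM.trans hMB⟩, ?_⟩
          simp only [Expr.neval, hke', NState.setArr_arr, if_neg hco, hI]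
          have := tally_le (P k) i
          simp; omega
        · rw [e]
          refine ⟨fun r => ?_, fun j hj hj' => ?_⟩
          · simp only [setVar_arr, NState.setArr_arr, if_true, if_neg hco, tally_succ, hI]
            by_cases hr : r = k
            · subst hr; simp [hP, hG, hkdef]
            · have : ¬ P r i := fun h => hr h.2.symm
              simp [hr, this]
          · simp only [setVar_arr, NState.setArr_arr, if_true, if_neg hco.symm]
            rcases Nat.lt_succ_iff_lt_or_eq.1 hj with h | rfl
            · rw [if_neg h.ne, hJ j h hj']
            · rw [if_pos rfl, hI]
      · have e : d.nrun σ = σ := by simp [hd, nrun, hpe, hG]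
        refine ⟨⟨okp, fun h => (hG (hpe.1 h)).elim, fun _ => trivial⟩, ?_⟩
        rw [e]
        refine ⟨fun r => ?_, fun j hj hj' => ?_⟩
        · have : ¬ P r i := fun h => hG h.1
          simp [tally_succ, hI, this]
        · rcases Nat.lt_succ_iff_lt_or_eq.1 hj with h | rfl
          · exact hJ j h hj'
          · exact (hG hj').elim)
  refine ⟨τ, hτ.mono ?_, ?_⟩
  · have hN : ν.var b ≤ M := hν.1 b
    have h1 : (d.bound + 9) * (ν.var b + 1) ≤ (d.bound + 9) * (2 * M) :=
      Nat.mul_le_mul_left _ (by omega)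
    omega
  · have hw : τ.var b = ν.var b := hτ.frame.var b (by simp [Program.upto, Program.vars, hvars, hb])
    have hfa : ∀ a, a ≠ c → a ≠ o → τ.arr a = ν.arr a := fun a h1 h2 =>
      hτ.frame.arr a (by simp [Program.upto, hd, Program.arrs, h1, h2])
    have hpe : ∀ i, p.NHolds (view τ.arr i) ↔ p.NHolds (view ν.arr i) := fun i =>
      Test.nholds_congr hp rfl fun a ha => hfa a (fun e => hcp (e ▸ ha)) (fun e => hop (e ▸ ha))
    have hke : ∀ i, key.neval (view τ.arr i) = key.neval (view ν.arr i) := fun i =>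
      Expr.neval_congr hk rfl fun a ha => hfa a (fun e => hck (e ▸ ha)) (fun e => hok (e ▸ ha))
    simp only [Stage.Post, hpe, hke, hw]
    exact hI

/-- Stages executed one after the other. -/
def stages : List Stage → Program
  | [] => .skip
  | s :: l => .seq s.compile (stages l)

end Program

/-- Every array is written by one stage only, before it is read. -/
def Stage.wf : List Stage → Bool
  | [] => true
  | s :: l => s.plain && (decide (s.limit ≠ 3) && (decide s.writes.Nodup &&
      (s.writes.all (fun a => decide (a ∉ s.reads)) &&
      (l.all (fun t => t.writes.all fun a => decide (a ∉ s.writes ++ s.reads)) && Stage.wf l))))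

/-! ### Composition of stages -/

namespace Program

theorem linear_compile {s : Stage} (hp : s.plain = true) (hl : s.limit ≠ 3) (hn : s.writes.Nodup)
    (hr : ∀ a ∈ s.writes, a ∉ s.reads) :
    Linear (fun ν => ∀ a ∈ s.writes, ∀ i, ν.arr a i = 0) s.compile
      (fun ν τ => s.Post τ.arr τ.var ∧ (∀ a, a ∉ s.writes → τ.arr a = ν.arr a) ∧
        ∀ x ≠ 3, τ.var x = ν.var x) := by
  suffices H : Linear (fun ν => ∀ a ∈ s.writes, ∀ i, ν.arr a i = 0) s.compile
      (fun _ τ => s.Post τ.arr τ.var) by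
    obtain ⟨K, hK⟩ := H
    refine ⟨K, fun M ν hM hν h0 => ?_⟩
    obtain ⟨τ, hτ, hQ⟩ := hK M ν hM hν h0
    refine ⟨τ, hτ, hQ, fun a ha => hτ.frame.arr a fun h => ha ?_, fun x hx =>
      hτ.frame.var x fun h => hx ?_⟩
    · cases s with
      | puts b a' l =>
        have := Stage.arrs_stores (b := a) (a := a') (l := l)
          (by simpa [Stage.compile, upto, arrs] using h)
        simp [Stage.writes, this]
      | rank b p key c o =>
        simpa [Stage.compile, Stage.writes, upto, arrs, or_comm] using h
    · cases s with
      | puts b a' l => simpa [Stage.compile, upto, vars, Stage.vars_stores] using h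
      | rank b p key c o => simpa [Stage.compile, upto, vars] using h
  cases s with
  | puts b a l =>
    refine (exists_run_stores (b := b) (a := a) (l := l) ?_ ?_ hl).mono (fun ν h => ?_)
      (fun _ _ _ h => h)
    · simpa [Stage.plain] using hp
    · intro q hq h
      exact hr a (by simp [Stage.writes]) (List.mem_flatMap.2 ⟨q, hq, h⟩)
    · exact h a (by simp [Stage.writes])
  | rank b p key c o =>
    simp only [Stage.plain, Bool.and_eq_true] at hp
    have h1 := hr c (by simp [Stage.writes])
    have h2 := hr o (by simp [Stage.writes])
    simp only [Stage.reads, List.mem_append, not_or] at h1 h2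
    refine (exists_run_rank hp.1 hp.2 hl ?_ h1.1 h2.1 h1.2 h2.2).mono (fun ν h => ?_)
      (fun _ _ _ h => h)
    · rintro rfl; simp [Stage.writes] at hn
    · exact h c (by simp [Stage.writes])

/-- By well-formedness no stage disturbs the arrays of an earlier one, so all postconditions hold
simultaneously in the final state. -/
theorem linear_stages {l : List Stage} (hl : Stage.wf l = true) :
    Linear (fun ν => ∀ s ∈ l, ∀ a ∈ s.writes, ∀ i, ν.arr a i = 0) (stages l)
      (fun ν τ => (∀ s ∈ l, s.Post τ.arr τ.var) ∧
        (∀ a, (∀ s ∈ l, a ∉ s.writes) → τ.arr a = ν.arr a) ∧ ∀ x ≠ 3, τ.var x = ν.var x) := by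
  induction l with
  | nil =>
    refine ⟨1, fun M ν hM hν _ => ⟨ν, ⟨⟨1, by omega, .skip _⟩, ?_, .refl _ _ _⟩, ?_⟩⟩
    · simpa using hν
    · exact ⟨by simp, fun _ _ => rfl, fun _ _ => rfl⟩
  | cons s l ih =>
    simp only [Stage.wf, Bool.and_eq_true, decide_eq_true_eq, List.all_eq_true] at hl
    obtain ⟨hp, hlim, hn, hr, hla, hl⟩ := hl
    refine ((linear_compile hp hlim hn hr).mono (fun ν h => h s (by simp))
      (fun _ _ _ h => h)).seq (ih hl) ?_ ?_
    · rintro ν τ h0 ⟨-, h1, -⟩ t ht a ha i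
      rw [h1 a fun h => hla t ht a ha (List.mem_append_left _ h)]
      exact h0 t (by simp [ht]) a ha i
    · rintro ν τ ρ - ⟨p1, f1, v1⟩ ⟨p2, f2, v2⟩
      refine ⟨fun t ht => ?_, fun a ha => ?_, fun x hx => (v2 x hx).trans (v1 x hx)⟩
      · rcases List.mem_cons.1 ht with rfl | ht
        · refine p1.congr hp (fun a ha => (f2 a fun u hu h => ?_).symm) (v2 _ hlim).symm
          exact hla u hu a h ha
        · exact p2 t ht
      · rw [f2 a fun u hu => ha u (by simp [hu]), f1 a (ha s (by simp))]

end Program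

end OneBendRAC

namespace OneBendRAC

open NState

namespace Program

/-! ### Numbering the cells along the cycles of a permutation -/

/-- Numbers the cells `0, …, n - 1` in the array `x` along the cycles of the permutation in the array
`s`, and stores in `l` for each cell the first cell of its cycle. -/
def label (s l x : ℕ) : Program :=
  .seq (.assign 3 (.lit 0)) (.seq (.assign 4 (.lit 0)) (.seq (.assign 6 (.lit 0))
    (.loop (.lt (.var 3) (.var 0))
      (.ite (.eq (.get x (.var 4)) (.lit 0))
        (.seq (.assign 6 (.add (.var 6) (.lit 1))) (.seq (.store x (.var 4) (.var 6))
          (.seq (.store l (.var 4) (.var 3)) (.assign 4 (.get s (.var 4))))))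
        (.seq (.assign 3 (.add (.var 3) (.lit 1))) (.assign 4 (.var 3)))))))

/-- The inverse `p` of the permutation occurs only in the proof. The number `0` means unvisited, and
`cnt` is the last number given. The field `step` looks backwards because the successor of the latest
cell may be unvisited. `start` and `wrap` describe the current cell: either it continues the walk
begun at `k`, or the walk is back at `k`. -/
structure LabelInv (n : ℕ) (p lab idx : ℕ → ℕ) (k x cnt : ℕ) : Prop where
  k_le : k ≤ n
  x_lt : x < n ∨ x = k
  idx_le : ∀ v < n, idx v ≤ cnt
  cnt_add : cnt + ((Finset.range n).filter fun v => idx v = 0).card = n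
  inj : ∀ v < n, ∀ w < n, idx v ≠ 0 → idx v = idx w → v = w
  done : ∀ v < k, idx v ≠ 0
  lab_spec : ∀ v < n, idx v ≠ 0 → lab v ≤ k ∧ lab v < n ∧ idx (lab v) ≠ 0 ∧ lab (lab v) = lab v
  step : ∀ v < n, idx v ≠ 0 → v = lab v ∨ idx (p v) ≠ 0 ∧ idx v = idx (p v) + 1 ∧ lab (p v) = lab v
  closed : ∀ v < k, lab v = v → idx (p v) ≠ 0 ∧ lab (p v) = v
  start : k < n → idx x = 0 → x = k ∨
    idx (p x) ≠ 0 ∧ idx (p x) = cnt ∧ lab (p x) = k ∧ idx k ≠ 0 ∧ lab k = k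
  wrap : k < n → idx x ≠ 0 → x = k ∧ (lab k = k → idx (p k) ≠ 0 ∧ lab (p k) = k)

theorem LabelInv.visit {n : ℕ} {s p lab idx : ℕ → ℕ} {k x cnt : ℕ}
    (hs : ∀ v < n, s v < n ∧ p (s v) = v)
    (h : LabelInv n p lab idx k x cnt) (hk : k < n) (hx : idx x = 0) :
    LabelInv n p (fun v => if v = x then k else lab v) (fun v => if v = x then cnt + 1 else idx v) k
      (s x) (cnt + 1) ∧ x < n ∧ cnt < n := by
  have hxn : x < n := by rcases h.x_lt with h | h <;> omega
  have hcard : ((Finset.range n).filter fun v => (if v = x then cnt + 1 else idx v) = 0).card + 1 =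
      ((Finset.range n).filter fun v => idx v = 0).card := by
    have : (Finset.range n).filter (fun v => idx v = 0) =
        insert x ((Finset.range n).filter fun v => (if v = x then cnt + 1 else idx v) = 0) := by
      ext v
      by_cases hv : v = x
      · subst hv; simp [hx, hxn]
      · simp [hv]
    rw [this, Finset.card_insert_of_notMem (by simp)]
  have hc := h.cnt_add
  have hxk : x = k ∨ idx k ≠ 0 ∧ lab k = k ∧ k ≠ x := by
    rcases h.start hk hx with h1 | ⟨-, -, -, h1, h2⟩
    · exact .inl h1
    · exact .inr ⟨h1, h2, fun e => h1 (e ▸ hx)⟩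
  have hne : ∀ v, idx v ≠ 0 → v ≠ x := fun v hv e => hv (e ▸ hx)
  refine ⟨⟨h.k_le, .inl (hs x hxn).1, ?_, by omega, ?_, ?_, ?_, ?_, ?_, ?_, ?_⟩, hxn, by omega⟩
  · intro v hv; have := h.idx_le v hv; split_ifs <;> omega
  · intro v hv w hw
    have h1 := h.idx_le v hv
    have h2 := h.idx_le w hw
    have h3 := h.inj v hv w hw
    split_ifs with h4 h5 h5
    · intros; omega
    · intros; omega
    · intros; omega
    · exact h3
  · intro v hv
    have := h.done v hv
    simp [hne v this, this]
  · intro v hv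
    by_cases hvx : v = x
    · subst hvx
      intro _
      rcases hxk with h1 | ⟨h1, h2, h3⟩
      · simp [h1, hk]
      · simp [h1, h2, h3, hk]
    · simp only [hvx, if_false]
      intro h0
      obtain ⟨h1, h2, h3, h4⟩ := h.lab_spec v hv h0
      simp [h1, h2, h3, h4, hne _ h3]
  · intro v hv
    by_cases hvx : v = x
    · subst hvx
      intro _
      rcases h.start hk hx with h1 | ⟨h1, h2, h3, -⟩
      · simp [h1]
      · right; simp [hne _ h1, h2, h3, h2 ▸ h1]
    · simp only [hvx, if_false]
      intro h0
      rcases h.step v hv h0 with h1 | ⟨h1, h2, h3⟩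
      · exact .inl h1
      · right; simp [hne _ h1, h1, h2, h3]
  · intro v hv
    have h0 := h.done v hv
    simp only [hne v h0, if_false]
    intro h1
    obtain ⟨h2, h3⟩ := h.closed v hv h1
    simp [hne _ h2, h2, h3]
  · intro _ hsx
    have h1 : s x ≠ x := by intro e; simp [e] at hsx
    right
    simp only [(hs x hxn).2, if_true]
    rcases hxk with h2 | ⟨h2, h3, h4⟩
    · simp [h2]
    · simp [h4, h2, h3]
  · intro _ hsx
    -- A visited cell whose predecessor `x` is unvisited must be the first cell of its cycle. Cycles
    -- begun before `k` are closed, so the walk can only have returned to `k`.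
    have hsk : s x = k := by
      by_cases h1 : s x = x
      · rcases h.start hk hx with h2 | ⟨h2, -⟩
        · rw [h1, h2]
        · exfalso
          have : p x = x := by
            have := (hs x hxn).2
            rwa [h1] at this
          rw [this] at h2; exact h2 hx
      · simp only [h1, if_false] at hsx
        have hpx := (hs x hxn).2
        rcases h.step _ (hs x hxn).1 hsx with h2 | ⟨h2, -⟩
        · obtain ⟨h3, -⟩ := h.lab_spec _ (hs x hxn).1 hsx
          rw [← h2] at h3
          rcases h3.lt_or_eq with h4 | h4
          · have := (h.closed _ h4 h2.symm).1
            rw [hpx] at this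
            exact (this hx).elim
          · exact h4
        · rw [hpx] at h2; exact (h2 hx).elim
    refine ⟨hsk, fun _ => ?_⟩
    rw [← hsk, (hs x hxn).2]
    simp

theorem LabelInv.next {n : ℕ} {p lab idx : ℕ → ℕ} {k x cnt : ℕ} (h : LabelInv n p lab idx k x cnt)
    (hk : k < n) (hx : idx x ≠ 0) : LabelInv n p lab idx (k + 1) (k + 1) cnt := by
  obtain ⟨rfl, hs⟩ := h.wrap hk hx
  refine ⟨hk, .inr rfl, h.idx_le, h.cnt_add, h.inj, ?_, ?_, h.step, ?_, fun _ _ => .inl rfl, ?_⟩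
  · intro v hv
    rcases Nat.lt_succ_iff_lt_or_eq.1 hv with h1 | rfl
    · exact h.done v h1
    · exact hx
  · intro v hv h0
    obtain ⟨h1, h2⟩ := h.lab_spec v hv h0
    exact ⟨by omega, h2⟩
  · intro v hv h0
    rcases Nat.lt_succ_iff_lt_or_eq.1 hv with h1 | rfl
    · exact h.closed v h1 h0
    · exact hs h0
  · intro h1 h2
    refine ⟨rfl, fun h3 => ?_⟩
    have := (h.lab_spec _ h1 h2).1
    omega

/-- `idx` numbers the cells along the cycles of `s`, starting with the cell `lab v` on the cycle of
`v`. -/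
structure IsNumbering (n : ℕ) (s lab idx : ℕ → ℕ) : Prop where
  lab_lt : ∀ v < n, lab v < n
  idx_pos : ∀ v < n, 1 ≤ idx v
  idx_le : ∀ v < n, idx v ≤ n
  inj : ∀ v < n, ∀ w < n, idx v = idx w → v = w
  lab_lab : ∀ v < n, lab (lab v) = lab v
  lab_apply : ∀ v < n, lab (s v) = lab v
  step : ∀ v < n, s v = lab v ∨ idx (s v) = idx v + 1

/-- Once all cells are visited, the backward statement about `p` turns into the forward one about
`s`, `closed` covering the return to the first cell of a cycle. -/
theorem LabelInv.final {n : ℕ} {s p lab idx : ℕ → ℕ} {k x cnt : ℕ}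
    (hs : ∀ v < n, s v < n ∧ p (s v) = v) (h : LabelInv n p lab idx k x cnt) (hk : n ≤ k) :
    IsNumbering n s lab idx := by
  have hd : ∀ v < n, idx v ≠ 0 := fun v hv => h.done v (by omega)
  have key : ∀ v < n, lab (s v) = lab v ∧ (s v = lab v ∨ idx (s v) = idx v + 1) := fun v hv => by
    obtain ⟨h1, h2⟩ := hs v hv
    rcases h.step _ h1 (hd _ h1) with h3 | ⟨-, h3, h4⟩
    · have := (h.closed (s v) (by omega) h3.symm).2
      rw [h2] at this
      exact ⟨by rw [← h3, this], .inl this.symm⟩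
    · rw [h2] at h3 h4
      exact ⟨h4.symm, .inr h3⟩
  have hc := h.cnt_add
  exact ⟨fun v hv => (h.lab_spec v hv (hd v hv)).2.1, fun v hv => Nat.pos_of_ne_zero (hd v hv),
    fun v hv => (h.idx_le v hv).trans (by omega), fun v hv w hw => h.inj v hv w hw (hd v hv),
    fun v hv => (h.lab_spec v hv (hd v hv)).2.2.2, fun v hv => (key v hv).1,
    fun v hv => (key v hv).2⟩

theorem exists_run_label {M n s l x : ℕ} {p : ℕ → ℕ} {ν : NState} (hν : ν.Bdd M) (hn : ν.var 0 = n)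
    (hM : 1 ≤ M) (hls : l ≠ s) (hxs : x ≠ s) (hlx : l ≠ x)
    (hs : ∀ v < n, ν.arr s v < n ∧ p (ν.arr s v) = v)
    (h0 : ∀ v < n, ν.arr x v = 0) :
    ∃ τ, Run M (label s l x) (80 * (n + 1)) ν τ ∧
      IsNumbering n (ν.arr s) (τ.arr l) (τ.arr x) := by
  have r1 : Run M (.assign 3 (.lit 0)) 2 ν (ν.setVar 3 0) :=
    run_of_ok (c := .assign 3 (.lit 0)) hν ⟨le_rfl, by positivity⟩
  have r2 : Run M (.assign 4 (.lit 0)) 2 (ν.setVar 3 0) ((ν.setVar 3 0).setVar 4 0) :=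
    run_of_ok (c := .assign 4 (.lit 0)) r1.bdd ⟨le_rfl, by positivity⟩
  have r3 : Run M (.assign 6 (.lit 0)) 2 ((ν.setVar 3 0).setVar 4 0)
      (((ν.setVar 3 0).setVar 4 0).setVar 6 0) :=
    run_of_ok (c := .assign 6 (.lit 0)) r2.bdd ⟨le_rfl, by positivity⟩
  set ν' := ((ν.setVar 3 0).setVar 4 0).setVar 6 0 with hν'
  have hcard0 : ((Finset.range n).filter fun v => ν.arr x v = 0).card = n := by
    rw [Finset.filter_true_of_mem fun v hv => h0 v (Finset.mem_range.1 hv), Finset.card_range]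
  obtain ⟨τ, hτ, hI, hq⟩ := exists_run_loop (M := M) (p := .lt (.var 3) (.var 0))
    (c := .ite (.eq (.get x (.var 4)) (.lit 0))
        (.seq (.assign 6 (.add (.var 6) (.lit 1))) (.seq (.store x (.var 4) (.var 6))
          (.seq (.store l (.var 4) (.var 3)) (.assign 4 (.get s (.var 4))))))
        (.seq (.assign 3 (.add (.var 3) (.lit 1))) (.assign 4 (.var 3))))
    (fun σ => LabelInv n p (σ.arr l) (σ.arr x) (σ.var 3) (σ.var 4) (σ.var 6))
    (fun σ => (n - σ.var 3) + ((Finset.range n).filter fun d => σ.arr x d = 0).card) r3.bdd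
    (by
      simp only [hν', NState.setVar_var, NState.setVar_arr]
      refine ⟨by simp, .inr (by simp), fun v hv => by simp [h0 v hv], by simpa using hcard0,
        fun v hv w hw h => (h (h0 v hv)).elim, by simp, fun v hv h => (h (h0 v hv)).elim,
        fun v hv h => (h (h0 v hv)).elim, by simp, fun _ _ => .inl (by simp), fun hn h => ?_⟩
      simp only [Nat.reduceEqDiff, if_false, if_true] at hn h
      exact (h (h0 0 hn)).elim)
    (by
      intro σ hσ hf hI
      have h2 : σ.var 0 = n := by
        rw [hf.var 0 (by simp [vars]), hν']; simp [NState.setVar_var, hn]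
      have ha : σ.arr s = ν.arr s := by
        rw [hf.arr s (by simp [arrs, hls.symm, hxs.symm])]; rfl
      refine ⟨by simp [Expr.Ok], fun hp' => ?_⟩
      have hk : σ.var 3 < n := by simpa [Expr.neval, h2] using hp'
      have hnM : n ≤ M := h2 ▸ hσ.1 0
      by_cases hx : σ.arr x (σ.var 4) = 0
      · obtain ⟨hI', hxn, hcn⟩ := hI.visit hs hk hx
        have hbr : (Test.eq (.get x (.var 4)) (.lit 0)).NHolds σ := hx
        set y := σ.var 4
        have e : ((Program.ite (.eq (.get x (.var 4)) (.lit 0))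
            (.seq (.assign 6 (.add (.var 6) (.lit 1))) (.seq (.store x (.var 4) (.var 6))
              (.seq (.store l (.var 4) (.var 3)) (.assign 4 (.get s (.var 4))))))
            (.seq (.assign 3 (.add (.var 3) (.lit 1))) (.assign 4 (.var 3)))).nrun σ) =
            (((σ.setVar 6 (σ.var 6 + 1)).setArr x y (σ.var 6 + 1)).setArr l y (σ.var 3)).setVar 4
              (ν.arr s y) := by
          simp only [nrun, if_pos hbr, Expr.neval]
          simp [NState.setVar_var, NState.setArr_arr, hls.symm, hxs.symm, ha, y]
        rw [e]
        have hx' : ((((σ.setVar 6 (σ.var 6 + 1)).setArr x y (σ.var 6 + 1)).setArr l y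
            (σ.var 3)).setVar 4 (ν.arr s y)).arr x =
            fun d => if d = y then σ.var 6 + 1 else σ.arr x d := by
          funext d; simp [NState.setArr_arr, hlx.symm]
        have hl' : ((((σ.setVar 6 (σ.var 6 + 1)).setArr x y (σ.var 6 + 1)).setArr l y
            (σ.var 3)).setVar 4 (ν.arr s y)).arr l =
            fun d => if d = y then σ.var 3 else σ.arr l d := by
          funext d; simp [NState.setArr_arr, hlx]
        refine ⟨?_, ?_, ?_⟩
        · simp [Ok, Test.Ok, Expr.Ok, Test.NHolds, Expr.neval, y, hx]; omega
        · simp only [hx', hl', NState.setVar_var, NState.setArr_var]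
          simpa using hI'
        · simp only [hx', NState.setVar_var, NState.setArr_var]
          have := card_filter_lt_of_update (N := n) (f := σ.arr x)
            (g := fun d => if d = y then σ.var 6 + 1 else σ.arr x d) hxn hx
            (by simp) (fun d => by split_ifs <;> simp)
          simpa using this
      · have hbr : ¬ (Test.eq (.get x (.var 4)) (.lit 0)).NHolds σ := hx
        have e : ((Program.ite (.eq (.get x (.var 4)) (.lit 0))
            (.seq (.assign 6 (.add (.var 6) (.lit 1))) (.seq (.store x (.var 4) (.var 6))
              (.seq (.store l (.var 4) (.var 3)) (.assign 4 (.get s (.var 4))))))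
            (.seq (.assign 3 (.add (.var 3) (.lit 1))) (.assign 4 (.var 3)))).nrun σ) =
            (σ.setVar 3 (σ.var 3 + 1)).setVar 4 (σ.var 3 + 1) := by
          simp only [nrun, if_neg hbr, Expr.neval]
          simp [NState.setVar_var]
        rw [e]
        refine ⟨?_, ?_, ?_⟩
        · simp [Ok, Test.Ok, Expr.Ok, Test.NHolds, Expr.neval, hx]; omega
        · have := hI.next hk hx
          simpa [NState.setVar_var] using this
        · refine Nat.add_lt_add_right (?_ : n - _ < n - _) _
          simp [NState.setVar_var]; omega)
  have hk : n ≤ τ.var 3 := by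
    have : τ.var 0 = n := by
      rw [hτ.frame.var 0 (by simp [vars]), hν']; simp [NState.setVar_var, hn]
    simpa [Expr.neval, this] using hq
  refine ⟨τ, (r1.seq (r2.seq (r3.seq hτ))).mono ?_, hI.final hs hk⟩
  have hcard : ((Finset.range n).filter fun d => ν'.arr x d = 0).card ≤ n :=
    (Finset.card_filter_le _ _).trans (by simp)
  have h3 : n - ν'.var 3 ≤ n := Nat.sub_le _ _
  simp only [Test.lt, Test.cost, Expr.cost, bound]
  omega

theorem linear_label {s l x : ℕ} (hls : l ≠ s) (hxs : x ≠ s) (hlx : l ≠ x) :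
    Linear (fun ν => (∃ p : ℕ → ℕ, ∀ v < ν.var 0, ν.arr s v < ν.var 0 ∧ p (ν.arr s v) = v) ∧
        ∀ i, ν.arr x i = 0) (label s l x)
      (fun ν τ => IsNumbering (ν.var 0) (ν.arr s) (τ.arr l) (τ.arr x) ∧
        (∀ a, a ≠ l → a ≠ x → τ.arr a = ν.arr a) ∧ ∀ i < 3, τ.var i = ν.var i) := by
  refine ⟨160, fun M ν hM hν ⟨⟨p, hs⟩, h0⟩ => ?_⟩
  obtain ⟨τ, hτ, h⟩ := exists_run_label (M := 160 * M) (hν.mono (by omega)) rfl (by omega) hls hxs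
    hlx hs fun v _ => h0 v
  refine ⟨τ, hτ.mono ?_, h, fun a h1 h2 => hτ.frame.arr a ?_, fun i hi => hτ.frame.var i ?_⟩
  · have := hν.1 0; omega
  · simp [label, arrs, h1, h2]
  · simp [label, vars]; omega

theorem linear_twoColor {a b c : ℕ} (hca : c ≠ a) (hcb : c ≠ b) :
    Linear (fun ν => IsMatching (ν.var 2) (ν.arr a) ∧ IsMatching (ν.var 2) (ν.arr b) ∧
        ∀ i, ν.arr c i = 0) (twoColor a b c)
      (fun ν τ => (∀ d < ν.var 2, (τ.arr c d = 1 ∨ τ.arr c d = 2) ∧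
          τ.arr c (ν.arr a d) ≠ τ.arr c d ∧ τ.arr c (ν.arr b d) ≠ τ.arr c d) ∧
        (∀ d, d ≠ c → τ.arr d = ν.arr d) ∧ ∀ i < 3, τ.var i = ν.var i) := by
  refine ⟨160, fun M ν hM hν ⟨ha, hb, h0⟩ => ?_⟩
  obtain ⟨τ, hτ, h⟩ := exists_run_twoColor (M := 160 * M) (hν.mono (by omega)) rfl (by omega) hca
    hcb ha hb fun v _ => h0 v
  refine ⟨τ, hτ.mono ?_, h, fun d h1 => hτ.frame.arr d ?_, fun i hi => hτ.frame.var i ?_⟩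
  · have := hν.1 2; omega
  · simp [twoColor, arrs, h1]
  · simp [twoColor, vars]; omega

end Program

end OneBendRAC

namespace OneBendRAC

open NState

/-! ### The program -/

/-- The loop counter. -/
def ctr : Expr := .var 3

def one : Expr := .lit 1

def triple (e : Expr) : Expr := .add e (.add e e)

def quad (e : Expr) : Expr := .add (.add e e) (.add e e)

def always : Test := .eq (.lit 0) (.lit 0)

def isZero (e : Expr) : Test := .eq e (.lit 0)

/-- Cell `4 * k + i`, where `k` is the loop counter. -/
def dart (i : ℤ) : Expr := .add (quad ctr) (.lit i)

namespace Stage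

/-- `a[k] := e` for all `k`. -/
def map (b a : ℕ) (e : Expr) : Stage := .puts b a [.put always ctr e]

/-- `a[k] := if p then e else f` for all `k`. -/
def select (b a : ℕ) (p : Test) (e f : Expr) : Stage :=
  .puts b a [.put p ctr e, .put (.not p) ctr f]

/-- `a[g] := e` for all `k` with `p`. -/
def send (b a : ℕ) (p : Test) (g e : Expr) : Stage := .puts b a [.put p g e]

/-- The stages computing `place`. -/
def place (lab idx inv cut other : ℕ) (rv : Test) (q f out : ℕ) : List Stage :=
  [.puts 0 q [.diff (.le (.get idx ctr) (.get idx (.get cut (.get lab ctr)))) ctr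
      (.add (.get idx ctr) (.get idx (.get inv (.get lab ctr))))
      (.get idx (.get cut (.get lab ctr))),
    .diff (.not (.le (.get idx ctr) (.get idx (.get cut (.get lab ctr))))) ctr
      (.add (.get idx ctr) (.get idx (.get lab ctr)))
      (.add (.get idx (.get cut (.get lab ctr))) one)],
   send 0 f (.lt (.get idx (.get other (.get cut (.get lab ctr)))) (.get idx (.get lab ctr))) ctr one,
   .puts 0 out [.diff rv ctr (.add (.get idx (.get lab ctr)) (.get idx (.get inv (.get lab ctr))))
      (.get idx ctr),
    .diff (.and (.not rv) (.not (isZero (.get f ctr)))) ctr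
      (.add (.get idx (.get lab ctr)) (.get idx (.get inv (.get lab ctr)))) (.get q ctr),
    .put (.and (.not rv) (isZero (.get f ctr))) ctr (.get q ctr)]]

end Stage

open Stage

/-- The two sides of `Whole` differ at the loop counter. -/
def notWhole (s t j k lab : ℕ) : Test :=
  .or (isZero (.get j (.get s ctr))) (.or (isZero (.get k ctr))
    (.ne (.get lab (.get t ctr)) (.get lab ctr)))

/-- Darts, their edges, and an involution pairing them. -/
def dartStages : List Stage :=
  [.rank 1 always (.get 0 ctr) 7 8,
   .rank 1 always (.get 1 ctr) 9 10,
   map 1 11 (.add (quad (.get 0 ctr)) (.get 8 ctr)),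
   map 1 12 (.add (quad (.get 1 ctr)) (.add (.get 7 (.get 1 ctr)) (.get 10 ctr))),
   .puts 1 13 [.put always (.get 11 ctr) (.get 12 ctr), .put always (.get 12 ctr) (.get 11 ctr)],
   .puts 1 14 [.put always (.get 11 ctr) (.add ctr one), .put always (.get 12 ctr) (.add ctr one)],
   .rank 2 (isZero (.get 14 ctr)) (.lit 0) 16 15,
   send 2 17 (isZero (.get 14 ctr)) (.get 15 ctr) ctr,
   .puts 0 18 [.put always (dart 0) (dart 1), .put always (dart 1) (dart 0),
    .put always (dart 2) (dart 3), .put always (dart 3) (dart 2)],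
   .puts 0 19 [.put always (dart 0) ctr, .put always (dart 1) ctr, .put always (dart 2) ctr,
    .put always (dart 3) ctr],
   select 2 20 (isZero (.get 14 ctr)) (.get 17 (.get 18 (.get 15 ctr))) (.get 13 ctr)]

/-- The involution pairing the darts of the same direction at each vertex. -/
def mateStages : List Stage :=
  let p : Test := .eq (.get 21 (dart 0)) (.get 21 (dart 2))
  [.puts 0 22 [.put p (dart 0) (dart 2), .put p (dart 1) (dart 3), .put p (dart 2) (dart 0),
    .put p (dart 3) (dart 1), .put (.not p) (dart 0) (dart 3), .put (.not p) (dart 1) (dart 2),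
    .put (.not p) (dart 2) (dart 1), .put (.not p) (dart 3) (dart 0)],
   map 2 23 (.get 20 (.get 22 (.get 20 ctr)))]

/-- The two factors. -/
def factorStages : List Stage :=
  let p : ℤ → Test := fun q => .and (.eq (.get 21 ctr) one) (.eq (.get 24 ctr) (.lit q))
  let o : Expr := .get 19 ctr
  let t : Expr := .get 19 (.get 20 ctr)
  [send 2 25 (p 1) o t, send 2 26 (p 2) o t, send 2 27 (p 1) t (.get 14 ctr),
   send 2 28 (p 2) t (.get 14 ctr), send 2 29 (p 1) t o, send 2 30 (p 2) t o]

/-- Exchanging the factors on the bad cycles. -/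
def swapStages : List Stage :=
  let p : Test := isZero (.get 33 (.get 31 ctr))
  [send 0 33 (notWhole 26 29 28 27 31) (.get 31 ctr) one,
   select 0 34 p (.get 26 ctr) (.get 25 ctr), select 0 35 p (.get 25 ctr) (.get 26 ctr),
   select 0 36 p (.get 30 ctr) (.get 29 ctr), select 0 37 p (.get 29 ctr) (.get 30 ctr),
   select 0 38 p (.get 28 ctr) (.get 27 ctr), select 0 39 p (.get 27 ctr) (.get 28 ctr)]

/-- Cutting the cycles of both factors. -/
def cutStages : List Stage :=
  let rv : Test := isZero (.get 48 (.get 40 ctr))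
  [send 0 44 (notWhole 34 37 38 39 40) (.get 40 ctr) one,
   send 0 45 (notWhole 34 37 38 39 40) (.get 40 ctr) ctr,
   send 0 46 (.and (.eq (.get 40 ctr) ctr) (isZero (.get 44 ctr))) ctr one,
   select 0 47 (isZero (.get 44 ctr)) ctr (.get 45 ctr),
   send 0 48 (.and (.not (isZero (.get 46 ctr)))
    (.lt (.get 41 (.get 37 ctr)) (.get 41 (.get 37 (.get 37 ctr))))) ctr one,
   select 0 49 rv (.get 36 ctr) (.get 34 ctr),
   select 0 50 rv (.get 38 ctr) (.get 38 (.get 34 ctr)),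
   send 0 51 (isZero (.get 46 ctr)) ctr (.get 39 ctr),
   send 0 52 (notWhole 35 49 51 50 42) (.get 42 ctr) ctr]

/-- Vertices and bends. -/
def drawStages : List Stage :=
  let rv : Test := .not (isZero (.get 48 (.get 40 ctr)))
  let x : Expr := .get 55 ctr
  let y : Expr := .get 58 ctr
  let xp : Expr := .get 55 (.get 49 ctr)
  let yp : Expr := .get 58 (.get 49 ctr)
  let xq : Expr := .get 55 (.get 37 ctr)
  let yq : Expr := .get 58 (.get 37 ctr)
  let k1 : Test := .not (isZero (.get 50 ctr))
  let k2 : Test := .not (isZero (.get 51 ctr))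
  let sp : Test := .not (isZero (.get 46 ctr))
  let ax : Test := .or (.eq xp (.add x one)) (.eq x (.add xp one))
  let ay : Test := .or (.eq yq (.add y one)) (.eq y (.add yq one))
  Stage.place 40 41 36 47 37 rv 53 54 55 ++ (Stage.place 42 43 37 52 49 (.not always) 56 57 58 ++
  [map 0 2 (triple x), map 0 3 (triple y),
   .puts 0 59 [.put k1 (.get 50 ctr) (triple x),
    .put (.and k2 (.and ay (.lt xq x))) (.get 51 ctr) (.add (triple xq) one),
    .diff (.and k2 (.and ay (.not (.lt xq x)))) (.get 51 ctr) (triple xq) one,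
    .put (.and k2 (.not ay)) (.get 51 ctr) (triple xq),
    .put sp (.get 39 ctr) (.add (triple x) one)],
   .puts 0 60 [.put (.and k1 (.and ax (.lt yp y))) (.get 50 ctr) (.add (triple yp) one),
    .diff (.and k1 (.and ax (.not (.lt yp y)))) (.get 50 ctr) (triple yp) one,
    .put (.and k1 (.not ax)) (.get 50 ctr) (triple yp),
    .put k2 (.get 51 ctr) (triple y),
    .put sp (.get 39 ctr) (triple yq)],
   map 1 4 one, map 1 5 (.get 59 (.add ctr one)), map 1 6 (.get 60 (.add ctr one))])

theorem wf_dartStages : Stage.wf dartStages = true := by decide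
theorem wf_mateStages : Stage.wf mateStages = true := by decide
theorem wf_factorStages : Stage.wf factorStages = true := by decide
theorem wf_swapStages : Stage.wf swapStages = true := by decide
theorem wf_cutStages : Stage.wf cutStages = true := by decide
theorem wf_drawStages : Stage.wf drawStages = true := by decide

/-- The drawing algorithm. -/
def drawProgram : Program :=
  .seq (.assign 2 (quad (.var 0))) (.seq (.stages dartStages) (.seq (.twoColor 20 18 21)
    (.seq (.stages mateStages) (.seq (.twoColor 22 23 24) (.seq (.stages factorStages)
      (.seq (.label 26 31 32) (.seq (.stages swapStages) (.seq (.label 34 40 41)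
        (.seq (.label 35 42 43) (.seq (.stages cutStages) (.stages drawStages)))))))))))

namespace Stage

variable {A : ℕ → ℕ → ℕ} {w : ℕ → ℕ} {b a : ℕ} {p : Test} {e f g : Expr}

theorem always_nholds (ν : NState) : always.NHolds ν := rfl

theorem isZero_nholds (ν : NState) : (isZero e).NHolds ν ↔ e.neval ν = 0 := Iff.rfl

@[simp] theorem ctr_neval (ν : NState) : ctr.neval ν = ν.var 3 := rfl

@[simp] theorem one_neval (ν : NState) : one.neval ν = 1 := rfl

@[simp] theorem triple_neval (ν : NState) : (triple e).neval ν = 3 * e.neval ν := by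
  simp only [triple, Expr.neval]; ring

@[simp] theorem quad_neval (ν : NState) : (quad e).neval ν = 4 * e.neval ν := by
  simp only [quad, Expr.neval]; ring

theorem dart_neval (i : ℕ) (ν : NState) : (dart i).neval ν = 4 * ν.var 3 + i := by
  simp only [dart, Expr.neval, quad_neval, ctr_neval, Int.toNat_natCast]

theorem notWhole_nholds {s t j k lab : ℕ} (ν : NState) :
    (notWhole s t j k lab).NHolds ν ↔ ¬ (ν.arr j (ν.arr s (ν.var 3)) ≠ 0 ∧ ν.arr k (ν.var 3) ≠ 0 ∧
      ν.arr lab (ν.arr t (ν.var 3)) = ν.arr lab (ν.var 3)) := by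
  simp only [notWhole, Test.or_nholds, Test.ne_nholds, isZero_nholds, Expr.neval, ctr_neval]
  tauto

theorem Post.map (h : (map b a e).Post A w) {i : ℕ} (hi : i < w b) :
    A a i = e.neval (view A i) := by
  rcases h i with ⟨-, h⟩ | ⟨j, hj, q, hq, -, h1, h2⟩
  · exact (h i hi _ (List.mem_singleton_self _) (always_nholds _) rfl).elim
  · obtain rfl := List.mem_singleton.1 hq
    obtain rfl : j = i := h1
    exact h2

open Classical in
theorem Post.select (h : (select b a p e f).Post A w) {i : ℕ} (hi : i < w b) :
    A a i = if p.NHolds (view A i) then e.neval (view A i) else f.neval (view A i) := by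
  rcases h i with ⟨-, h⟩ | ⟨j, hj, q, hq, h0, h1, h2⟩
  · by_cases hp : p.NHolds (view A i)
    · exact (h i hi (.put p ctr e) (by simp) hp rfl).elim
    · exact (h i hi (.put (.not p) ctr f) (by simp) hp rfl).elim
  · simp only [List.mem_cons, List.not_mem_nil, or_false] at hq
    rcases hq with rfl | rfl
    · obtain rfl : j = i := h1
      rw [if_pos (show p.NHolds (view A j) from h0)]; exact h2
    · obtain rfl : j = i := h1
      rw [if_neg (show ¬ p.NHolds (view A j) from h0)]; exact h2

theorem Post.send (h : (send b a p g e).Post A w) (r : ℕ) :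
    (A a r = 0 ∧ ∀ i < w b, p.NHolds (view A i) → g.neval (view A i) ≠ r) ∨
    ∃ i < w b, p.NHolds (view A i) ∧ g.neval (view A i) = r ∧ A a r = e.neval (view A i) := by
  rcases h r with ⟨h0, h⟩ | ⟨i, hi, q, hq, h0, h1, h2⟩
  · exact .inl ⟨h0, fun i hi => h i hi _ (List.mem_singleton_self _)⟩
  · obtain rfl := List.mem_singleton.1 hq
    exact .inr ⟨i, hi, h0, h1, h2⟩

open Classical in
theorem Post.send_ctr (h : (Stage.send b a p ctr e).Post A w) {i : ℕ} (hi : i < w b) :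
    A a i = if p.NHolds (view A i) then e.neval (view A i) else 0 := by
  rcases h.send i with ⟨h0, h⟩ | ⟨j, hj, h0, h1, h2⟩
  · rw [if_neg fun hp => h i hi hp rfl, h0]
  · obtain rfl : j = i := h1
    rw [if_pos h0, h2]

/-- Sending with an injective address. -/
theorem Post.send_inj (h : (Stage.send b a p g e).Post A w)
    (hg : ∀ i < w b, ∀ j < w b, p.NHolds (view A i) → p.NHolds (view A j) →
      g.neval (view A i) = g.neval (view A j) → i = j) {i : ℕ} (hi : i < w b)
    (hp : p.NHolds (view A i)) : A a (g.neval (view A i)) = e.neval (view A i) := by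
  rcases h.send (g.neval (view A i)) with ⟨-, h⟩ | ⟨j, hj, h0, h1, h2⟩
  · exact (h i hi hp rfl).elim
  · rw [h2, hg j hj i hi h0 hp h1]

end Stage

end OneBendRAC

namespace OneBendRAC

open NState Stage Program

/-! ### Darts -/

theorem tally_lt {P : ℕ → Prop} {i j : ℕ} (hi : P i) (h : i < j) : tally P i < tally P j := by
  classical
  exact Nat.count_strict_mono hi h

theorem tally_injective {P : ℕ → Prop} {i j : ℕ} (hi : P i) (hj : P j) (h : tally P i = tally P j) :
    i = j := by
  classical
  exact Nat.count_injective hi hj h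

/-- Ranks leave no gaps, so the partner rank of a free dart is again the rank of a free dart. -/
theorem exists_tally_eq {P : ℕ → Prop} {N r : ℕ} (h : r < tally P N) :
    ∃ i < N, P i ∧ tally P i = r := by
  induction N with
  | zero => simp [tally] at h
  | succ N ih =>
    rw [tally_succ] at h
    by_cases hN : r < tally P N
    · obtain ⟨i, hi, h⟩ := ih hN
      exact ⟨i, by omega, h⟩
    · split_ifs at h with hp
      · exact ⟨N, by omega, hp, by omega⟩
      · omega

/-- The darts `4 * v + i` of a list of edges with ends `U j` and `V j`: each dart belongs to the
edge number `eid d - 1`, or to none if `eid d = 0`, and `opp` pairs the darts. -/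
structure DartSpec (n m : ℕ) (U V opp eid : ℕ → ℕ) : Prop where
  matching : IsMatching (4 * n) opp
  eid_opp : ∀ d < 4 * n, eid (opp d) = eid d
  eid_le : ∀ d < 4 * n, eid d ≤ m
  ends : ∀ d < 4 * n, eid d ≠ 0 → d / 4 = U (eid d - 1) ∧ opp d / 4 = V (eid d - 1) ∨
    d / 4 = V (eid d - 1) ∧ opp d / 4 = U (eid d - 1)
  eid_inj : ∀ d < 4 * n, ∀ d' < 4 * n, eid d ≠ 0 → eid d = eid d' → d' = d ∨ d' = opp d
  eid_surj : ∀ e, e ≠ 0 → e ≤ m → ∃ d < 4 * n, eid d = e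

/-- The involution exchanging `2 * k` and `2 * k + 1`. -/
def flipBit (d : ℕ) : ℕ := if d % 2 = 0 then d + 1 else d - 1

theorem flipBit_flipBit (d : ℕ) : flipBit (flipBit d) = d := by
  unfold flipBit; split_ifs <;> omega

theorem flipBit_ne (d : ℕ) : flipBit d ≠ d := by
  unfold flipBit; split_ifs <;> omega

theorem flipBit_lt {d N : ℕ} (hN : N % 2 = 0) (h : d < N) : flipBit d < N := by
  unfold flipBit; split_ifs <;> omega

/-- An injective numbering of the darts of the edges, and a pairing of the remaining darts by their
rank. -/
theorem dartSpec_of {n m : ℕ} {U V a b opp₀ eid rk pos opp : ℕ → ℕ} (ha : ∀ j < m, a j < 4 * n)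
    (hb : ∀ j < m, b j < 4 * n) (haU : ∀ j < m, a j / 4 = U j) (hbV : ∀ j < m, b j / 4 = V j)
    (hainj : ∀ i < m, ∀ j < m, a i = a j → i = j) (hbinj : ∀ i < m, ∀ j < m, b i = b j → i = j)
    (hab : ∀ i < m, ∀ j < m, a i ≠ b j)
    (heid : ∀ d, (eid d = 0 ∧ ∀ j < m, a j ≠ d ∧ b j ≠ d) ∨
      ∃ j < m, (a j = d ∨ b j = d) ∧ eid d = j + 1)
    (hopp₀ : ∀ j < m, opp₀ (a j) = b j ∧ opp₀ (b j) = a j)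
    (hrk : ∀ d < 4 * n, eid d = 0 → rk d = tally (fun d => eid d = 0) d)
    (hpos : ∀ d < 4 * n, eid d = 0 → pos (rk d) = d)
    (hopp : ∀ d < 4 * n, opp d = if eid d = 0 then pos (flipBit (rk d)) else opp₀ d) :
    DartSpec n m U V opp eid := by
  have hea : ∀ j < m, eid (a j) = j + 1 := fun j hj => by
    rcases heid (a j) with ⟨-, h⟩ | ⟨i, hi, h | h, h'⟩
    · exact ((h j hj).1 rfl).elim
    · rw [h', hainj i hi j hj h]
    · exact (hab j hj i hi h.symm).elim
  have heb : ∀ j < m, eid (b j) = j + 1 := fun j hj => by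
    rcases heid (b j) with ⟨-, h⟩ | ⟨i, hi, h | h, h'⟩
    · exact ((h j hj).2 rfl).elim
    · exact (hab i hi j hj h).elim
    · rw [h', hbinj i hi j hj h]
  have hreal : ∀ d, eid d ≠ 0 → ∃ j < m, eid d = j + 1 ∧ (d = a j ∨ d = b j) := fun d hd => by
    rcases heid d with ⟨h, -⟩ | ⟨i, hi, h, h'⟩
    · exact (hd h).elim
    · exact ⟨i, hi, h', h.imp Eq.symm Eq.symm⟩
  have hoa : ∀ j < m, opp (a j) = b j := fun j hj => by
    rw [hopp _ (ha j hj), if_neg (by rw [hea j hj]; omega), (hopp₀ j hj).1]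
  have hob : ∀ j < m, opp (b j) = a j := fun j hj => by
    rw [hopp _ (hb j hj), if_neg (by rw [heb j hj]; omega), (hopp₀ j hj).2]
  set T := tally (fun d => eid d = 0) (4 * n) with hT
  -- The edges occupy `2 * m` of the `4 * n` darts, so an even number is free and `flipBit` is an
  -- involution of their ranks.
  have hTeven : T % 2 = 0 := by
    have h1 : T = ((Finset.range (4 * n)).filter fun d => eid d = 0).card := by
      classical
      rw [hT, tally, Nat.count_eq_card_filter_range]
      congr
    have h2 : (Finset.range (4 * n)).filter (fun d => ¬ eid d = 0) =
        (Finset.range m).image a ∪ (Finset.range m).image b := by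
      ext d
      simp only [Finset.mem_filter, Finset.mem_range, Finset.mem_union, Finset.mem_image]
      constructor
      · rintro ⟨-, h⟩
        obtain ⟨j, hj, -, h⟩ := hreal d h
        exact h.imp (fun h => ⟨j, hj, h.symm⟩) fun h => ⟨j, hj, h.symm⟩
      · rintro (⟨j, hj, rfl⟩ | ⟨j, hj, rfl⟩)
        · exact ⟨ha j hj, by rw [hea j hj]; omega⟩
        · exact ⟨hb j hj, by rw [heb j hj]; omega⟩
    have h3 : ((Finset.range (4 * n)).filter fun d => ¬ eid d = 0).card = m + m := by
      rw [h2, Finset.card_union_of_disjoint, Finset.card_image_of_injOn, Finset.card_image_of_injOn,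
        Finset.card_range]
      · intro i hi j hj h
        exact hbinj i (by simpa using hi) j (by simpa using hj) h
      · intro i hi j hj h
        exact hainj i (by simpa using hi) j (by simpa using hj) h
      · rw [Finset.disjoint_left]
        intro d h h'
        obtain ⟨i, hi, rfl⟩ := Finset.mem_image.1 h
        obtain ⟨j, hj, h⟩ := Finset.mem_image.1 h'
        exact hab i (by simpa using hi) j (by simpa using hj) h.symm
    have h4 := Finset.card_filter_add_card_filter_not (s := Finset.range (4 * n))
      (fun d => eid d = 0)
    rw [h3, Finset.card_range, ← h1] at h4
    omega
  have hpad : ∀ d < 4 * n, eid d = 0 → ∃ d' < 4 * n, eid d' = 0 ∧ rk d' = flipBit (rk d) ∧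
      opp d = d' := fun d hd h0 => by
    have h1 : rk d < T := by rw [hrk d hd h0]; exact tally_lt (P := fun d => eid d = 0) h0 hd
    obtain ⟨d', hd', h2, h3⟩ := exists_tally_eq (flipBit_lt hTeven h1)
    rw [← hrk d' hd' h2] at h3
    refine ⟨d', hd', h2, h3, ?_⟩
    rw [hopp d hd, if_pos h0, ← h3, hpos d' hd' h2]
  refine ⟨fun d hd => ?_, fun d hd => ?_, fun d hd => ?_, fun d hd h0 => ?_,
    fun d hd d' hd' h0 h => ?_, fun e he hem => ?_⟩
  · by_cases h0 : eid d = 0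
    · obtain ⟨d', hd', h1, h2, h3⟩ := hpad d hd h0
      rw [h3]
      refine ⟨hd', ?_, ?_⟩
      · rw [hopp d' hd', if_pos h1, h2, flipBit_flipBit, hpos d hd h0]
      · rintro rfl; exact flipBit_ne _ h2.symm
    · obtain ⟨j, hj, -, rfl | rfl⟩ := hreal d h0
      · rw [hoa j hj, hob j hj]; exact ⟨hb j hj, rfl, (hab j hj j hj).symm⟩
      · rw [hob j hj, hoa j hj]; exact ⟨ha j hj, rfl, hab j hj j hj⟩
  · by_cases h0 : eid d = 0
    · obtain ⟨d', hd', h1, h2, h3⟩ := hpad d hd h0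
      rw [h3, h1, h0]
    · obtain ⟨j, hj, -, rfl | rfl⟩ := hreal d h0
      · rw [hoa j hj, hea j hj, heb j hj]
      · rw [hob j hj, hea j hj, heb j hj]
  · by_cases h0 : eid d = 0
    · omega
    · obtain ⟨j, hj, h, -⟩ := hreal d h0
      omega
  · obtain ⟨j, hj, h, rfl | rfl⟩ := hreal d h0
    · left; rw [h, hoa j hj, Nat.add_sub_cancel]; exact ⟨haU j hj, hbV j hj⟩
    · right; rw [h, hob j hj, Nat.add_sub_cancel]; exact ⟨hbV j hj, haU j hj⟩
  · obtain ⟨i, hi, h1, h2⟩ := hreal d h0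
    obtain ⟨j, hj, h3, h4⟩ := hreal d' (h ▸ h0)
    obtain rfl : i = j := by omega
    rcases h2 with rfl | rfl <;> rcases h4 with rfl | rfl
    · exact .inl rfl
    · exact .inr (hoa i hi).symm
    · exact .inr (hob i hi).symm
    · exact .inl rfl
  · exact ⟨a (e - 1), ha _ (by omega), by rw [hea _ (by omega)]; omega⟩

/-- The edges with ends `U j` and `V j` are edges of a graph of maximum degree at most `4`. -/
structure IsInput (n m : ℕ) (U V : ℕ → ℕ) : Prop where
  left_lt : ∀ j < m, U j < n
  right_lt : ∀ j < m, V j < n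
  degree : ∀ v < n, tally (fun j => U j = v) m + tally (fun j => V j = v) m ≤ 4

/-- At each vertex the edges listing it as first end take the first slots, in the order of the list,
and those listing it as second end take the next ones. Maximum degree four keeps the slots below
four. Array `18` serves both as the pairing of slots within a vertex and as the pairing of ranks of
free darts. -/
theorem dartSpec_of_post {A : ℕ → ℕ → ℕ} {w : ℕ → ℕ} {n m : ℕ} (h0 : w 0 = n) (h1 : w 1 = m)
    (h2 : w 2 = 4 * n) (hI : IsInput n m (A 0) (A 1)) (h : ∀ s ∈ dartStages, s.Post A w) :
    DartSpec n m (A 0) (A 1) (A 20) (A 14) ∧ (∀ d < 4 * n, A 18 d = flipBit d) ∧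
      ∀ d < 4 * n, A 19 d = d / 4 := by
  simp only [dartStages, List.forall_mem_cons] at h
  obtain ⟨h7, h9, h11, h12, h13, h14, h15, h17, h18, h19, h20, -⟩ := h
  obtain ⟨h7, h8⟩ := h7
  obtain ⟨h9, h10⟩ := h9
  simp only [always_nholds, true_and, Expr.neval, ctr_neval, view_var, view_arr, h1,
    forall_true_left] at h7 h8 h9 h10
  have h11 : ∀ j < m, A 11 j = 4 * A 0 j + A 8 j := fun j hj => by
    simpa only [Expr.neval, quad_neval, ctr_neval, view_var, view_arr] using h11.map (h1 ▸ hj)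
  have h12 : ∀ j < m, A 12 j = 4 * A 1 j + (A 7 (A 1 j) + A 10 j) := fun j hj => by
    simpa only [Expr.neval, quad_neval, ctr_neval, view_var, view_arr] using h12.map (h1 ▸ hj)
  have h8' : ∀ j < m, A 8 j < A 7 (A 0 j) := fun j hj => by
    rw [h8 j hj, h7]; exact tally_lt (P := fun i => A 0 i = A 0 j) rfl hj
  have h10' : ∀ j < m, A 10 j < tally (fun i => A 1 i = A 1 j) m := fun j hj => by
    rw [h10 j hj]; exact tally_lt (P := fun i => A 1 i = A 1 j) rfl hj
  have hr8 : ∀ j < m, A 8 j < 4 := fun j hj => by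
    have := h8' j hj
    have := h7 (A 0 j)
    have := hI.degree _ (hI.left_lt j hj)
    omega
  have hr10 : ∀ j < m, A 7 (A 1 j) + A 10 j < 4 := fun j hj => by
    have := h10' j hj
    have := h7 (A 1 j)
    have := hI.degree _ (hI.right_lt j hj)
    omega
  have h18 : ∀ d < 4 * n, A 18 d = flipBit d := fun d hd => by
    have key : ∀ i < n, 4 * i ≤ d → d < 4 * i + 4 → A 18 d = flipBit d := fun i hi hd1 hd2 => by
      have hd4 : d = 4 * i + 0 ∨ d = 4 * i + 1 ∨ d = 4 * i + 2 ∨ d = 4 * i + 3 := by omega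
      rcases h18 d with ⟨-, h⟩ | ⟨j, hj, q, hq, -, h3, h4⟩
      · exfalso
        have h := h i (h0 ▸ hi)
        simp only [List.forall_mem_cons, Put.guard, Put.idx, always_nholds, forall_true_left] at h
        obtain ⟨k0, k1, k2, k3, -⟩ := h
        have e0 := dart_neval 0 (view A i)
        have e1 := dart_neval 1 (view A i)
        have e2 := dart_neval 2 (view A i)
        have e3 := dart_neval 3 (view A i)
        simp only [view_var, Nat.cast_zero, Nat.cast_one, Nat.cast_ofNat] at e0 e1 e2 e3
        omega
      · have e0 := dart_neval 0 (view A j)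
        have e1 := dart_neval 1 (view A j)
        have e2 := dart_neval 2 (view A j)
        have e3 := dart_neval 3 (view A j)
        simp only [view_var, Nat.cast_zero, Nat.cast_one, Nat.cast_ofNat] at e0 e1 e2 e3
        simp only [List.mem_cons, List.not_mem_nil, or_false] at hq
        unfold flipBit
        rcases hq with rfl | rfl | rfl | rfl <;> simp only [Put.idx, Put.val] at h3 h4 <;>
          split_ifs <;> omega
    exact key (d / 4) (by omega) (by omega) (by omega)
  have h19 : ∀ d < 4 * n, A 19 d = d / 4 := fun d hd => by
    have key : ∀ i < n, 4 * i ≤ d → d < 4 * i + 4 → A 19 d = d / 4 := fun i hi hd1 hd2 => by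
      have hd4 : d = 4 * i + 0 ∨ d = 4 * i + 1 ∨ d = 4 * i + 2 ∨ d = 4 * i + 3 := by omega
      rcases h19 d with ⟨-, h⟩ | ⟨j, hj, q, hq, -, h3, h4⟩
      · exfalso
        have h := h i (h0 ▸ hi)
        simp only [List.forall_mem_cons, Put.guard, Put.idx, always_nholds, forall_true_left] at h
        obtain ⟨k0, k1, k2, k3, -⟩ := h
        have e0 := dart_neval 0 (view A i)
        have e1 := dart_neval 1 (view A i)
        have e2 := dart_neval 2 (view A i)
        have e3 := dart_neval 3 (view A i)
        simp only [view_var, Nat.cast_zero, Nat.cast_one, Nat.cast_ofNat] at e0 e1 e2 e3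
        omega
      · have e0 := dart_neval 0 (view A j)
        have e1 := dart_neval 1 (view A j)
        have e2 := dart_neval 2 (view A j)
        have e3 := dart_neval 3 (view A j)
        simp only [view_var, Nat.cast_zero, Nat.cast_one, Nat.cast_ofNat] at e0 e1 e2 e3
        simp only [List.mem_cons, List.not_mem_nil, or_false] at hq
        rcases hq with rfl | rfl | rfl | rfl <;>
          simp only [Put.idx, Put.val, ctr_neval, view_var] at h3 h4 <;> omega
    exact key (d / 4) (by omega) (by omega) (by omega)
  refine ⟨?_, h18, h19⟩
  have ha : ∀ j < m, A 11 j < 4 * n := fun j hj => by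
    have := hI.left_lt j hj
    have := hr8 j hj
    rw [h11 j hj]; omega
  have hb : ∀ j < m, A 12 j < 4 * n := fun j hj => by
    have := hI.right_lt j hj
    have := hr10 j hj
    rw [h12 j hj]; omega
  have haU : ∀ j < m, A 11 j / 4 = A 0 j := fun j hj => by
    have := hr8 j hj
    rw [h11 j hj]; omega
  have hbV : ∀ j < m, A 12 j / 4 = A 1 j := fun j hj => by
    have := hr10 j hj
    rw [h12 j hj]; omega
  have hainj : ∀ i < m, ∀ j < m, A 11 i = A 11 j → i = j := fun i hi j hj h => by
    have e : A 0 i = A 0 j := by rw [← haU i hi, ← haU j hj, h]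
    have e' : A 8 i = A 8 j := by
      have := h11 i hi
      have := h11 j hj
      omega
    rw [h8 i hi, h8 j hj, e] at e'
    exact tally_injective (P := fun k => A 0 k = A 0 j) e rfl e'
  have hbinj : ∀ i < m, ∀ j < m, A 12 i = A 12 j → i = j := fun i hi j hj h => by
    have e : A 1 i = A 1 j := by rw [← hbV i hi, ← hbV j hj, h]
    have e' : A 10 i = A 10 j := by
      have := h12 i hi
      have := h12 j hj
      rw [← e] at this
      omega
    rw [h10 i hi, h10 j hj, e] at e'
    exact tally_injective (P := fun k => A 1 k = A 1 j) e rfl e'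
  have hab : ∀ i < m, ∀ j < m, A 11 i ≠ A 12 j := fun i hi j hj h => by
    have e : A 0 i = A 1 j := by rw [← haU i hi, ← hbV j hj, h]
    have h3 := h11 i hi
    have h4 := h12 j hj
    have h5 := h8' i hi
    rw [e] at h3 h5
    omega
  refine dartSpec_of (a := A 11) (b := A 12) (opp₀ := A 13) (rk := A 15) (pos := A 17) ha hb haU hbV
    hainj hbinj hab ?_ ?_ ?_ ?_ ?_
  · intro d
    rcases h14 d with ⟨h3, h4⟩ | ⟨j, hj, q, hq, -, h3, h4⟩
    · refine .inl ⟨h3, fun j hj => ?_⟩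
      have := h4 j (h1 ▸ hj)
      simpa only [List.forall_mem_cons, Put.guard, Put.idx, always_nholds, forall_true_left,
        Expr.neval, ctr_neval, view_var, view_arr, List.not_mem_nil, false_imp_iff, implies_true,
        and_true] using this
    · refine .inr ⟨j, h1 ▸ hj, ?_⟩
      simp only [List.mem_cons, List.not_mem_nil, or_false] at hq
      rcases hq with rfl | rfl
      · exact ⟨.inl h3, h4⟩
      · exact ⟨.inr h3, h4⟩
  · have key : ∀ d, (∃ j < m, A 11 j = d ∨ A 12 j = d) → ∃ j < m,
        (A 11 j = d ∧ A 13 d = A 12 j) ∨ (A 12 j = d ∧ A 13 d = A 11 j) := by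
      rintro d ⟨j, hj, hd⟩
      rcases h13 d with ⟨h3, h4⟩ | ⟨i, hi, q, hq, -, h3, h4⟩
      · exfalso
        have := h4 j (h1 ▸ hj)
        simp only [List.forall_mem_cons, Put.guard, Put.idx, always_nholds, forall_true_left,
          Expr.neval, ctr_neval, view_var, view_arr] at this
        exact hd.elim this.1 this.2.1
      · refine ⟨i, h1 ▸ hi, ?_⟩
        simp only [List.mem_cons, List.not_mem_nil, or_false] at hq
        rcases hq with rfl | rfl
        · exact .inl ⟨h3, h4⟩
        · exact .inr ⟨h3, h4⟩
    intro j hj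
    constructor
    · obtain ⟨i, hi, ⟨h3, h4⟩ | ⟨h3, h4⟩⟩ := key _ ⟨j, hj, .inl rfl⟩
      · rw [h4, hainj i hi j hj h3]
      · exact (hab j hj i hi h3.symm).elim
    · obtain ⟨i, hi, ⟨h3, h4⟩ | ⟨h3, h4⟩⟩ := key _ ⟨j, hj, .inr rfl⟩
      · exact (hab i hi j hj h3).elim
      · rw [h4, hbinj i hi j hj h3]
  · intro d hd h3
    have := h15.2 d (h2 ▸ hd) h3
    simpa only [Expr.neval, ctr_neval, view_var, view_arr, isZero_nholds, and_true] using this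
  · intro d hd h3
    have := h17.send_inj (fun i hi j hj hpi hpj hij => ?_) (h2 ▸ hd) h3
    · exact this
    · simp only [Expr.neval, ctr_neval, view_var, view_arr, isZero_nholds] at hpi hpj hij
      have h4 := h15.2 i hi hpi
      have h5 := h15.2 j hj hpj
      simp only [Expr.neval, ctr_neval, view_var, view_arr, isZero_nholds, and_true] at h4 h5
      exact tally_injective (P := fun d => A 14 d = 0) hpi hpj (by rw [← h4, ← h5, hij])
  · intro d hd
    have := h20.select (h2 ▸ hd)
    simp only [Expr.neval, ctr_neval, view_var, view_arr, isZero_nholds] at this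
    rw [this]
    by_cases h3 : A 14 d = 0
    · rw [if_pos h3, if_pos h3, h18]
      have h4 := h15.2 d (h2 ▸ hd) h3
      rw [h4]
      exact (tally_le _ _).trans_lt hd
    · rw [if_neg h3, if_neg h3]

end OneBendRAC

namespace OneBendRAC

open NState Stage Program

/-! ### The two directed 2-factors -/

/-- A colouring of the `N` cells with the colours `1` and `2` that separates the pairs of `f`. -/
def Separates (N : ℕ) (col f : ℕ → ℕ) : Prop :=
  ∀ d < N, (col d = 1 ∨ col d = 2) ∧ col (f d) ≠ col d

/-- `mate` pairs the darts at each vertex that have the same colour. -/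
structure MateSpec (n : ℕ) (col mate : ℕ → ℕ) : Prop where
  matching : IsMatching (4 * n) mate
  div_four : ∀ d < 4 * n, mate d / 4 = d / 4
  col_mate : ∀ d < 4 * n, col (mate d) = col d
  eq_or_eq : ∀ d < 4 * n, ∀ d' < 4 * n, d / 4 = d' / 4 → col d = col d' → d' = d ∨ d' = mate d

/-- The first colouring separates slots `0, 1` and slots `2, 3`, so each vertex has two darts of
either colour, and comparing slots `0` and `2` decides which ones match. -/
theorem mateSpec_of_post {A : ℕ → ℕ → ℕ} {w : ℕ → ℕ} {n : ℕ} (h0 : w 0 = n) (h2 : w 2 = 4 * n)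
    (h18 : ∀ d < 4 * n, A 18 d = flipBit d) (hcol : Separates (4 * n) (A 21) (A 18))
    (h : ∀ s ∈ mateStages, s.Post A w) :
    MateSpec n (A 21) (A 22) ∧ ∀ d < 4 * n, A 23 d = A 20 (A 22 (A 20 d)) := by
  simp only [mateStages, List.forall_mem_cons] at h
  obtain ⟨h22, h23, -⟩ := h
  have h23 : ∀ d < 4 * n, A 23 d = A 20 (A 22 (A 20 d)) := fun d hd => by
    simpa only [Expr.neval, ctr_neval, view_var, view_arr] using h23.map (h2 ▸ hd)
  refine ⟨?_, h23⟩
  have hc : ∀ v < n, ∀ c ∈ [0, 2], (A 21 (4 * v + c) = 1 ∧ A 21 (4 * v + c + 1) = 2) ∨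
      (A 21 (4 * v + c) = 2 ∧ A 21 (4 * v + c + 1) = 1) := fun v hv c hc => by
    have hc4 : c < 4 ∧ c % 2 = 0 := by
      simp only [List.mem_cons, List.not_mem_nil, or_false] at hc; omega
    have h3 := hcol (4 * v + c) (by omega)
    have h4 := hcol (4 * v + c + 1) (by omega)
    rw [h18 _ (by omega)] at h3
    have e : flipBit (4 * v + c) = 4 * v + c + 1 := by unfold flipBit; rw [if_pos (by omega)]
    rw [e] at h3
    omega
  have key : ∀ v < n,
      (A 21 (4 * v) = A 21 (4 * v + 2) ∧ A 22 (4 * v) = 4 * v + 2 ∧ A 22 (4 * v + 1) = 4 * v + 3 ∧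
        A 22 (4 * v + 2) = 4 * v ∧ A 22 (4 * v + 3) = 4 * v + 1) ∨
      (A 21 (4 * v) ≠ A 21 (4 * v + 2) ∧ A 22 (4 * v) = 4 * v + 3 ∧ A 22 (4 * v + 1) = 4 * v + 2 ∧
        A 22 (4 * v + 2) = 4 * v + 1 ∧ A 22 (4 * v + 3) = 4 * v) := fun v hv => by
    have he : ∀ j, (dart 0).neval (view A j) = 4 * j ∧ (dart 1).neval (view A j) = 4 * j + 1 ∧
        (dart 2).neval (view A j) = 4 * j + 2 ∧ (dart 3).neval (view A j) = 4 * j + 3 := fun j =>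
      ⟨dart_neval 0 (view A j), dart_neval 1 (view A j), dart_neval 2 (view A j),
        dart_neval 3 (view A j)⟩
    have hd : ∀ i < 4, (A 21 (4 * v) = A 21 (4 * v + 2) → A 22 (4 * v + i) =
          4 * v + if i = 0 then 2 else if i = 1 then 3 else if i = 2 then 0 else 1) ∧
        (A 21 (4 * v) ≠ A 21 (4 * v + 2) → A 22 (4 * v + i) =
          4 * v + if i = 0 then 3 else if i = 1 then 2 else if i = 2 then 1 else 0) := by
      intro i hi
      have hi4 : i = 0 ∨ i = 1 ∨ i = 2 ∨ i = 3 := by omega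
      rcases h22 (4 * v + i) with ⟨-, h⟩ | ⟨j, hj, q, hq, h3, h4, h5⟩
      · exfalso
        have h := h v (h0 ▸ hv)
        simp only [List.forall_mem_cons, Put.guard, Put.idx, Test.NHolds, Expr.neval, view_arr,
          he] at h
        obtain ⟨k0, k1, k2, k3, l0, l1, l2, l3, -⟩ := h
        by_cases hp : A 21 (4 * v) = A 21 (4 * v + 2)
        · have := k0 hp; have := k1 hp; have := k2 hp; have := k3 hp; omega
        · have := l0 hp; have := l1 hp; have := l2 hp; have := l3 hp; omega
      · simp only [List.mem_cons, List.not_mem_nil, or_false] at hq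
        obtain ⟨e0, e1, e2, e3⟩ := he j
        have hjv : j = v := by
          rcases hq with rfl | rfl | rfl | rfl | rfl | rfl | rfl | rfl <;>
            simp only [Put.idx] at h4 <;> omega
        subst hjv
        rcases hq with rfl | rfl | rfl | rfl | rfl | rfl | rfl | rfl <;>
          simp only [Put.idx, Put.val, Put.guard, Test.NHolds, Expr.neval, view_arr, e0, e1, e2,
            e3] at h3 h4 h5 <;>
          refine ⟨fun hp => ?_, fun hp => ?_⟩ <;>
          first
          | exact (h3 hp).elim
          | exact (hp h3).elim
          | (rw [h5]; rcases hi4 with rfl | rfl | rfl | rfl <;> first | omega | simp)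
    obtain ⟨a0, b0⟩ := hd 0 (by norm_num)
    obtain ⟨a1, b1⟩ := hd 1 (by norm_num)
    obtain ⟨a2, b2⟩ := hd 2 (by norm_num)
    obtain ⟨a3, b3⟩ := hd 3 (by norm_num)
    by_cases hp : A 21 (4 * v) = A 21 (4 * v + 2)
    · exact .inl ⟨hp, by simpa using a0 hp, by simpa using a1 hp, by simpa using a2 hp,
        by simpa using a3 hp⟩
    · exact .inr ⟨hp, by simpa using b0 hp, by simpa using b1 hp, by simpa using b2 hp,
        by simpa using b3 hp⟩
  have cases4 : ∀ d < 4 * n, ∃ v < n, d / 4 = v ∧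
      (d = 4 * v ∨ d = 4 * v + 1 ∨ d = 4 * v + 2 ∨ d = 4 * v + 3) := fun d hd =>
    ⟨d / 4, by omega, rfl, by omega⟩
  refine ⟨fun d hd => ?_, fun d hd => ?_, fun d hd => ?_, fun d hd d' hd' hv hcd => ?_⟩
  · obtain ⟨v, hv, -, hd4⟩ := cases4 d hd
    have := key v hv
    rcases hd4 with rfl | rfl | rfl | rfl <;>
      rcases this with ⟨-, k0, k1, k2, k3⟩ | ⟨-, k0, k1, k2, k3⟩ <;>
      simp only [k0, k1, k2, k3, true_and] <;> omega
  · obtain ⟨v, hv, -, hd4⟩ := cases4 d hd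
    have := key v hv
    rcases hd4 with rfl | rfl | rfl | rfl <;> omega
  · obtain ⟨v, hv, -, hd4⟩ := cases4 d hd
    have c0 := hc v hv 0 (by simp)
    have c2 := hc v hv 2 (by simp)
    simp only [Nat.add_zero, Nat.add_assoc, Nat.reduceAdd] at c0 c2
    rcases hd4 with rfl | rfl | rfl | rfl <;>
      rcases key v hv with ⟨hp, k0, k1, k2, k3⟩ | ⟨hp, k0, k1, k2, k3⟩ <;>
      simp only [k0, k1, k2, k3] <;> omega
  · obtain ⟨v, hv, e, hd4⟩ := cases4 d hd
    obtain ⟨v', hv', e', hd4'⟩ := cases4 d' hd'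
    obtain rfl : v = v' := by omega
    have c0 := hc v hv 0 (by simp)
    have c2 := hc v hv 2 (by simp)
    simp only [Nat.add_zero, Nat.add_assoc, Nat.reduceAdd] at c0 c2
    clear e e' hv
    rcases hd4 with rfl | rfl | rfl | rfl <;> rcases hd4' with rfl | rfl | rfl | rfl <;>
      rcases key v hv' with ⟨hp, k0, k1, k2, k3⟩ | ⟨hp, k0, k1, k2, k3⟩ <;>
      simp only [k0, k1, k2, k3, true_or, or_true] <;> omega

/-- A permutation `s` with inverse `p` such that `j v ≠ 0` is the number of an edge from `p v` to
`v`. -/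
structure FactorSpec (n m : ℕ) (U V s p j : ℕ → ℕ) : Prop where
  s_lt : ∀ v < n, s v < n
  p_lt : ∀ v < n, p v < n
  p_s : ∀ v < n, p (s v) = v
  s_p : ∀ v < n, s (p v) = v
  j_le : ∀ v < n, j v ≤ m
  ends : ∀ v < n, j v ≠ 0 →
    p v = U (j v - 1) ∧ v = V (j v - 1) ∨ p v = V (j v - 1) ∧ v = U (j v - 1)
  inj : ∀ u < n, ∀ v < n, j u ≠ 0 → j u = j v → u = v

section

variable {n m : ℕ} {U V opp eid col mate c₂ : ℕ → ℕ}

/-- Colour `1` marks outgoing darts. The two outgoing darts of a vertex are mates, and mates differ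
in the second colour. -/
theorem eq_of_div_four (hM : MateSpec n col mate) (hc₂ : Separates (4 * n) c₂ mate) {d d' : ℕ}
    (hd : d < 4 * n) (hd' : d' < 4 * n) (h : d / 4 = d' / 4) (h1 : col d = 1) (h2 : col d' = 1)
    (h3 : c₂ d = c₂ d') : d = d' := by
  rcases hM.eq_or_eq d hd d' hd' h (h1.trans h2.symm) with e | e
  · exact e.symm
  · exact ((hc₂ d hd).2 (by rw [← e, h3])).elim

/-- The same for incoming edges: their far ends are exchanged by `mate` conjugated with `opp`, the
second matching of the second colouring. The two statements together make the second colouring split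
the oriented edges into two permutations. -/
theorem eq_of_opp_div_four (hD : IsMatching (4 * n) opp) (hcol : Separates (4 * n) col opp)
    (hM : MateSpec n col mate) (hc₂ : Separates (4 * n) c₂ fun d => opp (mate (opp d))) {d d' : ℕ}
    (hd : d < 4 * n) (hd' : d' < 4 * n) (h : opp d / 4 = opp d' / 4) (h1 : col d = 1)
    (h2 : col d' = 1) (h3 : c₂ d = c₂ d') : d = d' := by
  obtain ⟨a1, a2, -⟩ := hD d hd
  obtain ⟨b1, b2, -⟩ := hD d' hd'
  have e1 := (hcol _ a1).1
  have e2 := (hcol _ b1).1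
  have e3 := (hcol _ hd).2
  have e4 := (hcol _ hd').2
  rcases hM.eq_or_eq _ a1 _ b1 h (by omega) with e | e
  · rw [← a2, ← b2, e]
  · refine ((hc₂ d hd).2 ?_).elim
    dsimp only
    rw [← e, b2, h3]

/-- One of the first two slots is outgoing, and if it has the wrong second colour then its mate has
the right one. -/
theorem exists_out (hM : MateSpec n col mate) (hcol : Separates (4 * n) col flipBit)
    (hc₂ : Separates (4 * n) c₂ mate) {v q : ℕ} (hv : v < n) (hq : q = 1 ∨ q = 2) :
    ∃ d < 4 * n, d / 4 = v ∧ col d = 1 ∧ c₂ d = q := by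
  have e : flipBit (4 * v) = 4 * v + 1 := by unfold flipBit; rw [if_pos (by omega)]
  have h0 := hcol (4 * v) (by omega)
  have h1 := hcol (4 * v + 1) (by omega)
  rw [e] at h0
  obtain ⟨d, hd, hdv, hd1⟩ : ∃ d < 4 * n, d / 4 = v ∧ col d = 1 := by
    by_cases h : col (4 * v) = 1
    · exact ⟨4 * v, by omega, by omega, h⟩
    · exact ⟨4 * v + 1, by omega, by omega, by omega⟩
  by_cases h : c₂ d = q
  · exact ⟨d, hd, hdv, hd1, h⟩
  · have h2 := hc₂ d hd
    have h3 := (hc₂ _ (hM.matching d hd).1).1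
    exact ⟨mate d, (hM.matching d hd).1, by rw [hM.div_four d hd, hdv],
      by rw [hM.col_mate d hd, hd1], by omega⟩

theorem exists_in (hD : IsMatching (4 * n) opp) (hcolo : Separates (4 * n) col opp)
    (hM : MateSpec n col mate) (hcol : Separates (4 * n) col flipBit)
    (hc₂ : Separates (4 * n) c₂ fun d => opp (mate (opp d))) {v q : ℕ} (hv : v < n)
    (hq : q = 1 ∨ q = 2) : ∃ d < 4 * n, opp d / 4 = v ∧ col d = 1 ∧ c₂ d = q := by
  have e : flipBit (4 * v) = 4 * v + 1 := by unfold flipBit; rw [if_pos (by omega)]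
  have h0 := hcol (4 * v) (by omega)
  have h1 := hcol (4 * v + 1) (by omega)
  rw [e] at h0
  obtain ⟨d, hd, hdv, hd1⟩ : ∃ d < 4 * n, d / 4 = v ∧ col d = 2 := by
    by_cases h : col (4 * v) = 2
    · exact ⟨4 * v, by omega, by omega, h⟩
    · exact ⟨4 * v + 1, by omega, by omega, by omega⟩
  have hopp : ∀ d < 4 * n, col d = 2 → col (opp d) = 1 := fun d hd h => by
    have h2 := (hcolo d hd).2
    have h3 := (hcolo _ (hD d hd).1).1
    omega
  by_cases h : c₂ (opp d) = q
  · exact ⟨opp d, (hD d hd).1, by rw [(hD d hd).2.1, hdv], hopp d hd hd1, h⟩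
  · have hm := (hM.matching d hd).1
    have h2 := hc₂ _ (hD d hd).1
    have h3 := (hc₂ _ (hD _ hm).1).1
    dsimp only at h2
    rw [(hD d hd).2.1] at h2
    exact ⟨opp (mate d), (hD _ hm).1, by rw [(hD _ hm).2.1, hM.div_four d hd, hdv],
      hopp _ hm (by rw [hM.col_mate d hd, hd1]), by omega⟩

/-- The darts of colour `1` and second colour `q` form a directed 2-factor. -/
theorem factorSpec_of (hD : DartSpec n m U V opp eid) (hcolo : Separates (4 * n) col opp)
    (hcol : Separates (4 * n) col flipBit) (hM : MateSpec n col mate)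
    (hc₂ : Separates (4 * n) c₂ mate) (hc₂' : Separates (4 * n) c₂ fun d => opp (mate (opp d)))
    {q : ℕ} (hq : q = 1 ∨ q = 2) {s p j : ℕ → ℕ}
    (hs : ∀ d < 4 * n, col d = 1 → c₂ d = q → s (d / 4) = opp d / 4)
    (hp : ∀ d < 4 * n, col d = 1 → c₂ d = q → p (opp d / 4) = d / 4)
    (hj : ∀ d < 4 * n, col d = 1 → c₂ d = q → j (opp d / 4) = eid d) :
    FactorSpec n m U V s p j := by
  have hout := fun v (hv : v < n) => exists_out hM hcol hc₂ hv hq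
  have hin := fun v (hv : v < n) => exists_in hD.matching hcolo hM hcol hc₂' hv hq
  refine ⟨fun v hv => ?_, fun v hv => ?_, fun v hv => ?_, fun v hv => ?_, fun v hv => ?_,
    fun v hv h0 => ?_, fun u hu v hv h0 h => ?_⟩
  · obtain ⟨d, hd, rfl, h1, h2⟩ := hout v hv
    have := (hD.matching d hd).1
    rw [hs d hd h1 h2]; omega
  · obtain ⟨d, hd, rfl, h1, h2⟩ := hin v hv
    rw [hp d hd h1 h2]; omega
  · obtain ⟨d, hd, rfl, h1, h2⟩ := hout v hv
    rw [hs d hd h1 h2, hp d hd h1 h2]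
  · obtain ⟨d, hd, rfl, h1, h2⟩ := hin v hv
    rw [hp d hd h1 h2, hs d hd h1 h2]
  · obtain ⟨d, hd, rfl, h1, h2⟩ := hin v hv
    rw [hj d hd h1 h2]; exact hD.eid_le d hd
  · obtain ⟨d, hd, rfl, h1, h2⟩ := hin v hv
    rw [hj d hd h1 h2] at h0 ⊢
    rw [hp d hd h1 h2]
    exact hD.ends d hd h0
  · obtain ⟨d, hd, rfl, h1, h2⟩ := hin u hu
    obtain ⟨d', hd', rfl, h1', h2'⟩ := hin v hv
    rw [hj d hd h1 h2] at h0 h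
    rw [hj d' hd' h1' h2'] at h
    rcases hD.eid_inj d hd d' hd' h0 h with e | e
    · rw [e]
    · exact ((hcolo d hd).2 (by rw [← e, h1, h1'])).elim

end

/-- Two directed 2-factors which together contain every edge once. -/
structure FactorsSpec (n m : ℕ) (U V s₁ p₁ j₁ s₂ p₂ j₂ : ℕ → ℕ) : Prop where
  left : FactorSpec n m U V s₁ p₁ j₁
  right : FactorSpec n m U V s₂ p₂ j₂
  disj : ∀ u < n, ∀ v < n, j₁ u ≠ 0 → j₁ u ≠ j₂ v
  surj : ∀ e, e ≠ 0 → e ≤ m → (∃ v < n, j₁ v = e) ∨ ∃ v < n, j₂ v = e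

/-- Each oriented edge of a given second colour writes to its tail and to its head; uniqueness of
such an edge at a vertex means that no cell is overwritten by another edge. -/
theorem factorsSpec_of_post {A : ℕ → ℕ → ℕ} {w : ℕ → ℕ} {n m : ℕ} (h2 : w 2 = 4 * n)
    (hD : DartSpec n m (A 0) (A 1) (A 20) (A 14)) (h19 : ∀ d < 4 * n, A 19 d = d / 4)
    (hcolo : Separates (4 * n) (A 21) (A 20)) (hcol : Separates (4 * n) (A 21) flipBit)
    (hM : MateSpec n (A 21) (A 22)) (hc₂ : Separates (4 * n) (A 24) (A 22))
    (hc₂' : Separates (4 * n) (A 24) fun d => A 20 (A 22 (A 20 d)))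
    (h : ∀ s ∈ factorStages, s.Post A w) :
    FactorsSpec n m (A 0) (A 1) (A 25) (A 29) (A 27) (A 26) (A 30) (A 28) := by
  simp only [factorStages, List.forall_mem_cons] at h
  obtain ⟨h25, h26, h27, h28, h29, h30, -⟩ := h
  have hguard : ∀ q : ℕ, ∀ i, (Test.and (.eq (.get 21 ctr) one)
      (.eq (.get 24 ctr) (.lit (q : ℤ)))).NHolds (view A i) ↔ A 21 i = 1 ∧ A 24 i = q := fun q i => by
    simp only [Test.NHolds, Expr.neval, ctr_neval, one_neval, view_var, view_arr, Int.toNat_natCast]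
  have e19 : ∀ d < 4 * n, A 19 (A 20 d) = A 20 d / 4 := fun d hd => h19 _ (hD.matching d hd).1
  have push : ∀ (q : ℕ) (a : ℕ) (e : Expr), (send 2 a (.and (.eq (.get 21 ctr) one)
      (.eq (.get 24 ctr) (.lit (q : ℤ)))) (.get 19 (.get 20 ctr)) e).Post A w → ∀ d < 4 * n,
      A 21 d = 1 → A 24 d = q → A a (A 20 d / 4) = e.neval (view A d) := by
    intro q a e hpost d hd h3 h4
    have := hpost.send_inj (fun i hi j hj hpi hpj hij => ?_) (h2 ▸ hd) ((hguard q d).2 ⟨h3, h4⟩)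
    · simpa only [Expr.neval, ctr_neval, view_var, view_arr, e19 d hd] using this
    · obtain ⟨a1, a2⟩ := (hguard q i).1 hpi
      obtain ⟨b1, b2⟩ := (hguard q j).1 hpj
      rw [h2] at hi hj
      simp only [Expr.neval, ctr_neval, view_var, view_arr, e19 i hi, e19 j hj] at hij
      exact eq_of_opp_div_four hD.matching hcolo hM hc₂' hi hj hij a1 b1 (a2.trans b2.symm)
  have push' : ∀ (q : ℕ) (a : ℕ), (send 2 a (.and (.eq (.get 21 ctr) one)
      (.eq (.get 24 ctr) (.lit (q : ℤ)))) (.get 19 ctr) (.get 19 (.get 20 ctr))).Post A w →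
      ∀ d < 4 * n, A 21 d = 1 → A 24 d = q → A a (d / 4) = A 20 d / 4 := by
    intro q a hpost d hd h3 h4
    have := hpost.send_inj (fun i hi j hj hpi hpj hij => ?_) (h2 ▸ hd) ((hguard q d).2 ⟨h3, h4⟩)
    · simpa only [Expr.neval, ctr_neval, view_var, view_arr, e19 d hd, h19 d hd] using this
    · obtain ⟨a1, a2⟩ := (hguard q i).1 hpi
      obtain ⟨b1, b2⟩ := (hguard q j).1 hpj
      rw [h2] at hi hj
      simp only [Expr.neval, ctr_neval, view_var, view_arr, h19 i hi, h19 j hj] at hij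
      exact eq_of_div_four hM hc₂ hi hj hij a1 b1 (a2.trans b2.symm)
  have t1 : ∀ d < 4 * n, A 21 d = 1 → A 24 d = 1 → A 27 (A 20 d / 4) = A 14 d :=
    fun d hd h3 h4 => push 1 27 _ h27 d hd h3 h4
  have t2 : ∀ d < 4 * n, A 21 d = 1 → A 24 d = 2 → A 28 (A 20 d / 4) = A 14 d :=
    fun d hd h3 h4 => push 2 28 _ h28 d hd h3 h4
  refine ⟨?_, ?_, ?_, ?_⟩
  · refine factorSpec_of hD hcolo hcol hM hc₂ hc₂' (.inl rfl) (push' 1 25 h25) ?_ t1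
    intro d hd h3 h4
    rw [← h19 d hd]; exact push 1 29 _ h29 d hd h3 h4
  · refine factorSpec_of hD hcolo hcol hM hc₂ hc₂' (.inr rfl) (push' 2 26 h26) ?_ t2
    intro d hd h3 h4
    rw [← h19 d hd]; exact push 2 30 _ h30 d hd h3 h4
  · intro u hu v hv h0 h
    obtain ⟨d, hd, rfl, h3, h4⟩ := exists_in hD.matching hcolo hM hcol hc₂' hu (.inl rfl)
    obtain ⟨d', hd', rfl, h3', h4'⟩ := exists_in hD.matching hcolo hM hcol hc₂' hv (.inr rfl)
    rw [t1 d hd h3 h4] at h0 h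
    rw [t2 d' hd' h3' h4'] at h
    rcases hD.eid_inj d hd d' hd' h0 h with rfl | rfl
    · omega
    · exact (hcolo d hd).2 (by rw [h3, h3'])
  · intro e he hem
    obtain ⟨d, hd, rfl⟩ := hD.eid_surj e he hem
    -- Of the two darts of an edge exactly the outgoing one represents it in a factor, and its
    -- second colour says in which.
    obtain ⟨d', hd', h3, h4⟩ : ∃ d' < 4 * n, A 14 d' = A 14 d ∧ A 21 d' = 1 := by
      by_cases hc : A 21 d = 1
      · exact ⟨d, hd, rfl, hc⟩
      · have h5 := hcolo d hd
        have h6 := (hcolo _ (hD.matching d hd).1).1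
        exact ⟨A 20 d, (hD.matching d hd).1, hD.eid_opp d hd, by omega⟩
    have hlt : A 20 d' / 4 < n := by
      have := (hD.matching d' hd').1
      omega
    rcases (hc₂ d' hd').1 with h5 | h5
    · exact .inl ⟨_, hlt, by rw [t1 d' hd' h4 h5, h3]⟩
    · exact .inr ⟨_, hlt, by rw [t2 d' hd' h4 h5, h3]⟩

end OneBendRAC

namespace OneBendRAC

open NState Stage Program Equiv

/-! ### From arrays to permutations -/

namespace FactorSpec

variable {n m : ℕ} {U V s p j : ℕ → ℕ}

/-- The permutation of the vertices. -/
def perm (h : FactorSpec n m U V s p j) : Perm (Fin n) where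
  toFun v := ⟨s v, h.s_lt v v.2⟩
  invFun v := ⟨p v, h.p_lt v v.2⟩
  left_inv v := Fin.ext (h.p_s v v.2)
  right_inv v := Fin.ext (h.s_p v v.2)

theorem perm_val (h : FactorSpec n m U V s p j) (v : Fin n) : (h.perm v : ℕ) = s v := rfl

theorem perm_inv_val (h : FactorSpec n m U V s p j) (v : Fin n) : (h.perm⁻¹ v : ℕ) = p v := rfl

end FactorSpec

namespace Program.IsNumbering

variable {n : ℕ} {s lab idx : ℕ → ℕ}

/-- The label of a vertex as a vertex. -/
def rep (h : IsNumbering n s lab idx) (v : Fin n) : Fin n := ⟨lab v, h.lab_lt v v.2⟩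

theorem isLabel (h : IsNumbering n s lab idx) {S : Perm (Fin n)} (hS : ∀ v, (S v : ℕ) = s v) :
    IsLabel S h.rep fun v => idx v where
  inj u v huv := Fin.ext (h.inj u u.2 v v.2 huv)
  lab_lab v := Fin.ext (h.lab_lab v v.2)
  lab_apply v := Fin.ext (by change lab (S v) = lab v; rw [hS]; exact h.lab_apply v v.2)
  step v := by
    rcases h.step v v.2 with h | h
    · exact .inl (Fin.ext ((hS v).trans h))
    · exact .inr (by rw [hS]; exact h)

end Program.IsNumbering

/-- Used three times: to detect exchanges, and to cut the cycles of either factor. -/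
theorem whole_iff {n : ℕ} {A : ℕ → ℕ → ℕ} {s t : Perm (Fin n)} {j k : Fin n → ℕ}
    {lab : Fin n → Fin n} {as at' aj ak al : ℕ} (hs : ∀ v, (s v : ℕ) = A as v)
    (ht : ∀ v, (t⁻¹ v : ℕ) = A at' v) (hj : ∀ v, j v = A aj v) (hk : ∀ v, k v = A ak v)
    (hl : ∀ v, (lab v : ℕ) = A al v) (u : Fin n) :
    Whole s t j k lab u ↔ ¬ (notWhole as at' aj ak al).NHolds (view A u) := by
  rw [notWhole_nholds, not_not, Whole, Fin.ext_iff, hj, hk, hl, hl, hs, ht]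
  rfl

theorem Stage.Post.send_one {A : ℕ → ℕ → ℕ} {w : ℕ → ℕ} {b a : ℕ} {p : Test} {g : Expr}
    (h : (Stage.send b a p g one).Post A w) (r : ℕ) :
    A a r = 0 ↔ ∀ i < w b, g.neval (view A i) = r → ¬ p.NHolds (view A i) := by
  rcases h.send r with ⟨h0, h⟩ | ⟨i, hi, h0, h1, h2⟩
  · exact iff_of_true h0 fun i hi hg hp => h i hi hp hg
  · refine iff_of_false (by rw [h2]; exact Nat.one_ne_zero) fun h => h i hi h1 h0

theorem exists_inverse {n : ℕ} {f : ℕ → ℕ} {S : Perm (Fin n)} (hS : ∀ v, (S v : ℕ) = f v) :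
    ∃ p : ℕ → ℕ, ∀ v < n, f v < n ∧ p (f v) = v := by
  refine ⟨fun v => if h : v < n then (S⁻¹ ⟨v, h⟩ : ℕ) else 0, fun v hv => ?_⟩
  have h1 := hS ⟨v, hv⟩
  have h2 : f v < n := h1 ▸ (S ⟨v, hv⟩).2
  refine ⟨h2, ?_⟩
  have e : (⟨f v, h2⟩ : Fin n) = S ⟨v, hv⟩ := Fin.ext h1.symm
  simp only [dif_pos h2]
  rw [e, perm_inv_apply]

/-- The permutations after exchanging the factors on the bad cycles. -/
theorem exists_swap {A : ℕ → ℕ → ℕ} {w : ℕ → ℕ} {n m : ℕ} {U V : ℕ → ℕ} (h0 : w 0 = n)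
    (hF : FactorsSpec n m U V (A 25) (A 29) (A 27) (A 26) (A 30) (A 28))
    (hL : IsNumbering n (A 26) (A 31) (A 32)) (h : ∀ s ∈ swapStages, s.Post A w) :
    (∀ v, A 33 (hL.rep v) = 0 ↔ ∀ u, hL.rep u = hL.rep v →
      Whole hF.right.perm hF.left.perm (fun v => A 28 v) (fun v => A 27 v) hL.rep u) ∧
    (∃ S₁ : Perm (Fin n),
      (∀ v, S₁ v = if A 33 (hL.rep v) = 0 then hF.right.perm v else hF.left.perm v) ∧
      (∀ v, S₁⁻¹ v = if A 33 (hL.rep v) = 0 then hF.right.perm⁻¹ v else hF.left.perm⁻¹ v) ∧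
      (∀ v, (S₁ v : ℕ) = A 34 v) ∧ ∀ v, (S₁⁻¹ v : ℕ) = A 36 v) ∧
    (∃ S₂ : Perm (Fin n),
      (∀ v, S₂ v = if A 33 (hL.rep v) = 0 then hF.left.perm v else hF.right.perm v) ∧
      (∀ v, S₂⁻¹ v = if A 33 (hL.rep v) = 0 then hF.left.perm⁻¹ v else hF.right.perm⁻¹ v) ∧
      (∀ v, (S₂ v : ℕ) = A 35 v) ∧ ∀ v, (S₂⁻¹ v : ℕ) = A 37 v) ∧
    (∀ v : Fin n, A 38 v = if A 33 (hL.rep v) = 0 then A 28 v else A 27 v) ∧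
    ∀ v : Fin n, A 39 v = if A 33 (hL.rep v) = 0 then A 27 v else A 28 v := by
  simp only [swapStages, List.forall_mem_cons] at h
  obtain ⟨h33, h34, h35, h36, h37, h38, h39, -⟩ := h
  have hw := whole_iff (A := A) (at' := 29) (aj := 28) (ak := 27) (al := 31) (lab := hL.rep)
    hF.right.perm_val hF.left.perm_inv_val (fun _ => rfl) (fun _ => rfl) (fun _ => rfl)
  have hbad : ∀ v, A 33 (hL.rep v) = 0 ↔ ∀ u, hL.rep u = hL.rep v →
      Whole hF.right.perm hF.left.perm (fun v => A 28 v) (fun v => A 27 v) hL.rep u := by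
    intro v
    rw [h33.send_one]
    constructor
    · intro h u hu
      exact (hw u).2 (h u (h0 ▸ u.2) (congrArg Fin.val hu))
    · intro h i hi hiv
      rw [h0] at hi
      exact (hw ⟨i, hi⟩).1 (h ⟨i, hi⟩ (Fin.ext hiv))
  have hsel : ∀ a e f, (select 0 a (isZero (.get 33 (.get 31 ctr))) (.get e ctr)
      (.get f ctr)).Post A w → ∀ v : Fin n, A a v = if A 33 (hL.rep v) = 0 then A e v else A f v := by
    intro a e f hp v
    have := hp.select (i := v) (h0 ▸ v.2)
    simp only [Expr.neval, ctr_neval, view_var, view_arr, isZero_nholds] at this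
    rw [this]; congr
  have hclosed : ∀ v, A 33 (hL.rep v) = 0 → hL.rep (hF.right.perm v) = hL.rep v ∧
      hL.rep (hF.left.perm v) = hL.rep v := fun v hv =>
    have H := Whole.closed ((hbad v).1 hv) v
    ⟨(hL.isLabel hF.right.perm_val).lab_apply v, H.2.2 rfl⟩
  have hc1 : ∀ v, A 33 (hL.rep v) = 0 → A 33 (hL.rep (hF.right.perm v)) = 0 := fun v hv => by
    rw [(hclosed v hv).1, hv]
  have hc2 : ∀ v, A 33 (hL.rep v) = 0 → A 33 (hL.rep (hF.left.perm v)) = 0 := fun v hv => by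
    rw [(hclosed v hv).2, hv]
  refine ⟨hbad, ?_, ?_, hsel _ _ _ h38, hsel _ _ _ h39⟩
  · obtain ⟨S, hS, hS', -⟩ := exists_blend hF.right.perm hF.left.perm
      (fun v => A 33 (hL.rep v) = 0) hc1 hc2
    refine ⟨S, fun v => (hS v).trans (by congr), fun v => (hS' v).trans (by congr), fun v => ?_,
      fun v => ?_⟩
    · rw [hsel _ _ _ h34, hS]; split_ifs <;> rfl
    · rw [hsel _ _ _ h36, hS']; split_ifs <;> rfl
  · obtain ⟨S, hS, hS', -⟩ := exists_blend hF.left.perm hF.right.perm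
      (fun v => A 33 (hL.rep v) = 0) hc2 hc1
    refine ⟨S, fun v => (hS v).trans (by congr), fun v => (hS' v).trans (by congr), fun v => ?_,
      fun v => ?_⟩
    · rw [hsel _ _ _ h35, hS]; split_ifs <;> rfl
    · rw [hsel _ _ _ h37, hS']; split_ifs <;> rfl

/-! ### Execution of the program -/

namespace Program

theorem Linear.then {I J K : NState → Prop} {c d : Program} (hc : Linear I c fun _ => J)
    (hd : Linear J d fun _ => K) : Linear I (.seq c d) fun _ => K :=
  hc.seq hd (fun _ _ _ h => h) fun _ _ _ _ _ h => h

end Program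

/-- The arrays above `k` and the output arrays have not been written. -/
def Clean (k : ℕ) (ν : NState) : Prop := ∀ a, (k < a ∨ 2 ≤ a ∧ a ≤ 6) → ∀ i, ν.arr a i = 0

/-- `Prepared`, …, `Drawn` are the assertions between consecutive phases of `drawProgram`; each
keeps whatever later phases or the final correctness argument still need. -/
structure Prepared (ν : NState) : Prop where
  isInput : IsInput (ν.var 0) (ν.var 1) (ν.arr 0) (ν.arr 1)
  var_two : ν.var 2 = 4 * ν.var 0

structure Paired (ν : NState) : Prop where
  var_two : ν.var 2 = 4 * ν.var 0
  darts : DartSpec (ν.var 0) (ν.var 1) (ν.arr 0) (ν.arr 1) (ν.arr 20) (ν.arr 14)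
  flip : ∀ d < 4 * ν.var 0, ν.arr 18 d = flipBit d
  own : ∀ d < 4 * ν.var 0, ν.arr 19 d = d / 4

structure Directed (ν : NState) : Prop extends Paired ν where
  opp : Separates (4 * ν.var 0) (ν.arr 21) (ν.arr 20)
  turn : Separates (4 * ν.var 0) (ν.arr 21) (ν.arr 18)

structure Mated (ν : NState) : Prop extends Directed ν where
  mate : MateSpec (ν.var 0) (ν.arr 21) (ν.arr 22)
  conj : ∀ d < 4 * ν.var 0, ν.arr 23 d = ν.arr 20 (ν.arr 22 (ν.arr 20 d))

structure Split (ν : NState) : Prop extends Mated ν where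
  left : Separates (4 * ν.var 0) (ν.arr 24) (ν.arr 22)
  right : Separates (4 * ν.var 0) (ν.arr 24) (ν.arr 23)

def Factored (ν : NState) : Prop :=
  FactorsSpec (ν.var 0) (ν.var 1) (ν.arr 0) (ν.arr 1) (ν.arr 25) (ν.arr 29) (ν.arr 27) (ν.arr 26)
    (ν.arr 30) (ν.arr 28)

structure Labelled (ν : NState) : Prop where
  factors : Factored ν
  label : IsNumbering (ν.var 0) (ν.arr 26) (ν.arr 31) (ν.arr 32)

structure Swapped (ν : NState) : Prop extends Labelled ν where
  swap : ∀ s ∈ swapStages, s.Post ν.arr ν.var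

structure LabelledOnce (ν : NState) : Prop extends Swapped ν where
  label₁ : IsNumbering (ν.var 0) (ν.arr 34) (ν.arr 40) (ν.arr 41)

structure LabelledTwice (ν : NState) : Prop extends LabelledOnce ν where
  label₂ : IsNumbering (ν.var 0) (ν.arr 35) (ν.arr 42) (ν.arr 43)

structure Cut (ν : NState) : Prop extends LabelledTwice ν where
  cut : ∀ s ∈ cutStages, s.Post ν.arr ν.var

structure Drawn (ν : NState) : Prop extends Cut ν where
  draw : ∀ s ∈ drawStages, s.Post ν.arr ν.var

/-- The arrays that matter to a list of stages are at most `k`. -/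
def Stage.below (k : ℕ) (l : List Stage) : Bool :=
  l.all fun s => s.plain && (decide (s.limit ≤ 2) &&
    (s.writes ++ s.reads).all fun a => decide (a ≤ k ∧ ¬ (2 ≤ a ∧ a ≤ 6)))

/-- Old arrays and the first variables are unchanged. -/
structure Keeps (k : ℕ) (ν τ : NState) : Prop where
  arr : ∀ a, a ≤ k ∧ ¬ (2 ≤ a ∧ a ≤ 6) → τ.arr a = ν.arr a
  var : ∀ x ≤ 2, τ.var x = ν.var x

theorem Keeps.post {k : ℕ} {ν τ : NState} (h : Keeps k ν τ) {l : List Stage}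
    (hl : Stage.below k l = true) (hp : ∀ s ∈ l, s.Post ν.arr ν.var) :
    ∀ s ∈ l, s.Post τ.arr τ.var := by
  intro s hs
  simp only [Stage.below, List.all_eq_true, Bool.and_eq_true, decide_eq_true_eq] at hl
  obtain ⟨h1, h2, h3⟩ := hl s hs
  exact (hp s hs).congr h1 (fun a ha => (h.arr a (h3 a ha)).symm) (h.var _ h2).symm

/-- The stages write arrays above `k` up to `k'` only. -/
def Stage.between (k k' : ℕ) (l : List Stage) : Bool :=
  l.all fun s => s.writes.all fun a => decide (k < a ∧ a ≤ k' ∧ 6 < a)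

theorem linear_stages_step {I J : NState → Prop} {k k' : ℕ} {l : List Stage}
    (hwf : Stage.wf l = true) (hb : Stage.between k k' l = true) (hk : k ≤ k')
    (hJ : ∀ ν τ, I ν → Keeps k ν τ → (∀ s ∈ l, s.Post τ.arr τ.var) → J τ) :
    Linear (fun ν => Clean k ν ∧ I ν) (stages l) fun _ τ => Clean k' τ ∧ J τ := by
  simp only [Stage.between, List.all_eq_true, decide_eq_true_eq] at hb
  refine (linear_stages hwf).mono (fun ν h s hs a ha => h.1 a (.inl (hb s hs a ha).1)) ?_
  rintro ν τ ⟨hZ, hI⟩ ⟨h1, h2, h3⟩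
  refine ⟨fun a ha i => ?_, hJ ν τ hI ⟨fun a ha => h2 a fun s hs h => ?_,
    fun x hx => h3 x (by omega)⟩ h1⟩
  · rw [h2 a fun s hs h => by have := hb s hs a h; omega]
    exact hZ a (by omega) i
  · have := hb s hs a h; omega

theorem linear_color_step {I J : NState → Prop} {k a b c : ℕ} (ha : a < c) (hb : b < c)
    (hc : c = k + 1) (hc6 : 6 < c)
    (hI : ∀ ν, I ν → ν.var 2 = 4 * ν.var 0 ∧ IsMatching (4 * ν.var 0) (ν.arr a) ∧
      IsMatching (4 * ν.var 0) (ν.arr b))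
    (hJ : ∀ ν τ, I ν → Keeps k ν τ → Separates (4 * ν.var 0) (τ.arr c) (ν.arr a) →
      Separates (4 * ν.var 0) (τ.arr c) (ν.arr b) → J τ) :
    Linear (fun ν => Clean k ν ∧ I ν) (twoColor a b c) fun _ τ => Clean c τ ∧ J τ := by
  refine (linear_twoColor ha.ne' hb.ne').mono (fun ν h => ?_) ?_
  · obtain ⟨h1, h2, h3⟩ := hI ν h.2
    rw [h1]
    exact ⟨h2, h3, h.1 c (.inl (by omega))⟩
  · rintro ν τ ⟨hZ, hIν⟩ ⟨h1, h2, h3⟩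
    rw [(hI ν hIν).1] at h1
    refine ⟨fun d hd i => ?_, hJ ν τ hIν ⟨fun d hd => h2 d (by omega), fun x hx => h3 x (by omega)⟩
      (fun d hd => ⟨(h1 d hd).1, (h1 d hd).2.1⟩) fun d hd => ⟨(h1 d hd).1, (h1 d hd).2.2⟩⟩
    rw [h2 d (by omega)]
    exact hZ d (by omega) i

theorem linear_label_step {I J : NState → Prop} {k s l x : ℕ} (hs : s < l) (hl : l = k + 1)
    (hx : x = k + 2) (hl6 : 6 < l)
    (hI : ∀ ν, I ν → ∃ p : ℕ → ℕ, ∀ v < ν.var 0, ν.arr s v < ν.var 0 ∧ p (ν.arr s v) = v)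
    (hJ : ∀ ν τ, I ν → Keeps k ν τ → IsNumbering (ν.var 0) (ν.arr s) (τ.arr l) (τ.arr x) → J τ) :
    Linear (fun ν => Clean k ν ∧ I ν) (label s l x) fun _ τ => Clean x τ ∧ J τ := by
  refine (linear_label (s := s) (l := l) (x := x) (by omega) (by omega) (by omega)).mono
    (fun ν h => ⟨hI ν h.2, h.1 x (.inl (by omega))⟩) ?_
  rintro ν τ ⟨hZ, hIν⟩ ⟨h1, h2, h3⟩
  refine ⟨fun d hd i => ?_, hJ ν τ hIν ⟨fun d hd => h2 d (by omega) (by omega),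
    fun x hx => h3 x (by omega)⟩ h1⟩
  rw [h2 d (by omega) (by omega)]
  exact hZ d (by omega) i

/-! ### Persistence of the assertions under later phases -/

section

variable {k : ℕ} {ν τ : NState}

theorem Paired.keep (h : Paired ν) (hk : Keeps k ν τ) (hk20 : 20 ≤ k) : Paired τ := by
  obtain ⟨h1, h2, h3, h4⟩ := h
  rw [← hk.var 0 (by omega)] at h1 h2 h3 h4
  rw [← hk.var 2 le_rfl] at h1
  rw [← hk.var 1 (by omega), ← hk.arr 0 (by omega), ← hk.arr 1 (by omega), ← hk.arr 20 (by omega),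
    ← hk.arr 14 (by omega)] at h2
  rw [← hk.arr 18 (by omega)] at h3
  rw [← hk.arr 19 (by omega)] at h4
  exact ⟨h1, h2, h3, h4⟩

theorem Directed.keep (h : Directed ν) (hk : Keeps k ν τ) (hk21 : 21 ≤ k) : Directed τ := by
  obtain ⟨h1, h2, h3⟩ := h
  rw [← hk.var 0 (by omega), ← hk.arr 21 (by omega)] at h2 h3
  rw [← hk.arr 20 (by omega)] at h2
  rw [← hk.arr 18 (by omega)] at h3
  exact ⟨h1.keep hk (by omega), h2, h3⟩

theorem Mated.keep (h : Mated ν) (hk : Keeps k ν τ) (hk23 : 23 ≤ k) : Mated τ := by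
  obtain ⟨h1, h2, h3⟩ := h
  rw [← hk.var 0 (by omega), ← hk.arr 22 (by omega)] at h2 h3
  rw [← hk.arr 21 (by omega)] at h2
  rw [← hk.arr 23 (by omega), ← hk.arr 20 (by omega)] at h3
  exact ⟨h1.keep hk (by omega), h2, h3⟩

theorem Factored.keep (h : Factored ν) (hk : Keeps k ν τ) (hk30 : 30 ≤ k) : Factored τ := by
  unfold Factored at h ⊢
  rwa [hk.var 0 (by omega), hk.var 1 (by omega), hk.arr 0 (by omega), hk.arr 1 (by omega),
    hk.arr 25 (by omega), hk.arr 26 (by omega), hk.arr 27 (by omega), hk.arr 28 (by omega),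
    hk.arr 29 (by omega), hk.arr 30 (by omega)]

theorem Labelled.keep (h : Labelled ν) (hk : Keeps k ν τ) (hk32 : 32 ≤ k) : Labelled τ := by
  obtain ⟨h1, h2⟩ := h
  rw [← hk.var 0 (by omega), ← hk.arr 26 (by omega), ← hk.arr 31 (by omega),
    ← hk.arr 32 (by omega)] at h2
  exact ⟨h1.keep hk (by omega), h2⟩

theorem Swapped.keep (h : Swapped ν) (hk : Keeps k ν τ) (hk39 : Stage.below k swapStages = true)
    (hk32 : 32 ≤ k) : Swapped τ :=
  ⟨h.1.keep hk (by omega), hk.post hk39 h.swap⟩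

theorem LabelledOnce.keep (h : LabelledOnce ν) (hk : Keeps k ν τ)
    (hk39 : Stage.below k swapStages = true) (hk41 : 41 ≤ k) : LabelledOnce τ := by
  obtain ⟨h1, h2⟩ := h
  rw [← hk.var 0 (by omega), ← hk.arr 34 (by omega), ← hk.arr 40 (by omega),
    ← hk.arr 41 (by omega)] at h2
  exact ⟨h1.keep hk hk39 (by omega), h2⟩

theorem LabelledTwice.keep (h : LabelledTwice ν) (hk : Keeps k ν τ)
    (hk39 : Stage.below k swapStages = true) (hk43 : 43 ≤ k) : LabelledTwice τ := by
  obtain ⟨h1, h2⟩ := h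
  rw [← hk.var 0 (by omega), ← hk.arr 35 (by omega), ← hk.arr 42 (by omega),
    ← hk.arr 43 (by omega)] at h2
  exact ⟨h1.keep hk hk39 (by omega), h2⟩

theorem Cut.keep (h : Cut ν) (hk : Keeps k ν τ) (hk39 : Stage.below k swapStages = true)
    (hk52 : Stage.below k cutStages = true) (hk43 : 43 ≤ k) : Cut τ :=
  ⟨h.1.keep hk hk39 hk43, hk.post hk52 h.cut⟩

end

/-- The algorithm runs in linear time. -/
theorem linear_drawProgram :
    Linear (fun ν => Clean 6 ν ∧ IsInput (ν.var 0) (ν.var 1) (ν.arr 0) (ν.arr 1)) drawProgram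
      fun _ => Drawn := by
  have t0 : Linear (fun ν => Clean 6 ν ∧ IsInput (ν.var 0) (ν.var 1) (ν.arr 0) (ν.arr 1))
      (.assign 2 (quad (.var 0))) fun _ τ => Clean 6 τ ∧ Prepared τ := by
    refine ⟨20, fun M ν hM hν ⟨hZ, hI⟩ => ⟨ν.setVar 2 (4 * ν.var 0), ?_, hZ, ?_⟩⟩
    · have hok : (Program.assign 2 (quad (.var 0))).Ok (20 * M) ν := by
        have := hν.1 0
        refine ⟨⟨trivial, trivial, ?_⟩, ⟨trivial, trivial, ?_⟩, ?_⟩ <;> simp only [Expr.neval] <;>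
          omega
      have := (run_of_ok (hν.mono (by omega)) hok).mono (T := 20 * M)
        (by simp only [bound, quad, Expr.cost]; omega)
      simpa only [nrun, quad_neval, Expr.neval] using this
    · refine ⟨?_, by simp [NState.setVar_var]⟩
      simpa [NState.setVar_var] using hI
  have t1 := linear_stages_step (I := Prepared) (J := Paired) (k := 6) (k' := 20) wf_dartStages
    (by decide) (by omega) (by
      intro ν τ h hk hp
      have h0 : IsInput (τ.var 0) (τ.var 1) (τ.arr 0) (τ.arr 1) := by
        rw [hk.var 0 (by omega), hk.var 1 (by omega), hk.arr 0 (by omega), hk.arr 1 (by omega)]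
        exact h.1
      have h2 : τ.var 2 = 4 * τ.var 0 := by
        rw [hk.var 0 (by omega), hk.var 2 le_rfl, h.2]
      obtain ⟨h3, h4, h5⟩ := dartSpec_of_post rfl rfl h2 h0 hp
      exact ⟨h2, h3, h4, h5⟩)
  have t2 := linear_color_step (I := Paired) (J := Directed) (k := 20) (a := 20) (b := 18) (c := 21)
    (by omega) (by omega) rfl (by omega)
    (fun ν h => ⟨h.1, h.2.matching, fun d hd => by
      have h1 := flipBit_lt (N := 4 * ν.var 0) (by omega) hd
      rw [h.flip d hd, h.flip _ h1]
      exact ⟨h1, flipBit_flipBit d, flipBit_ne d⟩⟩)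
    (by
      intro ν τ h hk h1 h2
      rw [← hk.var 0 (by omega)] at h1 h2
      rw [← hk.arr 20 (by omega)] at h1
      rw [← hk.arr 18 (by omega)] at h2
      exact ⟨h.keep hk (by omega), h1, h2⟩)
  have t3 := linear_stages_step (I := Directed) (J := Mated) (k := 21) (k' := 23) wf_mateStages
    (by decide) (by omega) (by
      intro ν τ h hk hp
      have h' := h.keep hk (by omega)
      obtain ⟨h1, h2⟩ := mateSpec_of_post rfl h'.var_two h'.flip h'.turn hp
      exact ⟨h', h1, h2⟩)
  have t4 := linear_color_step (I := Mated) (J := Split) (k := 23) (a := 22) (b := 23) (c := 24)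
    (by omega) (by omega) rfl (by omega)
    (fun ν h => ⟨h.var_two, h.mate.matching, fun d hd => by
      obtain ⟨a1, a2, a3⟩ := h.darts.matching d hd
      obtain ⟨b1, b2, b3⟩ := h.mate.matching _ a1
      obtain ⟨c1, c2, c3⟩ := h.darts.matching _ b1
      rw [h.conj d hd, h.conj _ c1, c2, b2, a2]
      refine ⟨c1, rfl, fun e => b3 ?_⟩
      rw [← c2, e]⟩)
    (by
      intro ν τ h hk h1 h2
      rw [← hk.var 0 (by omega)] at h1 h2
      rw [← hk.arr 22 (by omega)] at h1
      rw [← hk.arr 23 (by omega)] at h2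
      exact ⟨h.keep hk (by omega), h1, h2⟩)
  have t5 := linear_stages_step (I := Split) (J := Factored) (k := 24) (k' := 30) wf_factorStages
    (by decide) (by omega) (by
      intro ν τ h hk hp
      have h' := h.toMated.keep hk (by omega)
      obtain ⟨-, h1, h2⟩ := h
      rw [← hk.var 0 (by omega), ← hk.arr 24 (by omega)] at h1 h2
      rw [← hk.arr 22 (by omega)] at h1
      rw [← hk.arr 23 (by omega)] at h2
      refine factorsSpec_of_post h'.var_two h'.darts h'.own h'.opp (fun d hd => ?_) h'.mate h1
        (fun d hd => ?_) hp
      · rw [← h'.flip d hd]; exact h'.turn d hd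
      · have := h2 d hd
        rwa [h'.conj d hd] at this)
  have t6 := linear_label_step (I := Factored) (J := Labelled) (k := 30) (s := 26) (l := 31)
    (x := 32) (by omega) rfl rfl (by omega)
    (fun ν h => ⟨ν.arr 30, fun v hv => ⟨h.right.s_lt v hv, h.right.p_s v hv⟩⟩)
    (by
      intro ν τ h hk h1
      rw [← hk.var 0 (by omega), ← hk.arr 26 (by omega)] at h1
      exact ⟨h.keep hk (by omega), h1⟩)
  have t7 := linear_stages_step (I := Labelled) (J := Swapped) (k := 32) (k' := 39) wf_swapStages
    (by decide) (by omega) (fun ν τ h hk hp => ⟨h.keep hk (by omega), hp⟩)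
  have t8 := linear_label_step (I := Swapped) (J := LabelledOnce) (k := 39) (s := 34) (l := 40)
    (x := 41) (by omega) rfl rfl (by omega)
    (fun ν h => by
      obtain ⟨-, ⟨S, -, -, hS, -⟩, -⟩ := exists_swap rfl h.factors h.label h.swap
      exact exists_inverse hS)
    (by
      intro ν τ h hk h1
      rw [← hk.var 0 (by omega), ← hk.arr 34 (by omega)] at h1
      exact ⟨h.keep hk (by decide) (by omega), h1⟩)
  have t9 := linear_label_step (I := LabelledOnce) (J := LabelledTwice) (k := 41) (s := 35)
    (l := 42) (x := 43) (by omega) rfl rfl (by omega)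
    (fun ν h => by
      obtain ⟨-, -, ⟨S, -, -, hS, -⟩, -⟩ := exists_swap rfl h.factors h.label h.swap
      exact exists_inverse hS)
    (by
      intro ν τ h hk h1
      rw [← hk.var 0 (by omega), ← hk.arr 35 (by omega)] at h1
      exact ⟨h.keep hk (by decide) (by omega), h1⟩)
  have t10 := linear_stages_step (I := LabelledTwice) (J := Cut) (k := 43) (k' := 52) wf_cutStages
    (by decide) (by omega) (fun ν τ h hk hp => ⟨h.keep hk (by decide) (by omega), hp⟩)
  -- Only this phase writes the low-numbered output arrays, which is why `Clean` and `Keeps` treat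
  -- the arrays `2` to `6` separately and `linear_stages_step` does not apply.
  have t11 : Linear (fun ν => Clean 52 ν ∧ Cut ν) (stages drawStages) fun _ => Drawn := by
    have hb : ∀ s ∈ drawStages, ∀ a ∈ s.writes, 52 < a ∨ 2 ≤ a ∧ a ≤ 6 := by decide
    refine (linear_stages wf_drawStages).mono (fun ν h s hs a ha => h.1 a (hb s hs a ha)) ?_
    rintro ν τ ⟨-, h⟩ ⟨h1, h2, h3⟩
    refine ⟨h.keep (k := 52) ⟨fun a ha => h2 a fun s hs h => ?_, fun x hx => h3 x (by omega)⟩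
      (by decide) (by decide) (by omega), h1⟩
    have := hb s hs a h
    omega
  exact t0.then (t1.then (t2.then (t3.then (t4.then (t5.then (t6.then (t7.then (t8.then (t9.then
    (t10.then t11))))))))))

end OneBendRAC

namespace OneBendRAC

open NState Stage Program Equiv

/-! ### The choices made by the program -/

theorem FactorsSpec.factors {n m : ℕ} {U V s₁ p₁ j₁ s₂ p₂ j₂ : ℕ → ℕ}
    (h : FactorsSpec n m U V s₁ p₁ j₁ s₂ p₂ j₂) {E : ℕ → Sym2 (Fin n)}
    (hE : ∀ e, e ≠ 0 → e ≤ m → ∃ a b : Fin n, a = U (e - 1) ∧ b = V (e - 1) ∧ E e = s(a, b)) :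
    Factors m E h.left.perm h.right.perm (fun v => j₁ v) fun v => j₂ v := by
  have mem : ∀ {s p j : ℕ → ℕ} (h : FactorSpec n m U V s p j) (v : Fin n), j v ≠ 0 →
      j v ≤ m ∧ E (j v) = s(h.perm⁻¹ v, v) := by
    intro s p j h v h0
    have hm := h.j_le v v.2
    refine ⟨hm, ?_⟩
    obtain ⟨a, b, ha, hb, e⟩ := hE _ h0 hm
    rw [e]
    rcases h.ends v v.2 h0 with ⟨h1, h2⟩ | ⟨h1, h2⟩
    · have e1 : h.perm⁻¹ v = a := Fin.ext (h1.trans ha.symm)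
      have e2 : v = b := Fin.ext (h2.trans hb.symm)
      rw [e1, ← e2]
    · have e1 : h.perm⁻¹ v = b := Fin.ext (h1.trans hb.symm)
      have e2 : v = a := Fin.ext (h2.trans ha.symm)
      rw [e1, ← e2, Sym2.eq_swap]
  refine ⟨mem h.left, mem h.right, fun u v h0 huv => Fin.ext (h.left.inj u u.2 v v.2 h0 huv),
    fun u v h0 huv => Fin.ext (h.right.inj u u.2 v v.2 h0 huv),
    fun u v h0 => h.disj u u.2 v v.2 h0, fun e he hem => ?_⟩
  rcases h.surj e he hem with ⟨v, hv, h1⟩ | ⟨v, hv, h1⟩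
  · exact .inl ⟨⟨v, hv⟩, h1⟩
  · exact .inr ⟨⟨v, hv⟩, h1⟩

/-- The arrays `A` contain the choices `c` and `cut₂`. -/
structure Encodes {n : ℕ} (A : ℕ → ℕ → ℕ) (c : Choices (Fin n)) (cut₂ : Fin n → Fin n) : Prop where
  S₁_inv : ∀ v, (c.S₁⁻¹ v : ℕ) = A 36 v
  S₂_inv : ∀ v, (c.S₂⁻¹ v : ℕ) = A 37 v
  lab₁ : ∀ v, (c.lab₁ v : ℕ) = A 40 v
  idx₁ : ∀ v, c.idx₁ v = A 41 v
  lab₂ : ∀ v, (c.lab₂ v : ℕ) = A 42 v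
  idx₂ : ∀ v, c.idx₂ v = A 43 v
  cut₁_val : ∀ v, (c.cut₁ (c.lab₁ v) : ℕ) = A 47 (c.lab₁ v)
  cut₂_val : ∀ v, (cut₂ (c.lab₂ v) : ℕ) = A 52 (c.lab₂ v)
  rv : ∀ v, c.rv v ↔ A 48 v ≠ 0
  spec : ∀ v, c.spec v ↔ A 46 v ≠ 0
  T_inv : ∀ v, (c.T⁻¹ v : ℕ) = A 49 v
  K₁ : ∀ v, c.K₁ v = A 50 v
  K₂ : ∀ v, c.K₂ v = A 51 v
  J₂ : ∀ v, c.J₂ v = A 39 v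
  idx₁_mem : ∀ v, 1 ≤ c.idx₁ v ∧ c.idx₁ v ≤ n
  idx₂_mem : ∀ v, 1 ≤ c.idx₂ v ∧ c.idx₂ v ≤ n
  lab_cut₂ : ∀ v, c.lab₂ (cut₂ (c.lab₂ v)) = c.lab₂ v
  not_whole : ∀ v, ¬ Whole c.S₂ c.T c.K₂ c.K₁ c.lab₂ (cut₂ (c.lab₂ v))

-- The arrays realise one instance of `Choices`. The only existence question left to combinatorics
-- is whether every cycle of the second factor has received a cut.
open Classical in
theorem exists_choices {A : ℕ → ℕ → ℕ} {w : ℕ → ℕ} {n m : ℕ} {U V : ℕ → ℕ} (h0 : w 0 = n)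
    (hF : FactorsSpec n m U V (A 25) (A 29) (A 27) (A 26) (A 30) (A 28))
    (hL : IsNumbering n (A 26) (A 31) (A 32)) (hs : ∀ s ∈ swapStages, s.Post A w)
    (hL₁ : IsNumbering n (A 34) (A 40) (A 41)) (hL₂ : IsNumbering n (A 35) (A 42) (A 43))
    (hc : ∀ s ∈ cutStages, s.Post A w) :
    ∃ (c : Choices (Fin n)) (cut₂ : Fin n → Fin n), Encodes A c cut₂ ∧ c.s₁ = hF.left.perm ∧
      c.s₂ = hF.right.perm ∧ c.j₁ = (fun v : Fin n => A 27 v) ∧ c.j₂ = fun v : Fin n => A 28 v := by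
  obtain ⟨hbad, ⟨S₁, a1, a2, a3, a4⟩, ⟨S₂, b1, b2, b3, b4⟩, hJ₁, hJ₂⟩ := exists_swap h0 hF hL hs
  simp only [cutStages, List.forall_mem_cons] at hc
  obtain ⟨h44, h45, h46, h47, h48, h49, h50, h51, h52, -⟩ := hc
  have hl₁ := hL₁.isLabel a3
  have hl₂ := hL₂.isLabel b3
  have hw₁ := whole_iff (A := A) (s := S₁) (t := S₂) (j := fun v => A 38 v) (k := fun v => A 39 v)
    (lab := hL₁.rep) (al := 40) (aj := 38) (ak := 39) a3 b4 (fun _ => rfl) (fun _ => rfl)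
    (fun _ => rfl)
  have e44 : ∀ v : Fin n, A 44 v = 0 ↔ ∀ u, hL₁.rep u = v →
      Whole S₁ S₂ (fun v => A 38 v) (fun v => A 39 v) hL₁.rep u := fun v => by
    rw [h44.send_one]
    constructor
    · intro h u hu
      exact (hw₁ u).2 (h u (h0 ▸ u.2) (congrArg Fin.val hu))
    · intro h i hi hiv
      rw [h0] at hi
      exact (hw₁ ⟨i, hi⟩).1 (h ⟨i, hi⟩ (Fin.ext hiv))
  have e45 : ∀ v : Fin n, A 44 v ≠ 0 → ∃ u : Fin n, A 45 v = u ∧ hL₁.rep u = v ∧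
      ¬ Whole S₁ S₂ (fun v => A 38 v) (fun v => A 39 v) hL₁.rep u := fun v hv => by
    rcases h45.send v with ⟨-, h⟩ | ⟨i, hi, h1, h2, h3⟩
    · exfalso
      refine hv ((h44.send_one v).2 fun i hi hiv hp => h i hi hp hiv)
    · rw [h0] at hi
      exact ⟨⟨i, hi⟩, h3, Fin.ext h2, fun h => (hw₁ _).1 h h1⟩
  have e46 : ∀ v : Fin n, A 46 v ≠ 0 ↔ hL₁.rep v = v ∧ ∀ u, hL₁.rep u = v →
      Whole S₁ S₂ (fun v => A 38 v) (fun v => A 39 v) hL₁.rep u := fun v => by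
    rw [← e44, h46.send_ctr (h0 ▸ v.2)]
    simp only [Test.NHolds, Expr.neval, ctr_neval, one_neval, isZero_nholds, view_var, view_arr,
      Fin.ext_iff]
    have hrep : (hL₁.rep v : ℕ) = A 40 v := rfl
    split_ifs with h
    · simpa [hrep] using h
    · simpa [hrep] using h
  have e47 : ∀ v : Fin n, A 47 v = if A 44 v = 0 then (v : ℕ) else A 45 v := fun v => by
    have := h47.select (i := v) (h0 ▸ v.2)
    simp only [Expr.neval, ctr_neval, isZero_nholds, view_var, view_arr] at this
    rw [this]
  have e48 : ∀ v : Fin n, A 48 v ≠ 0 ↔ A 46 v ≠ 0 ∧ A 41 (S₂⁻¹ v) < A 41 (S₂⁻¹ (S₂⁻¹ v)) :=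
    fun v => by
      rw [h48.send_ctr (h0 ▸ v.2)]
      simp only [b4, Test.NHolds, Test.lt_nholds, Expr.neval, ctr_neval, one_neval, isZero_nholds,
        view_var, view_arr]
      split_ifs with h
      · simpa using h
      · simpa using h
  set rv : Fin n → Prop := fun v => A 48 v ≠ 0 with hrv
  have hsel : ∀ a e f, (select 0 a (isZero (.get 48 (.get 40 ctr))) e f).Post A w → ∀ v : Fin n,
      A a v = if rv (hL₁.rep v) then f.neval (view A v) else e.neval (view A v) := by
    intro a e f hp v
    have := hp.select (i := v) (h0 ▸ v.2)
    simp only [Expr.neval, ctr_neval, view_var, view_arr, isZero_nholds] at this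
    have hr : rv (hL₁.rep v) ↔ ¬ A 48 (A 40 v) = 0 := Iff.rfl
    rw [this]
    by_cases h : A 48 (A 40 v) = 0
    · rw [if_pos h, if_neg fun h' => hr.1 h' h]
    · rw [if_neg h, if_pos (hr.2 h)]
  obtain ⟨T, t1, t2, -⟩ := exists_blend S₁⁻¹ S₁ (fun v => rv (hL₁.rep v))
    (fun v h => by rwa [hl₁.lab_inv]) (fun v h => by rwa [hl₁.lab_apply])
  have t2 : ∀ v, T⁻¹ v = if rv (hL₁.rep v) then S₁ v else S₁⁻¹ v := fun v => by
    rw [t2]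
    split_ifs
    · rw [inv_inv]
    · rfl
  have t3 : ∀ v, (T⁻¹ v : ℕ) = A 49 v := fun v => by
    rw [t2, hsel _ _ _ h49]
    split_ifs
    · exact a3 v
    · exact a4 v
  have e50 : ∀ v : Fin n, A 50 v = if rv (hL₁.rep v) then A 38 (S₁ v) else A 38 v := fun v => by
    rw [hsel _ _ _ h50, a3]; rfl
  have e51 : ∀ v : Fin n, A 51 v = if A 46 v ≠ 0 then 0 else A 39 v := fun v => by
    rw [h51.send_ctr (h0 ▸ v.2)]
    simp only [Expr.neval, ctr_neval, isZero_nholds, view_var, view_arr]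
    split_ifs <;> simp_all
  -- Only values at canonical vertices matter, where the array entry is a vertex; elsewhere `v` is a
  -- dummy value.
  set cut₁ : Fin n → Fin n := fun v => if h : A 47 v < n then ⟨A 47 v, h⟩ else v with hcut₁
  have hcut₁' : ∀ v, (cut₁ (hL₁.rep v) : ℕ) = A 47 (hL₁.rep v) := fun v => by
    have : A 47 (hL₁.rep v) < n := by
      rw [e47]
      split_ifs with h
      · exact (hL₁.rep v).2
      · obtain ⟨u, hu, -⟩ := e45 _ h
        rw [hu]; exact u.2
    simp only [hcut₁, dif_pos this]
  set c : Choices (Fin n) :=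
    { s₁ := hF.left.perm
      s₂ := hF.right.perm
      j₁ := fun v => A 27 v
      j₂ := fun v => A 28 v
      lab := hL.rep
      idx := fun v => A 32 v
      isLabel := hL.isLabel hF.right.perm_val
      bad := fun v => A 33 v = 0
      bad_iff := hbad
      S₁ := S₁
      S₂ := S₂
      S₁_apply := fun v => (a1 v).trans (by congr)
      S₂_apply := fun v => (b1 v).trans (by congr)
      S₁_inv := fun v => (a2 v).trans (by congr)
      S₂_inv := fun v => (b2 v).trans (by congr)
      J₁ := fun v => A 38 v
      J₂ := fun v => A 39 v
      J₁_eq := fun v => (hJ₁ v).trans (by congr)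
      J₂_eq := fun v => (hJ₂ v).trans (by congr)
      lab₁ := hL₁.rep
      idx₁ := fun v => A 41 v
      isLabel₁ := hl₁
      lab₂ := hL₂.rep
      idx₂ := fun v => A 43 v
      isLabel₂ := hl₂
      spec := fun v => A 46 v ≠ 0
      spec_iff := e46
      cut₁ := cut₁
      lab_cut₁ := fun v => by
        by_cases h : A 44 (hL₁.rep v) = 0
        · have : cut₁ (hL₁.rep v) = hL₁.rep v := Fin.ext (by rw [hcut₁', e47, if_pos h])
          rw [this, hl₁.lab_lab]
        · obtain ⟨u, hu, h1, -⟩ := e45 _ h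
          have : cut₁ (hL₁.rep v) = u := Fin.ext (by rw [hcut₁', e47, if_neg h, hu])
          rw [this, h1]
      cut₁_spec := fun v h => Fin.ext (by rw [hcut₁', e47, if_pos ((e44 _).2 ((e46 _).1 h).2)])
      cut₁_not_spec := fun v h => by
        have h : A 44 (hL₁.rep v) ≠ 0 := fun h' => h ((e46 _).2 ⟨hl₁.lab_lab v, (e44 _).1 h'⟩)
        obtain ⟨u, hu, -, h2⟩ := e45 _ h
        have : cut₁ (hL₁.rep v) = u := Fin.ext (by rw [hcut₁', e47, if_neg h, hu])
        rwa [this]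
      rv := rv
      rv_iff := e48
      T := T
      T_apply := fun v => (t1 v).trans (by congr)
      T_inv := fun v => (t2 v).trans (by congr)
      K₁ := fun v => A 50 v
      K₂ := fun v => A 51 v
      K₁_eq := fun v => (e50 v).trans (by congr)
      K₂_eq := fun v => (e51 v).trans (by congr) } with hcdef
  have hw₂ := whole_iff (A := A) (s := S₂) (t := T) (j := fun v => A 51 v) (k := fun v => A 50 v)
    (lab := hL₂.rep) (al := 42) (aj := 51) (ak := 50) b3 t3 (fun _ => rfl) (fun _ => rfl)
    (fun _ => rfl)
  have e52 : ∀ v : Fin n, ∃ u : Fin n, A 52 (hL₂.rep v) = u ∧ hL₂.rep u = hL₂.rep v ∧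
      ¬ Whole S₂ T (fun v => A 51 v) (fun v => A 50 v) hL₂.rep u := fun v => by
    -- The alternative that no vertex of the cycle qualified is refuted by
    -- `Choices.exists_not_whole`.
    rcases h52.send (hL₂.rep v) with ⟨-, h⟩ | ⟨i, hi, h1, h2, h3⟩
    · obtain ⟨u, h1, h2⟩ := c.exists_not_whole v
      exact (h u (h0 ▸ u.2) (not_not.1 fun h' => h2 ((hw₂ u).2 h')) (congrArg Fin.val h1)).elim
    · rw [h0] at hi
      exact ⟨⟨i, hi⟩, h3, Fin.ext h2, fun h => (hw₂ _).1 h h1⟩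
  set cut₂ : Fin n → Fin n := fun v => if h : A 52 v < n then ⟨A 52 v, h⟩ else v with hcut₂
  have hcut₂' : ∀ v u : Fin n, A 52 (hL₂.rep v) = u → cut₂ (hL₂.rep v) = u := fun v u h => by
    simp only [hcut₂, h, dif_pos u.2]
  refine ⟨c, cut₂, ⟨a4, b4, fun _ => rfl, fun _ => rfl, fun _ => rfl, fun _ => rfl, hcut₁',
    fun v => ?_, fun _ => Iff.rfl, fun _ => Iff.rfl, t3, fun _ => rfl, fun _ => rfl, fun _ => rfl,
    fun v => ⟨hL₁.idx_pos v v.2, hL₁.idx_le v v.2⟩, fun v => ⟨hL₂.idx_pos v v.2, hL₂.idx_le v v.2⟩,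
    fun v => ?_, fun v => ?_⟩, rfl, rfl, rfl, rfl⟩
  · obtain ⟨u, hu, -⟩ := e52 v
    exact (congrArg Fin.val (hcut₂' v u hu)).trans hu.symm
  · obtain ⟨u, hu, h1, -⟩ := e52 v
    change hL₂.rep (cut₂ (hL₂.rep v)) = hL₂.rep v
    rw [hcut₂' v u hu, h1]
  · obtain ⟨u, hu, -, h2⟩ := e52 v
    change ¬ Whole S₂ T (fun v => A 51 v) (fun v => A 50 v) hL₂.rep (cut₂ (hL₂.rep v))
    rwa [hcut₂' v u hu]

end OneBendRAC

namespace OneBendRAC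

open NState Stage Program Equiv

/-! ### The drawing computed by the program -/

theorem Stage.Post.puts_ctr {A : ℕ → ℕ → ℕ} {w : ℕ → ℕ} {b a : ℕ} {l : List Put}
    (h : (Stage.puts b a l).Post A w) (hl : ∀ q ∈ l, q.idx = ctr) {i : ℕ} (hi : i < w b) :
    (A a i = 0 ∧ ∀ q ∈ l, ¬ q.guard.NHolds (view A i)) ∨
      ∃ q ∈ l, q.guard.NHolds (view A i) ∧ A a i = q.val.neval (view A i) := by
  rcases h i with ⟨h0, h⟩ | ⟨j, hj, q, hq, h0, h1, h2⟩
  · exact .inl ⟨h0, fun q hq hg => h i hi q hq hg (by rw [hl q hq]; rfl)⟩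
  · rw [hl q hq] at h1
    obtain rfl : j = i := h1
    exact .inr ⟨q, hq, h0, h2⟩

open Classical in
/-- The stages `place` compute the function `place`. -/
theorem place_of_post {A : ℕ → ℕ → ℕ} {w : ℕ → ℕ} {n : ℕ} (h0 : w 0 = n)
    {al ax ai ac ao aq af out : ℕ} {rvt : Test} {s : Perm (Fin n)} {lab : Fin n → Fin n}
    {idx : Fin n → ℕ} {cut o : Fin n → Fin n} {rv : Fin n → Prop}
    (hl : ∀ v, (lab v : ℕ) = A al v) (hx : ∀ v, idx v = A ax v) (hs : ∀ v, (s⁻¹ v : ℕ) = A ai v)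
    (hc : ∀ v, (cut (lab v) : ℕ) = A ac (lab v)) (ho : ∀ v, (o v : ℕ) = A ao v)
    (hrv : ∀ v : Fin n, rvt.NHolds (view A v) ↔ rv (lab v))
    (h : ∀ t ∈ Stage.place al ax ai ac ao rvt aq af out, t.Post A w) (v : Fin n) :
    A out v = OneBendRAC.place s lab idx cut (fun r => idx (o (cut r)) < idx r) rv v := by
  simp only [Stage.place, List.forall_mem_cons] at h
  obtain ⟨h1, h2, h3, -⟩ := h
  have hv : (v : ℕ) < w 0 := h0 ▸ v.2
  have h1 := h1.puts_ctr (by simp [Put.idx]) hv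
  have h2 := h2.send_ctr hv
  have h3 := h3.puts_ctr (by simp [Put.idx]) hv
  have e1 : A ax (A al v) = idx (lab v) := by rw [hx, hl]
  have e2 : A ax (A ai (A al v)) = idx (s⁻¹ (lab v)) := by rw [hx, hs, hl]
  have e3 : A ax (A ac (A al v)) = idx (cut (lab v)) := by rw [hx, hc, hl]
  have e4 : A ax (A ao (A ac (A al v))) = idx (o (cut (lab v))) := by rw [hx, ho, hc, hl]
  have e5 : A ax v = idx v := (hx v).symm
  simp only [List.forall_mem_cons, List.exists_mem_cons_iff, Put.guard, Put.val, Test.NHolds,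
    Expr.neval, ctr_neval, one_neval, isZero_nholds, Test.lt_nholds, view_var, view_arr, e1, e2, e3,
    e4, e5, hrv, List.not_mem_nil, false_and, exists_false, or_false, false_imp_iff,
    implies_true, and_true] at h1 h2 h3
  simp only [OneBendRAC.place]
  have hq₁ : idx v ≤ idx (cut (lab v)) →
      A aq v = idx v + idx (s⁻¹ (lab v)) - idx (cut (lab v)) := by omega
  have hq₂ : ¬ idx v ≤ idx (cut (lab v)) →
      A aq v = idx v - idx (cut (lab v)) - 1 + idx (lab v) := by omega
  clear h1
  by_cases hr : rv (lab v)
  · simp only [hr, if_true, not_true, false_and, or_false, not_false_eq_true, and_true,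
      and_false] at h3 ⊢
    omega
  · simp only [hr, if_false, false_and, not_false_eq_true, true_and, and_false, false_or] at h3 ⊢
    split_ifs at h2 ⊢ <;> omega

theorem place_bounds {n : ℕ} {s : Perm (Fin n)} {lab : Fin n → Fin n} {idx : Fin n → ℕ}
    {cut : Fin n → Fin n} {left rv : Fin n → Prop} (h : IsLabel s lab idx)
    (hcut : ∀ v, lab (cut (lab v)) = lab v) (hidx : ∀ v, 1 ≤ idx v ∧ idx v ≤ n) (v : Fin n) :
    1 ≤ place s lab idx cut left rv v ∧ place s lab idx cut left rv v ≤ n := by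
  obtain ⟨h1, h2⟩ := place_mem (left := left) (rv := rv) h hcut v
  exact ⟨(hidx _).1.trans h1, h2.trans (hidx _).2⟩

/-- The number of an edge of the layout. -/
def Choices.number {n : ℕ} (c : Choices (Fin n)) : Kind → Fin n → ℕ
  | .vert, v => c.K₁ v
  | .horiz, v => c.K₂ v
  | .steep, v => c.J₂ v

/-- Bends are stored by edge number, so this is what keeps one edge from overwriting the bend of
another. Horizontal and steep edges both carry numbers of the second factor, but `spec` tells them
apart. -/
theorem Choices.number_inj {n m : ℕ} {E : ℕ → Sym2 (Fin n)} (c : Choices (Fin n))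
    (hF : Factors m E c.s₁ c.s₂ c.j₁ c.j₂) {cut₂ : Fin n → Fin n} {k k' : Kind} {v v' : Fin n}
    (h : (c.layout cut₂).real k v) (h' : (c.layout cut₂).real k' v')
    (hn : c.number k v = c.number k' v') : k = k' ∧ v = v' := by
  have F := c.factors hF
  have hK : ∀ v, c.K₂ v ≠ 0 → c.K₂ v = c.J₂ v ∧ ¬ c.spec v := fun v hv => by
    rw [c.K₂_eq] at hv ⊢
    split_ifs at hv ⊢ with hs
    · exact (hv rfl).elim
    · exact ⟨rfl, hs⟩
  have hS : ∀ v, c.spec v → c.J₂ v ≠ 0 := fun v hv => by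
    obtain ⟨h1, h2⟩ := (c.spec_iff v).1 hv
    exact (h2 v h1).2.1
  cases k <;> cases k' <;> simp only [Choices.number] at hn
  · exact ⟨rfl, F.inj₁ v v' h hn⟩
  · exact (F.disj v v' h (hn.trans (hK v' h').1)).elim
  · exact (F.disj v v' h hn).elim
  · exact (F.disj v' v h' (hn.symm.trans (hK v h).1)).elim
  · refine ⟨rfl, F.inj₂ v v' ?_ ?_⟩
    · rw [← (hK v h).1]; exact h
    · rw [← (hK v h).1, ← (hK v' h').1, hn]
  · obtain ⟨h1, h2⟩ := hK v h
    obtain rfl := F.inj₂ v v' (h1 ▸ h) (h1 ▸ hn)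
    exact (h2 h').elim
  · exact (F.disj v' v h' hn.symm).elim
  · obtain ⟨h1, h2⟩ := hK v' h'
    obtain rfl := F.inj₂ v' v (h1 ▸ h') (h1 ▸ hn.symm)
    exact (h2 h).elim
  · exact ⟨rfl, F.inj₂ v v' (hS v h) hn⟩

/-- Coordinates and bends in the final arrays. -/
theorem drawn_spec {A : ℕ → ℕ → ℕ} {w : ℕ → ℕ} {n m : ℕ} {E : ℕ → Sym2 (Fin n)} (h0 : w 0 = n)
    (h1 : w 1 = m) {c : Choices (Fin n)} {cut₂ : Fin n → Fin n} (hc : Encodes A c cut₂)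
    (hF : Factors m E c.s₁ c.s₂ c.j₁ c.j₂) (h : ∀ s ∈ drawStages, s.Post A w) :
    (∀ v : Fin n, ((A 2 v : ℤ), (A 3 v : ℤ)) = (c.layout cut₂).pos v) ∧
    (∀ v : Fin n, 1 ≤ (c.layout cut₂).X v ∧ (c.layout cut₂).X v ≤ n ∧ 1 ≤ (c.layout cut₂).Y v ∧
      (c.layout cut₂).Y v ≤ n) ∧
    (∀ k v, (c.layout cut₂).real k v →
      ((A 59 (c.number k v) : ℤ), (A 60 (c.number k v) : ℤ)) = (c.layout cut₂).bend k v) ∧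
    ∀ j < m, A 4 j = 1 ∧ A 5 j = A 59 (j + 1) ∧ A 6 j = A 60 (j + 1) := by
  simp only [drawStages, List.forall_mem_append, List.forall_mem_cons] at h
  obtain ⟨hX, hY, h2, h3, h59, h60, h4, h5, h6, -⟩ := h
  set Λ := c.layout cut₂ with hΛ
  have eX : ∀ v : Fin n, (A 55 v : ℤ) = Λ.X v := fun v => by
    rw [place_of_post h0 hc.lab₁ hc.idx₁ hc.S₁_inv hc.cut₁_val hc.S₂_inv (fun v => ?_) hX v]
    · rfl
    · simp only [Test.NHolds, isZero_nholds, Expr.neval, ctr_neval, view_var, view_arr, hc.rv,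
        hc.lab₁, ne_eq]
  have eY : ∀ v : Fin n, (A 58 v : ℤ) = Λ.Y v := fun v => by
    rw [place_of_post (rv := fun _ => False) h0 hc.lab₂ hc.idx₂ hc.S₂_inv hc.cut₂_val hc.T_inv
      (fun v => ?_) hY v]
    · rfl
    · simp [Test.NHolds, always_nholds]
  have bX : ∀ v, 1 ≤ Λ.X v ∧ Λ.X v ≤ n := fun v => by
    obtain ⟨k1, k2⟩ := place_bounds (left := fun r => c.idx₁ (c.S₂⁻¹ (c.cut₁ r)) < c.idx₁ r)
      (rv := c.rv) c.isLabel₁ c.lab_cut₁ hc.idx₁_mem v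
    exact ⟨Nat.one_le_cast.2 k1, Nat.cast_le.2 k2⟩
  have bY : ∀ v, 1 ≤ Λ.Y v ∧ Λ.Y v ≤ n := fun v => by
    obtain ⟨k1, k2⟩ := place_bounds (left := fun r => c.idx₂ (c.T⁻¹ (cut₂ r)) < c.idx₂ r)
      (rv := fun _ => False) c.isLabel₂ hc.lab_cut₂ hc.idx₂_mem v
    exact ⟨Nat.one_le_cast.2 k1, Nat.cast_le.2 k2⟩
  have eP : ∀ v : Fin n, A 49 v = Λ.p v := fun v => (hc.T_inv v).symm
  have eQ : ∀ v : Fin n, A 37 v = Λ.q v := fun v => (hc.S₂_inv v).symm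
  have real1 : ∀ v : Fin n, Λ.real .vert v ↔ A 50 v ≠ 0 := fun v => by rw [← hc.K₁]; rfl
  have real2 : ∀ v : Fin n, Λ.real .horiz v ↔ A 51 v ≠ 0 := fun v => by rw [← hc.K₂]; rfl
  have real3 : ∀ v : Fin n, Λ.real .steep v ↔ A 46 v ≠ 0 := fun v => hc.spec v
  have hAX : ∀ v, Λ.AdjX v ↔ A 55 (Λ.p v) = A 55 v + 1 ∨ A 55 v = A 55 (Λ.p v) + 1 := fun v => by
    simp only [Layout.AdjX, ← eX]; norm_cast
  have hAY : ∀ v, Λ.AdjY v ↔ A 58 (Λ.q v) = A 58 v + 1 ∨ A 58 v = A 58 (Λ.q v) + 1 := fun v => by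
    simp only [Layout.AdjY, ← eY]; norm_cast
  refine ⟨fun v => ?_, fun v => ⟨(bX v).1, (bX v).2, bY v⟩, fun k v hr => ?_, fun j hj => ?_⟩
  · have k2 := h2.map (i := v) (h0 ▸ v.2)
    have k3 := h3.map (i := v) (h0 ▸ v.2)
    simp only [triple_neval, Expr.neval, ctr_neval, view_var, view_arr] at k2 k3
    rw [k2, k3]
    push_cast
    rw [eX, eY]
    rfl
  · have hv : (v : ℕ) < w 0 := h0 ▸ v.2
    -- Whoever wrote the cell of this number is the edge itself, so only the formula for its own
    -- kind remains to be compared.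
    have inj := fun k' (v' : Fin n) (hr' : Λ.real k' v') (e : c.number k' v' = c.number k v) =>
      c.number_inj hF hr' hr e
    -- Positions start at one, so the guard `y ≤ x` of the `diff` stores that subtract an offset is
    -- always satisfied.
    have xq := (bX (Λ.q v)).1
    have yp := (bY (Λ.p v)).1
    rw [← eX] at xq
    rw [← eY] at yp
    refine Prod.ext ?_ ?_
    · change (A 59 (c.number k v) : ℤ) = (Λ.bend k v).1
      rcases h59 (c.number k v) with ⟨-, hno⟩ | ⟨i, hi, q, hq, g1, g2, g3⟩
      · exfalso
        have hno := hno v hv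
        simp only [List.forall_mem_cons, Put.guard, Put.idx, Test.NHolds, Test.or_nholds,
          Test.lt_nholds, isZero_nholds, triple_neval, one_neval, Expr.neval, ctr_neval, view_var,
          view_arr, eQ, ← hAY] at hno
        obtain ⟨n1, n2, n3, n4, n5, -⟩ := hno
        cases k
        · exact n1 ((real1 v).1 hr) (hc.K₁ v).symm
        · have hr' := (real2 v).1 hr
          have e := (hc.K₂ v).symm
          by_cases ha : Λ.AdjY v
          · by_cases hlt : A 55 (Λ.q v) < A 55 v
            · exact n2 ⟨hr', ha, hlt⟩ e
            · exact n3 ⟨by omega, hr', ha, hlt⟩ e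
          · exact n4 ⟨hr', ha⟩ e
        · exact n5 ((real3 v).1 hr) (hc.J₂ v).symm
      · rw [h0] at hi
        obtain ⟨u, rfl⟩ : ∃ u : Fin n, (u : ℕ) = i := ⟨⟨i, hi⟩, rfl⟩
        simp only [List.mem_cons, List.not_mem_nil, or_false] at hq
        have n1 := fun g e => inj .vert u ((real1 u).2 g) ((hc.K₁ u).trans e)
        have n2 := fun g e => inj .horiz u ((real2 u).2 g) ((hc.K₂ u).trans e)
        have n3 := fun g e => inj .steep u ((real3 u).2 g) ((hc.J₂ u).trans e)
        rcases hq with rfl | rfl | rfl | rfl | rfl <;>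
          simp only [Put.guard, Put.idx, Put.val, Test.NHolds, Test.or_nholds, Test.lt_nholds,
            isZero_nholds, triple_neval, one_neval, Expr.neval, ctr_neval, view_var, view_arr, eQ,
            ← hAY] at g1 g2 g3
        · obtain ⟨rfl, rfl⟩ := n1 g1 g2
          rw [g3]; push_cast; rw [eX]; rfl
        · obtain ⟨rfl, rfl⟩ := n2 g1.1 g2
          rw [g3]
          simp only [Layout.bend, Layout.offX, if_pos g1.2.1, ← eX]
          rw [if_pos (by exact_mod_cast g1.2.2)]; push_cast; rfl
        · obtain ⟨rfl, rfl⟩ := n2 g1.2.1 g2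
          rw [g3]
          simp only [Layout.bend, Layout.offX, if_pos g1.2.2.1, ← eX]
          rw [if_neg (by exact_mod_cast g1.2.2.2)]; push_cast [g1.1]; rfl
        · obtain ⟨rfl, rfl⟩ := n2 g1.1 g2
          rw [g3]
          simp only [Layout.bend, Layout.offX, if_neg g1.2, ← eX]
          push_cast; ring
        · obtain ⟨rfl, rfl⟩ := n3 g1 g2
          rw [g3]; push_cast; rw [eX]; rfl
    · change (A 60 (c.number k v) : ℤ) = (Λ.bend k v).2
      rcases h60 (c.number k v) with ⟨-, hno⟩ | ⟨i, hi, q, hq, g1, g2, g3⟩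
      · exfalso
        have hno := hno v hv
        simp only [List.forall_mem_cons, Put.guard, Put.idx, Test.NHolds, Test.or_nholds,
          Test.lt_nholds, isZero_nholds, triple_neval, one_neval, Expr.neval, ctr_neval, view_var,
          view_arr, eP, ← hAX] at hno
        obtain ⟨n2, n3, n4, n1, n5, -⟩ := hno
        cases k
        · have hr' := (real1 v).1 hr
          have e := (hc.K₁ v).symm
          by_cases ha : Λ.AdjX v
          · by_cases hlt : A 58 (Λ.p v) < A 58 v
            · exact n2 ⟨hr', ha, hlt⟩ e
            · exact n3 ⟨by omega, hr', ha, hlt⟩ e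
          · exact n4 ⟨hr', ha⟩ e
        · exact n1 ((real2 v).1 hr) (hc.K₂ v).symm
        · exact n5 ((real3 v).1 hr) (hc.J₂ v).symm
      · rw [h0] at hi
        obtain ⟨u, rfl⟩ : ∃ u : Fin n, (u : ℕ) = i := ⟨⟨i, hi⟩, rfl⟩
        simp only [List.mem_cons, List.not_mem_nil, or_false] at hq
        have n1 := fun g e => inj .vert u ((real1 u).2 g) ((hc.K₁ u).trans e)
        have n2 := fun g e => inj .horiz u ((real2 u).2 g) ((hc.K₂ u).trans e)
        have n3 := fun g e => inj .steep u ((real3 u).2 g) ((hc.J₂ u).trans e)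
        rcases hq with rfl | rfl | rfl | rfl | rfl <;>
          simp only [Put.guard, Put.idx, Put.val, Test.NHolds, Test.or_nholds, Test.lt_nholds,
            isZero_nholds, triple_neval, one_neval, Expr.neval, ctr_neval, view_var, view_arr, eP,
            eQ, ← hAX] at g1 g2 g3
        · obtain ⟨rfl, rfl⟩ := n1 g1.1 g2
          rw [g3]
          simp only [Layout.bend, Layout.offY, if_pos g1.2.1, ← eY]
          rw [if_pos (by exact_mod_cast g1.2.2)]; push_cast; rfl
        · obtain ⟨rfl, rfl⟩ := n1 g1.2.1 g2
          rw [g3]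
          simp only [Layout.bend, Layout.offY, if_pos g1.2.2.1, ← eY]
          rw [if_neg (by exact_mod_cast g1.2.2.2)]; push_cast [g1.1]; rfl
        · obtain ⟨rfl, rfl⟩ := n1 g1.1 g2
          rw [g3]
          simp only [Layout.bend, Layout.offY, if_neg g1.2, ← eY]
          push_cast; ring
        · obtain ⟨rfl, rfl⟩ := n2 g1 g2
          rw [g3]; push_cast; rw [eY]; rfl
        · obtain ⟨rfl, rfl⟩ := n3 g1 g2
          rw [g3]; push_cast; rw [eY]; rfl
  · have k4 := h4.map (i := j) (h1 ▸ hj)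
    have k5 := h5.map (i := j) (h1 ▸ hj)
    have k6 := h6.map (i := j) (h1 ▸ hj)
    exact ⟨k4, k5, k6⟩

end OneBendRAC

namespace OneBendRAC

open NState Program

/-! ### Correctness -/

theorem IsEdgeList.adj {V : Type*} {G : SimpleGraph V} {L : List (V × V)} (h : IsEdgeList G L)
    {j : ℕ} (hj : j < L.length) : G.Adj L[j].1 L[j].2 :=
  (h.2 _ _).2 (List.mem_map.2 ⟨L[j], List.getElem_mem hj, rfl⟩)

theorem IsEdgeList.inj {V : Type*} {G : SimpleGraph V} {L : List (V × V)} (h : IsEdgeList G L)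
    {i j : ℕ} (hi : i < L.length) (hj : j < L.length)
    (hij : s(L[i].1, L[i].2) = s(L[j].1, L[j].2)) : i = j :=
  (h.1.getElem_inj_iff (hi := by simpa using hi) (hj := by simpa using hj)).1 (by simpa using hij)

theorem IsEdgeList.exists_index {V : Type*} {G : SimpleGraph V} {L : List (V × V)}
    (h : IsEdgeList G L) {u v : V} (huv : G.Adj u v) :
    ∃ (j : ℕ) (hj : j < L.length), s(u, v) = s(L[j].1, L[j].2) := by
  obtain ⟨e, he, h1⟩ := List.mem_map.1 ((h.2 u v).1 huv)
  obtain ⟨j, hj, rfl⟩ := List.getElem_of_mem he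
  exact ⟨j, hj, h1.symm⟩

theorem IsEdgeList.length_le {n : ℕ} {G : SimpleGraph (Fin n)} [DecidableRel G.Adj]
    {L : List (Fin n × Fin n)} (h : IsEdgeList G L) (hG : G.maxDegree ≤ 4) :
    L.length ≤ 2 * n := by
  have h1 : L.length ≤ G.edgeFinset.card := by
    rw [← List.length_map (as := L) fun e => s(e.1, e.2), ← List.toFinset_card_of_nodup h.1]
    refine Finset.card_le_card fun e he => ?_
    induction e with
    | h u v => rw [List.mem_toFinset, ← h.2] at he; simpa using he
  have h2 := G.sum_degrees_eq_twice_card_edges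
  have h3 : ∑ v, G.degree v ≤ ∑ _v : Fin n, 4 :=
    Finset.sum_le_sum fun v _ => (G.degree_le_maxDegree v).trans hG
  simp only [Finset.sum_const, Finset.card_univ, Fintype.card_fin, smul_eq_mul] at h3
  omega

-- Counting occurrences as first and as second end never counts an edge twice, since there are no
-- loops; the edge list then maps injectively into the edges at `v`.
open Classical in
theorem IsEdgeList.tally_le {n : ℕ} {G : SimpleGraph (Fin n)} [DecidableRel G.Adj]
    {L : List (Fin n × Fin n)} (h : IsEdgeList G L) {U V : ℕ → ℕ}
    (hU : ∀ (j : ℕ) (hj : j < L.length), U j = L[j].1)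
    (hV : ∀ (j : ℕ) (hj : j < L.length), V j = L[j].2) (v : Fin n) :
    tally (fun j => U j = v) L.length + tally (fun j => V j = v) L.length ≤ G.degree v := by
  simp only [tally, Nat.count_eq_card_filter_range]
  rw [← Finset.card_union_of_disjoint, ← G.card_incidenceFinset_eq_degree v]
  · refine Finset.card_le_card_of_injOn
      (fun j => if hj : j < L.length then s(L[j].1, L[j].2) else s(v, v)) (fun j hj => ?_)
      fun i hi j hj hij => ?_
    · simp only [Finset.coe_union, Finset.coe_filter, Finset.mem_range, Set.mem_union,
        Set.mem_ofPred_eq] at hj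
      have hlt : j < L.length := by tauto
      rw [hU j hlt, hV j hlt] at hj
      simp only [hlt, dif_pos, Finset.mem_coe, SimpleGraph.mem_incidenceFinset]
      refine ⟨h.adj hlt, Sym2.mem_iff.2 (hj.imp (fun h => (Fin.ext h.2).symm)
        fun h => (Fin.ext h.2).symm)⟩
    · simp only [Finset.coe_union, Finset.coe_filter, Finset.mem_range, Set.mem_union,
        Set.mem_ofPred_eq] at hi hj
      have hi : i < L.length := by tauto
      have hj : j < L.length := by tauto
      simp only [hi, hj, dif_pos] at hij
      exact h.inj hi hj hij
  · refine Finset.disjoint_left.2 fun j hj hj' => ?_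
    simp only [Finset.mem_filter, Finset.mem_range] at hj hj'
    rw [hU j hj.1] at hj
    rw [hV j hj.1] at hj'
    exact (h.adj hj.1).ne (Fin.ext (hj.2.trans hj'.2.symm))

/-- The initial memory. -/
def NState.input (n : ℕ) (L : List (Fin n × Fin n)) : NState where
  var x := if x = 0 then n else if x = 1 then L.length else 0
  arr a j :=
    if h : j < L.length then if a = 0 then L[j].1 else if a = 1 then L[j].2 else 0 else 0

theorem NState.toState_input (n : ℕ) (L : List (Fin n × Fin n)) :
    (NState.input n L).toState = inputState n L := by
  simp only [toState, NState.input, inputState, State.mk.injEq]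
  refine ⟨?_, ?_⟩
  · funext x; split_ifs <;> rfl
  · funext a j; split_ifs <;> rfl

theorem NState.input_left {n : ℕ} {L : List (Fin n × Fin n)} (j : ℕ) (hj : j < L.length) :
    (NState.input n L).arr 0 j = L[j].1 := by simp [NState.input, hj]

theorem NState.input_right {n : ℕ} {L : List (Fin n × Fin n)} (j : ℕ) (hj : j < L.length) :
    (NState.input n L).arr 1 j = L[j].2 := by simp [NState.input, hj]

theorem NState.input_bdd {n : ℕ} {L : List (Fin n × Fin n)} (h : L.length ≤ 2 * n) :
    (NState.input n L).Bdd (2 * (n + 1)) := by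
  refine ⟨fun x => ?_, fun a j => ?_⟩ <;> simp only [NState.input] <;> split_ifs <;> omega

theorem NState.input_clean (n : ℕ) (L : List (Fin n × Fin n)) : Clean 6 (NState.input n L) := by
  intro a ha j
  simp only [NState.input]
  split_ifs <;> omega

theorem NState.input_isInput {n : ℕ} {G : SimpleGraph (Fin n)} [DecidableRel G.Adj]
    {L : List (Fin n × Fin n)} (h : IsEdgeList G L) (hG : G.maxDegree ≤ 4) :
    IsInput n L.length ((NState.input n L).arr 0) ((NState.input n L).arr 1) where
  left_lt j hj := by rw [input_left j hj]; exact L[j].1.2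
  right_lt j hj := by rw [input_right j hj]; exact L[j].2.2
  degree v hv := (h.tally_le input_left input_right ⟨v, hv⟩).trans
    ((G.degree_le_maxDegree _).trans hG)

theorem Layout.bend_bounds {n : ℕ} (Λ : Layout n)
    (h : ∀ v, 1 ≤ Λ.X v ∧ Λ.X v ≤ n ∧ 1 ≤ Λ.Y v ∧ Λ.Y v ≤ n) (k : Kind) (v : Fin n) :
    0 ≤ (Λ.bend k v).1 ∧ (Λ.bend k v).1 ≤ 3 * n + 2 ∧ 0 ≤ (Λ.bend k v).2 ∧
      (Λ.bend k v).2 ≤ 3 * n + 2 := by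
  have hv := h v
  have hp := h (Λ.p v)
  have hq := h (Λ.q v)
  have hx : -1 ≤ Λ.offX v ∧ Λ.offX v ≤ 1 := by unfold Layout.offX; split_ifs <;> omega
  have hy : -1 ≤ Λ.offY v ∧ Λ.offY v ≤ 1 := by unfold Layout.offY; split_ifs <;> omega
  cases k <;> simp only [Layout.bend] <;> omega

open Classical in
/-- The final arrays describe a 1-bend RAC drawing. -/
theorem exists_drawing {n : ℕ} {G : SimpleGraph (Fin n)} {L : List (Fin n × Fin n)}
    (hL : IsEdgeList G L) {τ : NState} (hD : Drawn τ) (h0 : τ.var 0 = n) (h1 : τ.var 1 = L.length)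
    (hU : ∀ (j : ℕ) (hj : j < L.length), τ.arr 0 j = L[j].1)
    (hV : ∀ (j : ℕ) (hj : j < L.length), τ.arr 1 j = L[j].2) :
    ∃ Γ : Drawing (Fin n), Outputs τ.toState L Γ ∧ Γ.IsOneBendRAC G ∧
      Γ.HasAreaAtMost G (9 * (n + 1) ^ 2) := by
  -- The empty graph is treated apart because the enumeration of edges below needs a vertex for its
  -- dummy value.
  rcases isEmpty_or_nonempty (Fin n) with hn | ⟨⟨v₀⟩⟩
  · refine ⟨⟨fun v => hn.elim v, fun _ => none⟩, ⟨fun v => hn.elim v, fun j hj => hn.elim L[j].1⟩,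
      ⟨fun v => hn.elim v, fun v => hn.elim v, fun v => hn.elim v, fun v => hn.elim v,
        fun v => hn.elim v⟩, 0, 0, 0, 0, fun v => hn.elim v, fun v => hn.elim v, by nlinarith⟩
  -- Edges are numbered from `1`, the number `0` being reserved for dummy edges.
  let E : ℕ → Sym2 (Fin n) := fun e =>
    if h : e - 1 < L.length then s(L[e - 1].1, L[e - 1].2) else s(v₀, v₀)
  have hE : ∀ j (hj : j < L.length), E (j + 1) = s(L[j].1, L[j].2) := fun j hj => by
    simp only [E, Nat.add_sub_cancel, hj, dif_pos]
  have hE' : ∀ e, e ≠ 0 → e ≤ L.length → ∃ j, ∃ _ : j < L.length, e = j + 1 :=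
    fun e he hem => ⟨e - 1, by omega, by omega⟩
  have hF : FactorsSpec n L.length (τ.arr 0) (τ.arr 1) (τ.arr 25) (τ.arr 29) (τ.arr 27) (τ.arr 26)
      (τ.arr 30) (τ.arr 28) := by
    have := hD.factors; unfold Factored at this; rwa [h0, h1] at this
  have hlab := hD.label
  have hlab₁ := hD.label₁
  have hlab₂ := hD.label₂
  rw [h0] at hlab hlab₁ hlab₂
  have hf := hF.factors (E := E) fun e he hem => by
    obtain ⟨j, hj, rfl⟩ := hE' e he hem
    exact ⟨L[j].1, L[j].2, (hU j hj).symm, (hV j hj).symm, hE j hj⟩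
  obtain ⟨c, cut₂, hc, e1, e2, e3, e4⟩ := exists_choices h0 hF hlab hD.swap hlab₁ hlab₂ hD.cut
  rw [← e1, ← e2, ← e3, ← e4] at hf
  obtain ⟨hpos, hbd, hbend, hout⟩ := drawn_spec h0 h1 hc hf hD.draw
  have hgood : (c.layout cut₂).Good := c.layout_good hf
    (fun e he hem => by
      obtain ⟨j, hj, rfl⟩ := hE' e he hem
      rw [hE j hj, Sym2.mk_isDiag_iff]
      exact (hL.adj hj).ne)
    (fun e f he hem hf hfm hef => by
      obtain ⟨i, hi, rfl⟩ := hE' e he hem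
      obtain ⟨j, hj, rfl⟩ := hE' f hf hfm
      rw [hE i hi, hE j hj] at hef
      rw [hL.inj hi hj hef]) hc.lab_cut₂ hc.not_whole
  have hreal : ∀ j (hj : j < L.length), ∃ k v, (c.layout cut₂).real k v ∧
      s(L[j].1, L[j].2) = s((c.layout cut₂).tail k v, v) ∧ c.number k v = j + 1 := fun j hj => by
    obtain ⟨k, v, hr, he, hk⟩ := c.exists_real hf cut₂ (e := j + 1) (by omega) (by omega)
    refine ⟨k, v, hr, (hE j hj).symm.trans he, ?_⟩
    rcases hk with ⟨rfl, h⟩ | ⟨rfl, h⟩ | ⟨rfl, h⟩ <;> exact h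
  let b : ℕ → GridPoint := fun j => ((τ.arr 5 j : ℤ), (τ.arr 6 j : ℤ))
  have hb : ∀ j (_ : j < L.length) k v, (c.layout cut₂).real k v → c.number k v = j + 1 →
      b j = (c.layout cut₂).bend k v := fun j hj k v hr hk => by
    obtain ⟨-, h5, h6⟩ := hout j hj
    simp only [b, h5, h6]
    rw [← hk, hbend k v hr]
  -- The chosen index is unique because the list contains each edge once. Every edge of this drawing
  -- has a bend.
  let Γ : Drawing (Fin n) := ⟨fun v => ((τ.arr 2 v : ℤ), (τ.arr 3 v : ℤ)), fun e =>
    if h : ∃ j, j < L.length ∧ E (j + 1) = e then some (b h.choose) else none⟩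
  have hΓ : ∀ j (hj : j < L.length), Γ.bend s(L[j].1, L[j].2) = some (b j) := fun j hj => by
    have h : ∃ i, i < L.length ∧ E (i + 1) = s(L[j].1, L[j].2) := ⟨j, hj, hE j hj⟩
    have h2 := h.choose_spec
    rw [hE _ h2.1] at h2
    simp only [Γ, dif_pos h, hL.inj h2.1 hj h2.2]
  have hnum : ∀ k v, (c.layout cut₂).real k v → ∃ j, ∃ hj : j < L.length,
      s((c.layout cut₂).tail k v, v) = s(L[j].1, L[j].2) ∧ c.number k v = j + 1 := fun k v hr => by
    have F := c.factors hf
    obtain ⟨g0, g1, g2⟩ : c.number k v ≠ 0 ∧ c.number k v ≤ L.length ∧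
        E (c.number k v) = s((c.layout cut₂).tail k v, v) := by
      cases k with
      | vert => exact ⟨hr, F.mem₁ v hr⟩
      | horiz =>
        have hr : c.K₂ v ≠ 0 := hr
        have hK : c.K₂ v = c.J₂ v := by
          rw [c.K₂_eq] at hr ⊢
          split_ifs at hr ⊢
          · exact (hr rfl).elim
          · rfl
        change c.K₂ v ≠ 0 ∧ c.K₂ v ≤ _ ∧ E (c.K₂ v) = _
        rw [hK] at hr ⊢
        exact ⟨hr, F.mem₂ v hr⟩
      | steep =>
        obtain ⟨k1, k2⟩ := (c.spec_iff v).1 hr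
        have hJ : c.J₂ v ≠ 0 := (k2 v k1).2.1
        exact ⟨hJ, F.mem₂ v hJ⟩
    obtain ⟨j, hj, hk⟩ := hE' _ g0 g1
    exact ⟨j, hj, by rw [← g2, hk, hE j hj], hk⟩
  have hΓb : ∀ k v, (c.layout cut₂).real k v →
      Γ.bend s((c.layout cut₂).tail k v, v) = some ((c.layout cut₂).bend k v) := fun k v hr => by
    obtain ⟨j, hj, g1, g2⟩ := hnum k v hr
    rw [g1, hΓ j hj, hb j hj k v hr g2]
  have hadj : ∀ u v, G.Adj u v → ∃ k w, (c.layout cut₂).real k w ∧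
      s(u, v) = s((c.layout cut₂).tail k w, w) := fun u v huv => by
    obtain ⟨j, hj, e⟩ := hL.exists_index huv
    obtain ⟨k, w, hr, hk, -⟩ := hreal j hj
    exact ⟨k, w, hr, e.trans hk⟩
  -- Vertices have coordinates from `3` to `3 * n` and bends exceed this range by at most one, so a
  -- square of side `3 * n + 2` at the origin suffices; it has `9 * (n + 1) ^ 2` grid points.
  refine ⟨Γ, ⟨fun v => rfl, fun j hj => ?_⟩, Layout.isOneBendRAC hgood hpos hΓb hadj,
    0, 0, 3 * n + 2, 3 * n + 2, fun v => ?_, fun u v p huv hp => ?_, by nlinarith⟩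
  · have h4 : τ.toState.arr 4 j ≠ 0 := by simp [toState, (hout j hj).1]
    rw [hΓ j hj, if_neg h4]
    rfl
  · have h := hbd v
    rw [show Γ.pos v = (c.layout cut₂).pos v from hpos v]
    simp only [Layout.pos, Set.mem_prod, Set.mem_Icc]
    push_cast
    omega
  · obtain ⟨k, w, hr, e⟩ := hadj u v huv
    rw [e, hΓb k w hr, Option.some_inj] at hp
    have h := (c.layout cut₂).bend_bounds hbd k w
    rw [← hp]
    simp only [Set.mem_prod, Set.mem_Icc]
    push_cast
    omega

/-- The final assertions speak of the final arrays; since the input is never overwritten, these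
still contain the given edge list. -/
theorem arrs_drawProgram : 0 ∉ drawProgram.arrs ∧ 1 ∉ drawProgram.arrs := by decide

theorem vars_drawProgram : 0 ∉ drawProgram.vars ∧ 1 ∉ drawProgram.vars := by decide

end OneBendRAC

theorem mainTheorem4 :
    ∃ (P : OneBendRAC.Program) (C : ℕ),
      ∀ (n : ℕ) (G : SimpleGraph (Fin n)) [DecidableRel G.Adj] (L : List (Fin n × Fin n)),
        G.maxDegree ≤ 4 → OneBendRAC.IsEdgeList G L →
          ∃ (t : ℕ) (σ : OneBendRAC.State) (Γ : OneBendRAC.Drawing (Fin n)),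
            OneBendRAC.Exec (C * (n + 1)) P (OneBendRAC.inputState n L) t σ ∧
            t ≤ C * (n + 1) ∧
            OneBendRAC.Outputs σ L Γ ∧
            Γ.IsOneBendRAC G ∧
            Γ.HasAreaAtMost G (C * (n + 1) ^ 2) := by
  obtain ⟨K, hK⟩ := OneBendRAC.linear_drawProgram
  -- A graph of maximum degree four has at most `2 * n` edges, so the initial words are at most `2 *
  -- (n + 1)`, which gives `2 * K`; the summand `9` pays for the area.
  refine ⟨OneBendRAC.drawProgram, 2 * K + 9, fun n G _ L hG hL => ?_⟩
  have hm := hL.length_le hG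
  have hI := OneBendRAC.NState.input_isInput hL hG
  obtain ⟨τ, hτ, hD⟩ := hK (2 * (n + 1)) (.input n L) (by omega)
    (OneBendRAC.NState.input_bdd hm) ⟨OneBendRAC.NState.input_clean n L, hI⟩
  obtain ⟨t, ht, hex⟩ := hτ.exec
  rw [OneBendRAC.NState.toState_input] at hex
  have hle : K * (2 * (n + 1)) ≤ (2 * K + 9) * (n + 1) := by nlinarith
  have ha := hτ.frame.arr
  have hv := hτ.frame.var
  obtain ⟨Γ, hΓ, hR, x₀, y₀, w, h, hA⟩ := OneBendRAC.exists_drawing hL hD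
    (hv 0 OneBendRAC.vars_drawProgram.1) (hv 1 OneBendRAC.vars_drawProgram.2)
    (fun j hj => by
      rw [ha 0 OneBendRAC.arrs_drawProgram.1]; exact OneBendRAC.NState.input_left j hj)
    (fun j hj => by
      rw [ha 1 OneBendRAC.arrs_drawProgram.2]; exact OneBendRAC.NState.input_right j hj)
  exact ⟨t, τ.toState, Γ, hex.mono hle, ht.trans hle, hΓ, hR, x₀, y₀, w, h, hA.1, hA.2.1,
    hA.2.2.trans (by gcongr; omega)⟩
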